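/- Let $q$ be a power of an odd prime, $n\ge 0$, $G=UT_{2n}(\mathbb F_q)$ the group of upper unitriangular $2n\times 2n$ matrices and $\mathfrak g=\mathfrak{ut}_{2n}(\mathbb F_q)$ the algebra of strictly upper triangular matrices. Let $\Omega=\begin{pmatrix}0&-J\\J&0\end{pmatrix}$, where $J$ is the $n\times n$ matrix with ones on the antidiagonal and zeroes elsewhere, put $x^\dagger=-\Omega x^t\Omega$, and let $$U=USp_{2n}(\mathbb F_q)=\{u\in G: u^{-1}=u^\dagger\},\qquad \mathfrak u=\mathfrak{usp}_{2n}(\mathbb F_q)=\{x\in\mathfrak g: x^\dagger=-x\}.$$ A supercharacter theory of a finite group is a pair $(\mathcal K,\mathcal X)$, where $\mathcal K$ is a partition of the group into unions of conjugacy classes and $\mathcal X$ is a set of characters with $|\mathcal X|=|\mathcal K|$, such that every $\chi\in\mathcal X$ is constant on every $K\in\mathcal K$ and every irreducible character is a constituent of exactly one $\chi\in\mathcal X$. *The theory of the anti-involution.* A Springer morphism is a bijection $f:G\to\mathfrak g$ with $f(U)=\mathfrak u$ for which there are $a_i\in\mathbb F_q$ with $f(1+x)=x+\sum_{i\ge2}a_ix^i$.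 Let $G$ act on $\mathfrak u$ by $g\cdot x=gxg^\dagger$ and on $\mathfrak u^*$ by $(g\cdot\lambda)(x)=\lambda(g^{-1}\cdot x)$, and let $H=\{h\in G: h_{ij}=0\text{ for } i\ne j,\ j\le n\}$. For a Springer morphism $f$ and a nontrivial homomorphism $\theta:\mathbb F_q^+\to\mathbb C^\times$ put $$K_u=\{v\in U: f(v)\in G\cdot f(u)\}\ (u\in U),\qquad \chi_\lambda=\frac{|H\cdot\lambda|}{|G\cdot\lambda|}\sum_{\mu\in G\cdot\lambda}\theta\circ\mu\circ f\ (\lambda\in\mathfrak u^*).$$ *The André–Neto theory.* Write $\bar k=2n+1-k$. The positive roots of type $C_n$ are $\varepsilon_i-\varepsilon_j$, $\varepsilon_i+\varepsilon_j$ ($1\le i<j\le n$) and $2\varepsilon_i$ ($1\le i\le n$); to them belong the matrix positions $\{(i,j),(\bar j,\bar i)\}$, $\{(i,\bar j),(j,\bar i)\}$ and $\{(i,\bar i)\}$, the root vectors $e_\alpha=e_{ij}-e_{\bar j\bar i}$, $e_{i\bar j}+e_{j\bar i}$ and $e_{i\bar i}$, and the subgroups $U_\alpha$ of $U$ defined respectively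 by $u_{ik}=0$ $(i<k<j)$; by $u_{ik}=0$ $(i<k\le n)$ and $u_{jk}=0$ $(j<k\le n)$; and by $u_{ik}=0$ $(i<k\le n)$. A set $D$ of positive roots is basic if the positions belonging to its members include at most one in each row and at most one in each column. Fix a nontrivial homomorphism $\psi:\mathbb F_q^+\to\mathbb C^\times$. For $r\in\mathbb F_q^\times$ let $\xi_{\alpha,r}$ be the character of $U$ induced from the linear character $u\mapsto\psi(r\,u_{ab})$ of $U_\alpha$, where $(a,b)$ is the first of the listed positions of $\alpha$. For $D$ basic and $\varphi:D\to\mathbb F_q^\times$ the superclass and the supercharacter of $(D,\varphi)$ are $$K_{D,\varphi}=\Big\{u\in U: u-1\in G\Big(\sum_{\alpha\in D}\varphi(\alpha)e_\alpha\Big)G\Big\},\qquad \xi_{D,\varphi}=\prod_{\alpha\in D}\xi_{\alpha,\varphi(\alpha)}.$$ **Theorem.** Springer morphisms exist, and for every Springer morphism $f$ and all nontrivial $\theta,\psi$, the pair $(\{K_u\},\{\chi_\lambda\})$ and the pair $(\{K_{D,\varphi}\},\{\xi_{D,\varphi}\})$ are supercharacter theories of $USp_{2n}(\mathbb F_q)$,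 and they coincide: $\{K_u\}=\{K_{D,\varphi}\}$ and $\{\chi_\lambda\}=\{\xi_{D,\varphi}\}$. In both, the superclasses are exactly the nonempty sets of the form $USp_{2n}(\mathbb F_q)\cap K_g$ with $g\in G$, where $K_g=\{h\in G: h-1\in G(g-1)G\}$ is a superclass of the algebra group $UT_{2n}(\mathbb F_q)$. -/

import Mathlib

open Matrix

/-! ### Characters and supercharacter theories of finite groups -/

section SupercharacterTheories

variable {G : Type*} [Group G]

/-- `χ` is the character of a nonzero finite-dimensional complex representation of `G`. -/
def IsComplexCharacter (χ : G → ℂ) : Prop :=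
  ∃ (d : ℕ) (ρ : Representation ℂ G (Fin d → ℂ)), 0 < d ∧ ρ.character = χ

/-- `ψ` is the character of an irreducible finite-dimensional complex representation of `G`. -/
def IsIrreducibleCharacter (ψ : G → ℂ) : Prop :=
  ∃ (d : ℕ) (ρ : Representation ℂ G (Fin d → ℂ)), ρ.IsIrreducible ∧ ρ.character = ψ

/-- The Hermitian inner product `(1 / |G|) ∑ χ(g) conj ψ(g)` of functions on a finite group. -/
noncomputable def characterInner (χ ψ : G → ℂ) : ℂ :=
  (Nat.card G : ℂ)⁻¹ * ∑ᶠ g : G, χ g * star (ψ g)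

/-- The irreducible character `ψ` occurs in the character `χ`. -/
def IsConstituent (ψ χ : G → ℂ) : Prop := characterInner χ ψ ≠ 0

/-- The pair `T = (𝒦, 𝒳)` of a set of subsets of the finite group `G` and a set of complex functions
on `G` is a supercharacter theory of `G`. -/
structure IsSupercharacterTheory (T : Set (Set G) × Set (G → ℂ)) : Prop where
  /-- The superclasses partition `G`. -/
  isPartition : Setoid.IsPartition T.1
  /-- Each superclass is a union of conjugacy classes. -/
  conj_mem : ∀ K ∈ T.1, ∀ u ∈ K, ∀ g : G, g * u * g⁻¹ ∈ K
  isCharacter : ∀ χ ∈ T.2, IsComplexCharacter χ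
  card_eq : T.2.encard = T.1.encard
  constant : ∀ χ ∈ T.2, ∀ K ∈ T.1, ∀ u ∈ K, ∀ v ∈ K, χ u = χ v
  constituent : ∀ ψ : G → ℂ, IsIrreducibleCharacter ψ → ∃! χ, χ ∈ T.2 ∧ IsConstituent ψ χ

open Classical in
/-- The function induced from the function `φ` on the subgroup `S` of the finite group `G`: it
sends `g` to `(1 / |S|) ∑ φ(x g x⁻¹)`, where `x` runs over the elements of `G` with
`x g x⁻¹ ∈ S`. -/
noncomputable def inducedFunction (S : Subgroup G) (φ : S → ℂ) (g : G) : ℂ :=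
  (Nat.card S : ℂ)⁻¹ *
    ∑ᶠ x : G, if h : x * g * x⁻¹ ∈ S then φ ⟨x * g * x⁻¹, h⟩ else 0

end SupercharacterTheories

/-! ### Unitriangular matrices -/

section Unitriangular

/-- The group `UT_m(F)` of upper triangular matrices with ones on the diagonal. -/
def UT (m : ℕ) (F : Type*) [Field F] : Subgroup (GL (Fin m) F) where
  carrier := {g | (∀ i j, j < i → (g : Matrix (Fin m) (Fin m) F) i j = 0) ∧
    ∀ i, (g : Matrix (Fin m) (Fin m) F) i i = 1}
  one_mem' := by
    refine ⟨fun i j h => ?_, fun i => ?_⟩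
    · simp [h.ne']
    · simp
  mul_mem' := by
    rintro a b ⟨ha, ha'⟩ ⟨hb, hb'⟩
    refine ⟨fun i j h => ?_, fun i => ?_⟩
    · rw [Units.val_mul, Matrix.mul_apply]
      refine Finset.sum_eq_zero fun k _ => ?_
      rcases lt_or_ge k i with hk | hk
      · rw [ha _ _ hk, zero_mul]
      · rw [hb _ _ (h.trans_le hk), mul_zero]
    · rw [Units.val_mul, Matrix.mul_apply, Finset.sum_eq_single i, ha', hb', one_mul]
      · intro k _ hk
        rcases lt_or_gt_of_ne hk with hk | hk
        · rw [ha _ _ hk, zero_mul]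
        · rw [hb _ _ hk, mul_zero]
      · simp
  inv_mem' := by
    rintro a ⟨ha, ha'⟩
    have hinv : ∀ i j, j < i → ((a⁻¹ : GL (Fin m) F) : Matrix (Fin m) (Fin m) F) i j = 0 := by
      have h : Matrix.BlockTriangular (a : Matrix (Fin m) (Fin m) F) id := fun i j h => ha i j h
      let _ : Invertible (a : Matrix (Fin m) (Fin m) F) := a.isUnit.invertible
      have h2 := Matrix.blockTriangular_inv_of_blockTriangular h
      intro i j hij
      rw [Matrix.coe_units_inv]
      exact h2 hij
    refine ⟨hinv, fun i => ?_⟩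
    have h1 : ((a * a⁻¹ : GL (Fin m) F) : Matrix (Fin m) (Fin m) F) i i = 1 := by simp
    rw [Units.val_mul, Matrix.mul_apply, Finset.sum_eq_single i, ha', one_mul] at h1
    · exact h1
    · intro k _ hk
      rcases lt_or_gt_of_ne hk with hk | hk
      · rw [ha _ _ hk, zero_mul]
      · rw [hinv _ _ hk, mul_zero]
    · simp

variable {m : ℕ} {F : Type*} [Field F]

/-- The matrix underlying an element of `UT_m(F)`. -/
def utMat (g : UT m F) : Matrix (Fin m) (Fin m) F := ((g : GL (Fin m) F) : Matrix _ _ F)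

theorem utMat_lower (g : UT m F) {i j : Fin m} (h : j < i) : utMat g i j = 0 := g.2.1 i j h

theorem utMat_diag (g : UT m F) (i : Fin m) : utMat g i i = 1 := g.2.2 i

theorem utMat_mul (g h : UT m F) : utMat (g * h) = utMat g * utMat h := rfl

theorem utMat_one : utMat (1 : UT m F) = 1 := rfl

theorem utMat_mul_inv (g : UT m F) : utMat g * utMat g⁻¹ = 1 := by
  rw [← utMat_mul, mul_inv_cancel, utMat_one]

theorem utMat_inv_mul (g : UT m F) : utMat g⁻¹ * utMat g = 1 := by
  rw [← utMat_mul, inv_mul_cancel, utMat_one]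

variable (m F) in
/-- The algebra `𝔲𝔱_m(F)` of strictly upper triangular matrices (as a vector space). -/
def ut : Submodule F (Matrix (Fin m) (Fin m) F) where
  carrier := {x | ∀ i j, j ≤ i → x i j = 0}
  zero_mem' := fun _ _ _ => rfl
  add_mem' := fun {a b} ha hb i j h => by simp [ha i j h, hb i j h]
  smul_mem' := fun c a ha i j h => by simp [ha i j h]

theorem ut_mul_mem (g : UT m F) {x : Matrix (Fin m) (Fin m) F} (hx : x ∈ ut m F)
    {y : Matrix (Fin m) (Fin m) F} (hy : ∀ i j, j < i → y i j = 0) :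
    utMat g * x * y ∈ ut m F := by
  intro i j hij
  rw [Matrix.mul_apply]
  refine Finset.sum_eq_zero fun k _ => ?_
  rcases lt_or_ge j k with hk | hk
  · rw [hy _ _ hk, mul_zero]
  · rw [Matrix.mul_apply, Finset.sum_eq_zero, zero_mul]
    intro l _
    rcases lt_or_ge l i with hl | hl
    · rw [utMat_lower _ hl, zero_mul]
    · rw [hx l k ((hk.trans hij).trans hl), mul_zero]

/-- The algebra group superclass `K_g = {h | h - 1 ∈ G (g - 1) G}` of `G = UT_m(F)`. -/
def utSuperclass (g : UT m F) : Set (UT m F) :=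
  {h | ∃ a b : UT m F, utMat h - 1 = utMat a * (utMat g - 1) * utMat b}

/-- The unitriangular matrices whose entries in row `i` and in the columns `k` with `i < k < c`
vanish (columns are numbered from `0`). -/
def utRowSubgroup (i : Fin m) (c : ℕ) : Subgroup (UT m F) where
  carrier := {g | ∀ k : Fin m, i < k → (k : ℕ) < c → utMat g i k = 0}
  one_mem' := fun k hk _ => by simp [utMat_one, hk.ne]
  mul_mem' := by
    intro a b ha hb k hk hc
    rw [utMat_mul, Matrix.mul_apply]
    refine Finset.sum_eq_zero fun l _ => ?_
    rcases lt_trichotomy l i with hl | hl | hl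
    · rw [utMat_lower _ hl, zero_mul]
    · rw [hl, hb k hk hc, mul_zero]
    · rcases lt_or_ge k l with h | h
      · rw [utMat_lower _ h, mul_zero]
      · rw [ha l hl (lt_of_le_of_lt h hc), zero_mul]
  inv_mem' := by
    intro a ha k hk hc
    have h1 : (utMat a * utMat a⁻¹) i k = 0 := by
      rw [utMat_mul_inv, Matrix.one_apply, if_neg hk.ne]
    rw [Matrix.mul_apply, Finset.sum_eq_single i, utMat_diag, one_mul] at h1
    · exact h1
    · intro l _ hl
      rcases lt_or_gt_of_ne hl with hl | hl
      · rw [utMat_lower _ hl, zero_mul]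
      · rcases lt_or_ge k l with h | h
        · rw [utMat_lower _ h, mul_zero]
        · rw [ha l hl (lt_of_le_of_lt h hc), zero_mul]
    · simp

end Unitriangular

/-! ### The unipotent symplectic group and its Lie algebra -/

section Symplectic

variable (n : ℕ) (F : Type*) [Field F]

/-- The `2n × 2n` matrix `Ω` with blocks `0, -J, J, 0`, where `J` is the `n × n` matrix with ones on
the antidiagonal and zeroes elsewhere. -/
def symplecticOmega : Matrix (Fin (2 * n)) (Fin (2 * n)) F :=
  Matrix.of fun i j => if j = i.rev then (if (i : ℕ) < n then -1 else 1) else 0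

theorem symplecticOmega_mul_self : symplecticOmega n F * symplecticOmega n F = -1 := by
  ext i j
  rw [Matrix.mul_apply, Finset.sum_eq_single i.rev]
  · simp only [symplecticOmega, Matrix.of_apply, Fin.rev_rev, if_true, Matrix.neg_apply,
      Matrix.one_apply, Fin.val_rev]
    have hi := i.2
    by_cases h : (i : ℕ) < n
    · have h2 : ¬ (2 * n - (i + 1) < n) := by omega
      by_cases h3 : i = j
      · subst h3
        simp [h, h2]
      · simp [h3, Ne.symm h3]
    · have h2 : 2 * n - (i + 1) < n := by omega
      by_cases h3 : i = j
      · subst h3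
        simp [h, h2]
      · simp [h3, Ne.symm h3]
  · intro k _ hk
    simp [symplecticOmega, hk]
  · simp

theorem symplecticOmega_transpose : (symplecticOmega n F)ᵀ = -symplecticOmega n F := by
  ext i j
  have hi := i.2
  have hj := j.2
  simp only [symplecticOmega, Matrix.transpose_apply, Matrix.of_apply, Matrix.neg_apply,
    Fin.ext_iff, Fin.val_rev]
  split_ifs <;> first | omega | simp

variable {n F}

/-- The anti-involution `x ↦ x† = -Ω xᵗ Ω`. -/
def dagger (x : Matrix (Fin (2 * n)) (Fin (2 * n)) F) : Matrix (Fin (2 * n)) (Fin (2 * n)) F :=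
  -(symplecticOmega n F * xᵀ * symplecticOmega n F)

theorem dagger_mul (x y : Matrix (Fin (2 * n)) (Fin (2 * n)) F) :
    dagger (x * y) = dagger y * dagger x := by
  have h := symplecticOmega_mul_self n F
  simp only [dagger, Matrix.transpose_mul, Matrix.neg_mul, Matrix.mul_neg, neg_neg]
  calc -(symplecticOmega n F * (yᵀ * xᵀ) * symplecticOmega n F)
      = symplecticOmega n F * yᵀ * (symplecticOmega n F * symplecticOmega n F) * xᵀ *
          symplecticOmega n F := by rw [h]; simp [Matrix.mul_assoc]
    _ = _ := by simp only [Matrix.mul_assoc]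

theorem dagger_one : dagger (1 : Matrix (Fin (2 * n)) (Fin (2 * n)) F) = 1 := by
  simp [dagger, symplecticOmega_mul_self]

theorem dagger_dagger (x : Matrix (Fin (2 * n)) (Fin (2 * n)) F) : dagger (dagger x) = x := by
  have h := symplecticOmega_mul_self n F
  simp only [dagger, Matrix.transpose_neg, Matrix.transpose_mul, Matrix.transpose_transpose,
    symplecticOmega_transpose, Matrix.neg_mul, Matrix.mul_neg, neg_neg]
  calc symplecticOmega n F * (symplecticOmega n F * (x * symplecticOmega n F)) *
        symplecticOmega n F
      = (symplecticOmega n F * symplecticOmega n F) * x *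
          (symplecticOmega n F * symplecticOmega n F) := by simp only [Matrix.mul_assoc]
    _ = x := by rw [h]; simp

theorem dagger_add (x y : Matrix (Fin (2 * n)) (Fin (2 * n)) F) :
    dagger (x + y) = dagger x + dagger y := by
  simp only [dagger, Matrix.transpose_add, Matrix.mul_add, Matrix.add_mul, neg_add]

theorem dagger_smul (c : F) (x : Matrix (Fin (2 * n)) (Fin (2 * n)) F) :
    dagger (c • x) = c • dagger x := by
  simp [dagger]

theorem dagger_lower {x : Matrix (Fin (2 * n)) (Fin (2 * n)) F} (hx : ∀ i j, j < i → x i j = 0) :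
    ∀ i j, j < i → dagger x i j = 0 := by
  intro i j hij
  rw [dagger, Matrix.neg_apply, neg_eq_zero, Matrix.mul_apply]
  refine Finset.sum_eq_zero fun k _ => ?_
  by_cases hk : j = k.rev
  · rw [Matrix.mul_apply, Finset.sum_eq_zero, zero_mul]
    intro l _
    by_cases hl : l = i.rev
    · have : l < k := by
        rw [hl, ← Fin.rev_lt_rev, Fin.rev_rev, ← hk]
        exact hij
      rw [Matrix.transpose_apply, hx k l this, mul_zero]
    · simp [symplecticOmega, hl]
  · simp [symplecticOmega, hk]

variable (n F)

/-- The unipotent symplectic group `USp_{2n}(F) = {u ∈ UT_{2n}(F) | u⁻¹ = u†}`. -/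
def USp : Subgroup (UT (2 * n) F) where
  carrier := {u | utMat u⁻¹ = dagger (utMat u)}
  one_mem' := by simp [utMat_one, dagger_one]
  mul_mem' := by
    intro a b ha hb
    change utMat (a * b)⁻¹ = dagger (utMat (a * b))
    rw [_root_.mul_inv_rev, utMat_mul, utMat_mul, dagger_mul, ← ha, ← hb]
  inv_mem' := by
    intro a ha
    change utMat (a⁻¹⁻¹) = dagger (utMat a⁻¹)
    rw [show utMat a⁻¹ = dagger (utMat a) from ha, dagger_dagger, inv_inv]

/-- The Lie algebra `𝔲𝔰𝔭_{2n}(F) = {x ∈ 𝔲𝔱_{2n}(F) | x† = -x}`. -/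
def usp : Submodule F (Matrix (Fin (2 * n)) (Fin (2 * n)) F) where
  carrier := {x | x ∈ ut (2 * n) F ∧ dagger x = -x}
  zero_mem' := ⟨Submodule.zero_mem _, by simp [dagger]⟩
  add_mem' := by
    rintro a b ⟨ha, ha'⟩ ⟨hb, hb'⟩
    exact ⟨Submodule.add_mem _ ha hb, by rw [dagger_add, ha', hb', neg_add]⟩
  smul_mem' := by
    rintro c a ⟨ha, ha'⟩
    exact ⟨Submodule.smul_mem _ c ha, by rw [dagger_smul, ha', smul_neg]⟩

variable {n F}

/-- The action `g · x = g x g†` of `UT_{2n}(F)` on `𝔲𝔰𝔭_{2n}(F)`. -/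
def uspAction (g : UT (2 * n) F) : usp n F →ₗ[F] usp n F where
  toFun x := ⟨utMat g * (x : Matrix _ _ F) * dagger (utMat g),
    ut_mul_mem g x.2.1 (dagger_lower fun _ _ h => utMat_lower g h), by
      rw [dagger_mul, dagger_mul, dagger_dagger, x.2.2]
      simp [Matrix.mul_assoc]⟩
  map_add' x y := Subtype.ext (by simp [Matrix.mul_add, Matrix.add_mul])
  map_smul' c x := Subtype.ext (by simp)

/-- The action `(g · l)(x) = l(g⁻¹ · x)` of `UT_{2n}(F)` on the dual space of `𝔲𝔰𝔭_{2n}(F)`. -/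
def uspDualAction (g : UT (2 * n) F) (l : Module.Dual F (usp n F)) : Module.Dual F (usp n F) :=
  l ∘ₗ uspAction g⁻¹

variable (n F)

/-- A Springer morphism for `G = UT_{2n}(F)` and `†`: a bijection `f` from `G` to `𝔲𝔱_{2n}(F)` that
maps `USp_{2n}(F)` onto `𝔲𝔰𝔭_{2n}(F)` and has the form `f(1 + x) = x + ∑_{i ≥ 2} a_i x^i`.
Here `x ^ (2n) = 0`, so that the terms with `2 ≤ i < 2n` are the only ones that matter. -/
structure SpringerMorphism where
  toFun : UT (2 * n) F → ut (2 * n) F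
  bijective : Function.Bijective toFun
  image_eq : (fun u => (toFun u : Matrix (Fin (2 * n)) (Fin (2 * n)) F)) ''
    (USp n F : Set (UT (2 * n) F)) = (usp n F : Set (Matrix (Fin (2 * n)) (Fin (2 * n)) F))
  exists_coeff : ∃ a : ℕ → F, ∀ g : UT (2 * n) F,
    (toFun g : Matrix (Fin (2 * n)) (Fin (2 * n)) F) =
      (utMat g - 1) + ∑ i ∈ Finset.Ico 2 (2 * n), a i • (utMat g - 1) ^ i

variable {n F}

/-- The restriction of a Springer morphism to a map from `USp_{2n}(F)` to `𝔲𝔰𝔭_{2n}(F)`. -/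
def SpringerMorphism.onUSp (f : SpringerMorphism n F) (u : USp n F) : usp n F :=
  ⟨f.toFun u, by
    have h : (f.toFun u : Matrix (Fin (2 * n)) (Fin (2 * n)) F) ∈
        (usp n F : Set (Matrix (Fin (2 * n)) (Fin (2 * n)) F)) := by
      rw [← f.image_eq]
      exact ⟨u, u.2, rfl⟩
    exact h⟩

/-! ### The supercharacter theory obtained from the action of `UT_{2n}(F)` -/

/-- The superclass `K_u = {v | f(v) ∈ G · f(u)}` of `USp_{2n}(F)`. -/
def actionSuperclass (f : SpringerMorphism n F) (u : USp n F) : Set (USp n F) :=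
  {v | ∃ g : UT (2 * n) F, f.onUSp v = uspAction g (f.onUSp u)}

/-- The set of unitriangular matrices `h` of size `2n` whose entries off the diagonal vanish in the
first `n` columns. -/
def halfGroup (n : ℕ) (F : Type*) [Field F] : Set (UT (2 * n) F) :=
  {h | ∀ i j : Fin (2 * n), i ≠ j → (j : ℕ) < n → utMat h i j = 0}

/-- The orbit `G · l`. -/
def dualOrbit (l : Module.Dual F (usp n F)) : Set (Module.Dual F (usp n F)) :=
  {μ | ∃ g : UT (2 * n) F, μ = uspDualAction g l}

/-- The orbit `H · l`, where `H` is `halfGroup n F`. -/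
def halfDualOrbit (l : Module.Dual F (usp n F)) : Set (Module.Dual F (usp n F)) :=
  {μ | ∃ h ∈ halfGroup n F, μ = uspDualAction h l}

/-- The function `χ_l = (|H · l| / |G · l|) ∑ θ ∘ μ ∘ f` on `USp_{2n}(F)`, with `μ` running over
`G · l`. -/
noncomputable def actionSupercharacter (f : SpringerMorphism n F) (θ : AddChar F ℂ)
    (l : Module.Dual F (usp n F)) (u : USp n F) : ℂ :=
  ((halfDualOrbit l).ncard : ℂ) / ((dualOrbit l).ncard : ℂ) *
    ∑ᶠ μ ∈ dualOrbit l, θ (μ (f.onUSp u))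

/-- The pair `({K_u}, {χ_l})`. -/
noncomputable def actionTheory (f : SpringerMorphism n F) (θ : AddChar F ℂ) :
    Set (Set (USp n F)) × Set (USp n F → ℂ) :=
  (Set.range (actionSuperclass f), Set.range (actionSupercharacter f θ))

/-! ### The André–Neto supercharacter theory -/

/-- The positive roots of type `C_n`. With rows and columns numbered from `0` to `2n - 1`, a root is
recorded by its position `(i, j)` above the diagonal and on or above the antidiagonal. In the usual
notation, `(i, j)` is `ε_i - ε_j` if `j < n`, it is `2 ε_i` if `j = 2n - 1 - i`, and it is
`ε_i + ε_{2n - 1 - j}` otherwise. -/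
def PosRoot (n : ℕ) : Type :=
  {p : Fin (2 * n) × Fin (2 * n) // p.1 < p.2 ∧ p.2 ≤ p.1.rev}

/-- The row of the position of a root. -/
def PosRoot.row (α : PosRoot n) : Fin (2 * n) := α.1.1

/-- The column of the position of a root. -/
def PosRoot.col (α : PosRoot n) : Fin (2 * n) := α.1.2

/-- The positions `(i, j)` and `(2n - 1 - j, 2n - 1 - i)` that belong to a root. -/
def PosRoot.entries (α : PosRoot n) : Set (Fin (2 * n) × Fin (2 * n)) :=
  {(α.row, α.col), (α.col.rev, α.row.rev)}

/-- A set of positive roots is basic if the positions belonging to its members include at most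
one position in each row and at most one in each column. -/
def IsBasic (D : Finset (PosRoot n)) : Prop :=
  ∀ α ∈ D, ∀ β ∈ D, ∀ p ∈ α.entries, ∀ q ∈ β.entries, (p.1 = q.1 ∨ p.2 = q.2) → p = q

/-- The root vector of `𝔲𝔰𝔭_{2n}(F)` for a positive root. -/
noncomputable def PosRoot.rootVector (F : Type*) [Field F] (α : PosRoot n) :
    Matrix (Fin (2 * n)) (Fin (2 * n)) F :=
  if α.col = α.row.rev then Matrix.single α.row α.col 1
  else if (α.col : ℕ) < n then
    Matrix.single α.row α.col 1 - Matrix.single α.col.rev α.row.rev 1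
  else Matrix.single α.row α.col 1 + Matrix.single α.col.rev α.row.rev 1

/-- The element `e_{D,φ} = ∑_{α ∈ D} φ(α) e_α`. -/
noncomputable def basicElement (D : Finset (PosRoot n)) (φ : PosRoot n → Fˣ) :
    Matrix (Fin (2 * n)) (Fin (2 * n)) F :=
  ∑ α ∈ D, (φ α : F) • α.rootVector F

/-- The superclass `{u ∈ USp_{2n}(F) | u - 1 ∈ G e_{D,φ} G}`, where `G = UT_{2n}(F)`. -/
def andreNetoSuperclass (D : Finset (PosRoot n)) (φ : PosRoot n → Fˣ) : Set (USp n F) :=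
  {u | ∃ a b : UT (2 * n) F, utMat (u : UT (2 * n) F) - 1 = utMat a * basicElement D φ * utMat b}

/-- The subgroup `U_α` of `USp_{2n}(F)`. For `α = ε_i - ε_j` it is given by `u_{ik} = 0` for
`i < k < j`; for `α = ε_i + ε_j` by `u_{ik} = 0` for `i < k ≤ n` and `u_{jk} = 0` for `j < k ≤ n`; and
for `α = 2 ε_i` by `u_{ik} = 0` for `i < k ≤ n` (indices starting from `1`). -/
noncomputable def elementarySubgroup (F : Type*) [Field F] (α : PosRoot n) : Subgroup (USp n F) :=
  (if (α.col : ℕ) < n then utRowSubgroup α.row α.col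
    else utRowSubgroup α.row n ⊓ utRowSubgroup α.col.rev n).subgroupOf (USp n F)

/-- The elementary character `ξ_{α,r}`, induced from the linear character `u ↦ ψ(r u_{ij})`
of `U_α`, where `(i, j)` is the position of `α`. -/
noncomputable def elementaryCharacter (ψ : AddChar F ℂ) (α : PosRoot n) (r : Fˣ) :
    USp n F → ℂ :=
  inducedFunction (elementarySubgroup F α) fun u =>
    ψ (r * utMat ((u : USp n F) : UT (2 * n) F) α.row α.col)

/-- The supercharacter `ξ_{D,φ} = ∏_{α ∈ D} ξ_{α,φ(α)}`. -/
noncomputable def andreNetoSupercharacter (ψ : AddChar F ℂ) (D : Finset (PosRoot n))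
    (φ : PosRoot n → Fˣ) (u : USp n F) : ℂ :=
  ∏ α ∈ D, elementaryCharacter ψ α (φ α) u

/-- The superclasses and supercharacters indexed by the pairs `(D, φ)` with `D` basic. -/
noncomputable def andreNetoTheory (n : ℕ) {F : Type*} [Field F] (ψ : AddChar F ℂ) :
    Set (Set (USp n F)) × Set (USp n F → ℂ) :=
  ({K | ∃ (D : Finset (PosRoot n)) (φ : PosRoot n → Fˣ),
      IsBasic D ∧ K = andreNetoSuperclass D φ},
   {χ | ∃ (D : Finset (PosRoot n)) (φ : PosRoot n → Fˣ),
      IsBasic D ∧ χ = andreNetoSupercharacter ψ D φ})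

/-! ### Intersections with the superclasses of the algebra group -/

/-- The nonempty sets of the form `USp_{2n}(F) ∩ K_g`, where `K_g` is a superclass of the algebra
group `UT_{2n}(F)`. -/
def superclassIntersections (n : ℕ) (F : Type*) [Field F] : Set (Set (USp n F)) :=
  {K | K.Nonempty ∧ ∃ g : UT (2 * n) F, K = {u : USp n F | (u : UT (2 * n) F) ∈ utSuperclass g}}

end Symplectic

/-!
Write `G = UT_{2n}(F)`, `U = USp_{2n}(F)`, and `𝔲 = 𝔲𝔰𝔭_{2n}(F)`.

*Superclasses.* A Springer morphism sends `g` to `(g - 1) h` with `h ∈ G` a polynomial in `g - 1`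
(`SpringerMorphism.exists_eq_mul`), so `f(v) ∈ G · f(u)` forces `v - 1 ∈ G (u - 1) G`. Conversely,
if `y = a x b` with `x, y ∈ 𝔲`, moving `a` to the other side reduces to `y = x b`; then
`x b = b† x`, and a power `c` of `b` with `c² = b`, which exists because `G` has odd exponent,
gives `y = c† x c` (`exists_uspAction_eq`). Hence `K_u = U ∩ K_g` for `g = u`.
Multiplication by `Ω` identifies the action of `G` on `𝔲` with congruence of symmetric matrices; symmetric elimination
(`exists_unitriangular_congruence`) brings each of them to a form with at most one nonzero entry
per row, so the elements `∑ φ(α) e_α` with `D` basic meet all orbits, and dually the functionals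
`x ↦ ∑ φ(α) x_α` meet all orbits on `𝔲*`. The Cayley map is a Springer morphism.

*Supercharacters.* For a single root `α`, averaging `ψ(r (h · x)_α)` over `h ∈ H` gives `ψ(r x_α)`
on the subspace `𝔲_α` of `𝔲` that corresponds to `U_α`, and zero off it, because off `𝔲_α` some
entry of `h` enters linearly (`sum_halfSubgroup_addChar`). Since `G = H U`
(`exists_halfSubgroup_mul_USp`), the induced character `ξ_{α,r}` is, up to the factor `|U : U_α|`,
the average of `ψ(r (g · f(u))_α)` over all `g ∈ G`. This coordinate depends only on the rows of
`g` that belong to `α`, and these are disjoint for the members of a basic set; functions of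
disjoint rows are independent (`average_prod_eq_prod_average`), so `ξ_{D,φ}` is a multiple of the
average over `G` of the character attached to `x ↦ ∑ φ(α) x_α`, that is, of the sum over the orbit
of this functional. The factors agree because the same averages over `H`, paired with the
character itself, compute the size of its `H`-orbit (`ncard_halfDualOrbit_basicFunctional`).

*Axioms.* For a linear action on a finite vector space, orbit sums of additive characters over
different orbits on the dual are orthogonal and constant on the orbits, the number of orbits is
the same on the space and on its dual, and some combination of the orbit sums is the regular character.
So the axioms hold once suitable multiples of the orbit sums are characters
(`isSupercharacterTheory_of_orbits`), and here these multiples are products of induced characters.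
-/

/-! ### Characters of finite groups -/

section Characters

variable {G : Type*} [Group G]

theorem isComplexCharacter_of_representation {V : Type*} [AddCommGroup V] [Module ℂ V]
    [FiniteDimensional ℂ V] [Nontrivial V] (ρ : Representation ℂ G V) :
    IsComplexCharacter ρ.character := by
  let e : V ≃ₗ[ℂ] (Fin (Module.finrank ℂ V) → ℂ) := (Module.finBasis ℂ V).equivFun
  refine ⟨Module.finrank ℂ V,
    { toFun := fun g => e.conj (ρ g)
      map_one' := by simp [Module.End.one_eq_id]
      map_mul' := fun g h => by simp [Module.End.mul_eq_comp, LinearEquiv.conj_comp] },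
    Module.finrank_pos, ?_⟩
  ext g
  exact LinearMap.trace_conj' (ρ g) e

theorem isComplexCharacter_one : IsComplexCharacter (1 : G → ℂ) := by
  have h := isComplexCharacter_of_representation (1 : Representation ℂ G ℂ)
  convert h using 1
  ext g
  simp [Representation.character]

theorem IsComplexCharacter.mul {χ ψ : G → ℂ} (hχ : IsComplexCharacter χ)
    (hψ : IsComplexCharacter ψ) : IsComplexCharacter (χ * ψ) := by
  obtain ⟨d, ρ, hd, rfl⟩ := hχ
  obtain ⟨e, σ, he, rfl⟩ := hψ
  have : Nonempty (Fin d) := ⟨⟨0, hd⟩⟩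
  have : Nonempty (Fin e) := ⟨⟨0, he⟩⟩
  have : Nontrivial (TensorProduct ℂ (Fin d → ℂ) (Fin e → ℂ)) := by
    apply Module.nontrivial_of_finrank_pos (R := ℂ)
    simp [Module.finrank_tensorProduct, hd, he]
  rw [← Representation.char_tensor]
  exact isComplexCharacter_of_representation _

theorem isComplexCharacter_prod {ι : Type*} (s : Finset ι) (χ : ι → G → ℂ)
    (h : ∀ i ∈ s, IsComplexCharacter (χ i)) : IsComplexCharacter (∏ i ∈ s, χ i) := by
  classical
  induction s using Finset.induction_on with
  | empty => simpa using isComplexCharacter_one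
  | insert a s ha ih =>
    rw [Finset.prod_insert ha]
    exact (h a (Finset.mem_insert_self a s)).mul
      (ih fun i hi => h i (Finset.mem_insert_of_mem hi))

open scoped ComplexOrder in
/-- Averaging `Aᴴ A` over the group gives an invariant positive definite form, for which the
representing matrices are unitary. -/
theorem star_character_apply [Finite G] {d : ℕ} (ρ : Representation ℂ G (Fin d → ℂ)) (g : G) :
    star (ρ.character g) = ρ.character g⁻¹ := by
  classical
  have := Fintype.ofFinite G
  let M : G → Matrix (Fin d) (Fin d) ℂ := fun g => LinearMap.toMatrix' (ρ g)
  have hM : ∀ a b, M (a * b) = M a * M b := fun a b => by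
    simp [M, map_mul, LinearMap.toMatrix'_mul]
  have hM1 : M 1 = 1 := by simp [M]
  have htr : ∀ a, ρ.character a = (M a).trace := fun a => by
    rw [Representation.character, LinearMap.trace_eq_matrix_trace ℂ (Pi.basisFun ℂ (Fin d)),
      LinearMap.toMatrix_eq_toMatrix']
  have hunit : ∀ a, IsUnit (M a) := fun a => IsUnit.of_mul_eq_one (M a⁻¹) (by
    rw [← hM, mul_inv_cancel, hM1])
  let P : Matrix (Fin d) (Fin d) ℂ := ∑ a, (M a)ᴴ * M a
  have hP : P.PosDef := by
    refine Matrix.posDef_sum ⟨1, Finset.mem_univ 1⟩ fun a _ => ?_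
    exact Matrix.PosDef.conjTranspose_mul_self _ (Matrix.mulVec_injective_of_isUnit (hunit a))
  have hinv : (M g)ᴴ * P * M g = P := by
    simp only [P, Finset.mul_sum, Finset.sum_mul]
    refine Fintype.sum_equiv (Equiv.mulRight g) _ _ fun a => ?_
    simp [hM, Matrix.conjTranspose_mul, Matrix.mul_assoc]
  have hPu : IsUnit P.det := (Matrix.isUnit_iff_isUnit_det P).1 hP.isUnit
  have h2 : (M g)ᴴ = P * M g⁻¹ * P⁻¹ := by
    calc (M g)ᴴ = (M g)ᴴ * P * (M g * M g⁻¹) * P⁻¹ := by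
          rw [← hM, mul_inv_cancel, hM1, Matrix.mul_one, Matrix.mul_assoc,
            Matrix.mul_nonsing_inv _ hPu, Matrix.mul_one]
      _ = ((M g)ᴴ * P * M g) * M g⁻¹ * P⁻¹ := by simp only [Matrix.mul_assoc]
      _ = _ := by rw [hinv]
  rw [htr, htr, ← Matrix.trace_conjTranspose, h2, Matrix.trace_mul_comm, ← Matrix.mul_assoc,
    Matrix.nonsing_inv_mul _ hPu, Matrix.one_mul]

theorem characterInner_eq_sum {X : Type*} [Fintype X] (χ ψ : X → ℂ) :
    characterInner χ ψ = (Nat.card X : ℂ)⁻¹ * ∑ g, χ g * star (ψ g) := by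
  rw [characterInner, finsum_eq_sum_of_fintype]

theorem characterInner_character [Finite G] {d e : ℕ} (ρ : Representation ℂ G (Fin d → ℂ))
    (σ : Representation ℂ G (Fin e → ℂ)) :
    characterInner σ.character ρ.character =
      Module.finrank ℂ (Representation.IntertwiningMap ρ σ) := by
  have := Fintype.ofFinite G
  have : Invertible (Nat.card G : ℂ) := invertibleOfNonzero (by simp)
  rw [← Representation.card_inv_mul_sum_char_mul_char_eq_finrank, characterInner_eq_sum]
  simp only [star_character_apply]

theorem characterInner_comm {X : Type*} [Finite X] (χ ψ : X → ℂ) :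
    characterInner χ ψ = star (characterInner ψ χ) := by
  have := Fintype.ofFinite X
  simp [characterInner_eq_sum, mul_comm]

/-- Two characters with a common irreducible constituent are not orthogonal: the constituent is a
quotient of one representation and embeds into the other. -/
theorem characterInner_ne_zero_of_isConstituent [Finite G] {χ χ' ψ : G → ℂ}
    (hχ : IsComplexCharacter χ) (hχ' : IsComplexCharacter χ') (hψ : IsIrreducibleCharacter ψ)
    (h : IsConstituent ψ χ) (h' : IsConstituent ψ χ') : characterInner χ χ' ≠ 0 := by
  obtain ⟨d, ρ, hd, rfl⟩ := hχ
  obtain ⟨e, σ, he, rfl⟩ := hχ'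
  obtain ⟨k, τ, hτ, rfl⟩ := hψ
  have h'' : characterInner τ.character σ.character ≠ 0 := by
    rw [characterInner_comm]
    exact star_ne_zero.2 h'
  rw [IsConstituent, characterInner_character] at h
  rw [characterInner_character] at h'' ⊢
  have hex : ∀ {a b : ℕ} {α : Representation ℂ G (Fin a → ℂ)} {β : Representation ℂ G (Fin b → ℂ)},
      (Module.finrank ℂ (Representation.IntertwiningMap α β) : ℂ) ≠ 0 →
      ∃ φ : Representation.IntertwiningMap α β, φ ≠ 0 := by
    intro a b α β hne
    have : Nontrivial (Representation.IntertwiningMap α β) :=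
      Module.nontrivial_of_finrank_pos (R := ℂ) (Nat.pos_of_ne_zero (by exact_mod_cast hne))
    exact exists_ne 0
  obtain ⟨φ, hφ⟩ := hex h
  obtain ⟨φ', hφ'⟩ := hex h''
  have hinj := (Representation.IsIrreducible.injective_or_eq_zero φ).resolve_right hφ
  have hsur := (Representation.IsIrreducible.surjective_or_eq_zero φ').resolve_right hφ'
  have hcomp : φ.comp φ' ≠ 0 := by
    intro h0
    apply hφ
    ext1
    refine LinearMap.ext fun v => ?_
    obtain ⟨w, rfl⟩ := hsur v
    exact congrArg (fun t : Representation.IntertwiningMap σ ρ => t w) h0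
  have : Nontrivial (Representation.IntertwiningMap σ ρ) := ⟨⟨_, _, hcomp⟩⟩
  exact_mod_cast (Module.finrank_pos (R := ℂ)).ne'

/-- The idempotent of the function space of `G` onto the functions `v` with `v(sx) = φ(s) v(x)` for
`s ∈ S`. -/
noncomputable def semiInvariantProjection [Fintype G] (S : Subgroup G) [Fintype S] (φ : S →* ℂ) :
    (G → ℂ) →ₗ[ℂ] (G → ℂ) where
  toFun v x := (Nat.card S : ℂ)⁻¹ * ∑ s : S, φ s⁻¹ * v (s * x)
  map_add' v w := by
    ext x
    simp [mul_add, Finset.sum_add_distrib]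
  map_smul' c v := by
    ext x
    simp only [Pi.smul_apply, smul_eq_mul, RingHom.id_apply, Finset.mul_sum]
    refine Finset.sum_congr rfl fun s _ => by ring

/-- The space of the representation induced from the linear character `φ` of `S`: the functions `v`
on `G` with `v(sx) = φ(s) v(x)` for `s ∈ S`. -/
noncomputable def semiInvariants (S : Subgroup G) (φ : S →* ℂ) : Submodule ℂ (G → ℂ) where
  carrier := {v | ∀ (s : S) (x : G), v (s * x) = φ s * v x}
  zero_mem' := fun _ _ => by simp
  add_mem' := fun {v w} hv hw s x => by simp [hv s x, hw s x, mul_add]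
  smul_mem' := fun c v hv s x => by simp [hv s x, mul_left_comm]

/-- The action of `G` on the semi-invariant functions by right translation. -/
noncomputable def semiInvariantsRepresentation (S : Subgroup G) (φ : S →* ℂ) :
    Representation ℂ G (semiInvariants S φ) where
  toFun g :=
    { toFun := fun v => ⟨fun x => (v : G → ℂ) (x * g), fun s x => by
        simpa only [mul_assoc] using v.2 s (x * g)⟩
      map_add' := fun _ _ => rfl
      map_smul' := fun _ _ => rfl }
  map_one' := by
    ext v x
    simp
  map_mul' g h := by
    ext v x
    simp [mul_assoc]

theorem semiInvariantProjection_mem [Fintype G] (S : Subgroup G) [Fintype S] (φ : S →* ℂ)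
    (v : G → ℂ) : semiInvariantProjection S φ v ∈ semiInvariants S φ := by
  intro t x
  simp only [semiInvariantProjection, LinearMap.coe_mk, AddHom.coe_mk, Finset.mul_sum]
  refine Fintype.sum_equiv (Equiv.mulRight t) _ _ fun s => ?_
  have h1 : φ t * φ (s * t)⁻¹ = φ s⁻¹ := by rw [← map_mul, _root_.mul_inv_rev, mul_inv_cancel_left]
  simp only [Equiv.coe_mulRight, Subgroup.coe_mul, mul_assoc]
  rw [← h1]
  ring

theorem semiInvariantProjection_of_mem [Fintype G] (S : Subgroup G) [Fintype S] (φ : S →* ℂ)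
    {v : G → ℂ} (hv : v ∈ semiInvariants S φ) : semiInvariantProjection S φ v = v := by
  ext x
  simp only [semiInvariantProjection, LinearMap.coe_mk, AddHom.coe_mk]
  have : ∀ s : S, φ s⁻¹ * v (s * x) = v x := fun s => by
    rw [hv s x, ← mul_assoc, ← map_mul, inv_mul_cancel, map_one, one_mul]
  rw [Finset.sum_congr rfl fun s _ => this s]
  simp

/-- The trace is computed on the whole function space, on which right translation composed with
the projection onto the induced representation is an explicit matrix. -/
theorem isComplexCharacter_inducedFunction [Finite G] (S : Subgroup G) (φ : S →* ℂ) :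
    IsComplexCharacter (inducedFunction S φ) := by
  classical
  have := Fintype.ofFinite G
  have := Fintype.ofFinite S
  have hne : semiInvariantProjection S φ (Pi.single 1 1) 1 ≠ 0 := by
    simp only [semiInvariantProjection, LinearMap.coe_mk, AddHom.coe_mk, mul_one]
    rw [Finset.sum_eq_single 1]
    · simp
    · intro s _ hs
      have : (s : G) ≠ 1 := fun h => hs (Subtype.ext h)
      simp [this]
    · simp
  have : Nontrivial (semiInvariants S φ) := by
    refine ⟨⟨⟨_, semiInvariantProjection_mem S φ (Pi.single 1 1)⟩, 0, fun h => hne ?_⟩⟩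
    exact congrFun (congrArg Subtype.val h) 1
  convert isComplexCharacter_of_representation (semiInvariantsRepresentation S φ) using 1
  ext g
  let R : (G → ℂ) →ₗ[ℂ] (G → ℂ) := LinearMap.funLeft ℂ ℂ (fun x => x * g)
  let f := R ∘ₗ semiInvariantProjection S φ
  have hf : ∀ v, f v ∈ semiInvariants S φ := fun v =>
    (semiInvariantsRepresentation S φ g ⟨_, semiInvariantProjection_mem S φ v⟩).2
  have h1 : semiInvariantsRepresentation S φ g = f.restrict (fun x _ => hf x) := by
    ext v x
    change (v : G → ℂ) (x * g) = semiInvariantProjection S φ v (x * g)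
    rw [semiInvariantProjection_of_mem S φ v.2]
  rw [Representation.character, h1, LinearMap.trace_restrict_eq_of_forall_mem _ f hf,
    LinearMap.trace_eq_matrix_trace ℂ (Pi.basisFun ℂ G), Matrix.trace, inducedFunction,
    finsum_eq_sum_of_fintype, Finset.mul_sum]
  refine Finset.sum_congr rfl fun x _ => ?_
  simp only [Matrix.diag_apply, LinearMap.toMatrix_apply, Pi.basisFun_apply, Pi.basisFun_repr]
  change _ = semiInvariantProjection S φ (Pi.single x 1) (x * g)
  simp only [semiInvariantProjection, LinearMap.coe_mk, AddHom.coe_mk]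
  congr 1
  split_ifs with h
  · rw [Finset.sum_eq_single (⟨x * g * x⁻¹, h⟩⁻¹ : S)]
    · simp [mul_assoc]
    · intro s _ hs
      have : (s : G) * (x * g) ≠ x := fun h' => hs (by
        rw [eq_inv_iff_mul_eq_one]
        apply Subtype.ext
        change (s : G) * (x * g * x⁻¹) = 1
        rw [← mul_assoc, h', mul_inv_cancel])
      simp [this]
    · simp
  · symm
    refine Finset.sum_eq_zero fun s _ => ?_
    have : (s : G) * (x * g) ≠ x := fun h' => h (by
      have : x * g * x⁻¹ = (s : G)⁻¹ := eq_inv_of_mul_eq_one_right (by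
        rw [← mul_assoc, h', mul_inv_cancel])
      rw [this]
      exact S.inv_mem s.2)
    simp [this]

end Characters

/-! ### Supercharacter theories from linear actions -/

section LinearActions

variable {F : Type*} [Field F] {A : Type*} [Group A] {V : Type*} [AddCommGroup V] [Module F V]

theorem sum_addChar_apply_dual_eq_zero [Fintype V] {θ : AddChar F ℂ} (hθ : θ ≠ 1)
    {l : Module.Dual F V} (hl : l ≠ 0) : ∑ x, θ (l x) = 0 := by
  obtain ⟨c, hc⟩ := (AddChar.ne_one_iff).1 hθ
  obtain ⟨x, hx⟩ := LinearMap.surjective hl c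
  refine (AddChar.sum_eq_zero_iff_ne_zero (ψ := θ.compAddMonoidHom l.toAddMonoidHom)).2 ?_
  rw [AddChar.ne_zero_iff]
  exact ⟨x, by simpa [hx] using hc⟩

theorem sum_dual_addChar_apply_eq_zero [Fintype (Module.Dual F V)] {θ : AddChar F ℂ} (hθ : θ ≠ 1)
    {x : V} (hx : x ≠ 0) : ∑ l : Module.Dual F V, θ (l x) = 0 := by
  refine sum_addChar_apply_dual_eq_zero hθ (l := Module.Dual.eval F V x) fun h => hx ?_
  exact (Module.forall_dual_apply_eq_zero_iff F x).1 fun l => LinearMap.congr_fun h l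

variable (ρ : Representation F A V)

/-- The action of `A` on `V` given by the representation `ρ`. -/
abbrev representationAction : MulAction A V := MulAction.compHom V ρ

theorem card_orbits_mul_card_eq [Finite A] [Finite V] :
    Nat.card (Quotient (@MulAction.orbitRel A V _ (representationAction ρ))) * Nat.card A =
      ∑ᶠ a : A, Nat.card (LinearMap.ker (ρ a - 1)) := by
  classical
  have := Fintype.ofFinite A
  have := Fintype.ofFinite V
  let _ := representationAction ρ
  have : Fintype (Quotient (MulAction.orbitRel A V)) := Fintype.ofFinite _
  have h := MulAction.sum_card_fixedBy_eq_card_orbits_mul_card_group A V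
  rw [Nat.card_eq_fintype_card, Nat.card_eq_fintype_card, finsum_eq_sum_of_fintype]
  refine Eq.trans ?_ (h.symm.trans ?_)
  · rfl
  · refine Finset.sum_congr rfl fun a _ => ?_
    rw [← Nat.card_eq_fintype_card]
    refine Nat.card_congr (Equiv.subtypeEquivRight fun v => ?_)
    rw [LinearMap.mem_ker, LinearMap.sub_apply, sub_eq_zero]
    rfl

/-- A finite group acting linearly on a finite vector space has as many orbits on the space as on
its dual, because every element has as many fixed points on either. -/
theorem card_orbits_dual [Finite F] [Finite A] [Finite V] :
    Nat.card (Quotient (@MulAction.orbitRel A _ _ (representationAction ρ.dual))) =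
      Nat.card (Quotient (@MulAction.orbitRel A V _ (representationAction ρ))) := by
  have : Module.Finite F V := Module.Finite.of_finite
  have : Finite (Module.Dual F V) := Module.finite_of_finite F
  refine Nat.eq_of_mul_eq_mul_right (Nat.card_pos (α := A)) ?_
  rw [card_orbits_mul_card_eq, card_orbits_mul_card_eq]
  have := Fintype.ofFinite A
  rw [finsum_eq_sum_of_fintype, finsum_eq_sum_of_fintype]
  refine Fintype.sum_equiv (Equiv.inv A) _ _ fun a => ?_
  have h1 : ρ.dual a - 1 = (ρ a⁻¹ - 1).dualMap := by
    ext l v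
    simp [Module.Dual.transpose_apply]
  rw [Equiv.inv_apply, h1,
    Module.natCard_eq_pow_finrank (K := F) (V := LinearMap.ker (ρ a⁻¹ - 1).dualMap),
    Module.natCard_eq_pow_finrank (K := F) (V := LinearMap.ker (ρ a⁻¹ - 1))]
  have h2 := LinearMap.finrank_range_dualMap_eq_finrank_range (ρ a⁻¹ - 1)
  have h3 := LinearMap.finrank_range_add_finrank_ker (ρ a⁻¹ - 1)
  have h4 := LinearMap.finrank_range_add_finrank_ker (ρ a⁻¹ - 1).dualMap
  rw [Subspace.dual_finrank_eq] at h4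
  congr 1
  omega

/-- Averages over a group are averages over an orbit. -/
theorem sum_smul_eq_orbit_sum [Fintype A] {X : Type*} [Finite X] [MulAction A X] (x : X)
    (Φ : X → ℂ) : ∑ a : A, Φ (a • x) =
      (Nat.card A : ℂ) / ((MulAction.orbit A x).ncard : ℂ) * ∑ᶠ y ∈ MulAction.orbit A x, Φ y := by
  classical
  have := Fintype.ofFinite X
  have hst : (Nat.card A : ℂ) =
      (MulAction.orbit A x).ncard * Nat.card (MulAction.stabilizer A x) := by
    rw [← Nat.card_coe_set_eq, ← Nat.cast_mul, ← Nat.card_prod]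
    exact congrArg _ (Nat.card_congr (MulAction.orbitProdStabilizerEquivGroup A x).symm)
  have horb : ((MulAction.orbit A x).ncard : ℂ) ≠ 0 := by
    rw [Nat.cast_ne_zero, ← Nat.pos_iff_ne_zero, Set.ncard_pos]
    exact MulAction.nonempty_orbit x
  rw [hst, mul_div_cancel_left₀ _ horb, finsum_mem_eq_toFinset_sum,
    ← Finset.sum_fiberwise_of_maps_to (s := Finset.univ) (t := (MulAction.orbit A x).toFinset)
      (g := fun a => a • x) (fun a _ => by simp), Finset.mul_sum]
  refine Finset.sum_congr rfl fun y hy => ?_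
  obtain ⟨b, rfl⟩ := Set.mem_toFinset.1 hy
  rw [Finset.sum_congr rfl (g := fun _ => Φ (b • x)) (fun a ha => by
    rw [(Finset.mem_filter.1 ha).2]), Finset.sum_const, nsmul_eq_mul]
  congr 2
  rw [← Fintype.card_subtype, ← Nat.card_eq_fintype_card]
  refine Nat.card_congr ((Equiv.mulLeft b⁻¹).subtypeEquiv fun a => ?_)
  rw [MulAction.mem_stabilizer_iff, Equiv.coe_mulLeft, mul_smul, inv_smul_eq_iff]

/-- The orbits of a linear action on `V`, transported along a bijection `f : U → V`, and the Fourier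
transforms of the orbits on the dual of `V` form a supercharacter theory, as soon as suitable
multiples of the latter are characters. -/
theorem isSupercharacterTheory_of_orbits [Finite F] [Finite A] [Finite V] {U : Type*} [Group U]
    (f : U ≃ V) (hf1 : f 1 = 0) (hf : ∀ u v, ∃ a, f (u * v * u⁻¹) = ρ a (f v))
    {θ : AddChar F ℂ} (hθ : θ ≠ 1) (χ : Module.Dual F V → U → ℂ) (c : Module.Dual F V → ℂ)
    (hc : ∀ l, c l ≠ 0)
    (hχ : ∀ l u, χ l u = c l * ∑ᶠ a : A, θ (l (ρ a (f u))))
    (hχorb : ∀ l a, χ (l ∘ₗ ρ a) = χ l) (hchar : ∀ l, IsComplexCharacter (χ l)) :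
    IsSupercharacterTheory (Set.range fun u => {v | ∃ a, f v = ρ a (f u)}, Set.range χ) := by
  classical
  have := Fintype.ofFinite A
  have := Fintype.ofFinite V
  have : Module.Finite F V := Module.Finite.of_finite
  have : Finite (Module.Dual F V) := Module.finite_of_finite F
  have := Fintype.ofFinite (Module.Dual F V)
  have : Fintype U := Fintype.ofEquiv V f.symm
  simp only [finsum_eq_sum_of_fintype] at hχ
  have hρ : ∀ a b v, ρ a (ρ b v) = ρ (a * b) v := fun a b v => by rw [map_mul]; rfl
  have hρ1 : ∀ v, ρ 1 v = v := fun v => by rw [map_one]; rfl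
  have hU : (Nat.card U : ℂ)⁻¹ ≠ 0 := inv_ne_zero (Nat.cast_ne_zero.2 Nat.card_pos.ne')
  -- Functions attached to functionals in different orbits are orthogonal.
  have hmeet : ∀ l l', characterInner (χ l) (χ l') ≠ 0 → ∃ a b, l ∘ₗ ρ a = l' ∘ₗ ρ b := by
    intro l l' h
    by_contra! hne
    refine h ?_
    rw [characterInner_eq_sum]
    have h1 : ∀ u, χ l u * star (χ l' u) =
        c l * star (c l') * ∑ a, ∑ b, θ ((l ∘ₗ ρ a - l' ∘ₗ ρ b) (f u)) := by
      intro u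
      rw [hχ, hχ, star_mul', star_sum, mul_mul_mul_comm, Finset.sum_mul_sum]
      congr 1
      refine Finset.sum_congr rfl fun a _ => Finset.sum_congr rfl fun b _ => ?_
      rw [LinearMap.sub_apply, sub_eq_add_neg, AddChar.map_add_eq_mul, AddChar.map_neg_eq_conj]
      rfl
    rw [Finset.sum_congr rfl fun u _ => h1 u, ← Finset.mul_sum, Finset.sum_comm,
      Finset.sum_eq_zero, mul_zero, mul_zero]
    intro a _
    rw [Finset.sum_comm]
    refine Finset.sum_eq_zero fun b _ => ?_
    rw [Equiv.sum_comp f fun x => θ ((l ∘ₗ ρ a - l' ∘ₗ ρ b) x)]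
    exact sum_addChar_apply_dual_eq_zero hθ (sub_ne_zero.2 (hne a b))
  have horth : ∀ l l', characterInner (χ l) (χ l') ≠ 0 → χ l = χ l' := by
    intro l l' h
    obtain ⟨a, b, hab⟩ := hmeet l l' h
    rw [← hχorb l a, hab, hχorb]
  have hself : ∀ l, characterInner (χ l) (χ l) ≠ 0 := by
    intro l h
    obtain ⟨d, σ, hd, hσ⟩ := hchar l
    have h1 : σ.character 1 ≠ 0 := by
      rw [Representation.char_one, Module.finrank_fin_fun]
      exact Nat.cast_ne_zero.2 hd.ne'
    rw [characterInner_eq_sum, mul_eq_zero, or_iff_right hU] at h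
    have h2 : ∑ u, Complex.normSq (χ l u) = 0 := by
      have : ∀ u, χ l u * star (χ l u) = (Complex.normSq (χ l u) : ℂ) := fun u =>
        Complex.mul_conj _
      simp only [this] at h
      exact_mod_cast h
    rw [Finset.sum_eq_zero_iff_of_nonneg fun u _ => Complex.normSq_nonneg _] at h2
    exact h1 (hσ ▸ Complex.normSq_eq_zero.1 (h2 1 (Finset.mem_univ 1)))
  have hker : ∀ l l', χ l = χ l' ↔ ∃ a, l' ∘ₗ ρ a⁻¹ = l := by
    intro l l'
    refine ⟨fun h => ?_, fun ⟨a, ha⟩ => ha ▸ hχorb l' a⁻¹⟩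
    obtain ⟨a, b, hab⟩ := hmeet l l' (h ▸ hself l)
    refine ⟨a * b⁻¹, LinearMap.ext fun v => ?_⟩
    have := LinearMap.congr_fun hab (ρ a⁻¹ v)
    simp only [LinearMap.comp_apply, hρ] at this
    rw [mul_inv_cancel, hρ1] at this
    rw [this, LinearMap.comp_apply, _root_.mul_inv_rev, inv_inv]
  refine ⟨?_, ?_, ?_, ?_, ?_, ?_⟩
  · refine ⟨?_, fun u => ?_⟩
    · rintro ⟨u, hu⟩
      have : u ∈ {v | ∃ a, f v = ρ a (f u)} := ⟨1, (hρ1 _).symm⟩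
      change {v | ∃ a, f v = ρ a (f u)} = ∅ at hu
      rw [hu] at this
      exact this
    · refine ⟨{v | ∃ a, f v = ρ a (f u)}, ⟨⟨u, rfl⟩, 1, (hρ1 _).symm⟩, ?_⟩
      rintro _ ⟨⟨w, rfl⟩, a, ha⟩
      ext v
      constructor
      · rintro ⟨b, hb⟩
        exact ⟨b * a⁻¹, by rw [hb, ha, hρ, inv_mul_cancel_right]⟩
      · rintro ⟨b, hb⟩
        exact ⟨b * a, by rw [hb, ha, hρ]⟩
  · rintro _ ⟨w, rfl⟩ v ⟨a, ha⟩ u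
    obtain ⟨b, hb⟩ := hf u v
    exact ⟨b * a, by rw [hb, ha, hρ]⟩
  · rintro _ ⟨l, rfl⟩
    exact hchar l
  -- Both sets are parametrized by orbits, on the dual space and on the space.
  · have h1 : (Set.range χ).ncard =
        Nat.card (Quotient (@MulAction.orbitRel A _ _ (representationAction ρ.dual))) := by
      rw [← Nat.card_coe_set_eq]
      refine Nat.card_congr ((Setoid.quotientKerEquivRange χ).symm.trans
        (Quotient.congr (Equiv.refl _) fun l l' => ?_))
      exact hker l l'
    have h2 : (Set.range fun u => {v | ∃ a, f v = ρ a (f u)}).ncard =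
        Nat.card (Quotient (@MulAction.orbitRel A V _ (representationAction ρ))) := by
      rw [← Nat.card_coe_set_eq]
      refine Nat.card_congr ((Setoid.quotientKerEquivRange _).symm.trans
        (Quotient.congr f fun u w => ?_))
      change {v | ∃ a, f v = ρ a (f u)} = {v | ∃ a, f v = ρ a (f w)} ↔ ∃ a, ρ a (f w) = f u
      constructor
      · intro h
        obtain ⟨a, ha⟩ : u ∈ {v | ∃ a, f v = ρ a (f w)} := h ▸ ⟨1, (hρ1 _).symm⟩
        exact ⟨a, ha.symm⟩
      · rintro ⟨a, ha⟩
        ext v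
        constructor
        · rintro ⟨b, hb⟩
          exact ⟨b * a, by rw [hb, ← ha, hρ]⟩
        · rintro ⟨b, hb⟩
          exact ⟨b * a⁻¹, by rw [hb, ← ha, hρ, inv_mul_cancel_right]⟩
    rw [← (Set.finite_range χ).cast_ncard_eq, ← (Set.finite_range _).cast_ncard_eq, h1, h2,
      card_orbits_dual]
  · rintro _ ⟨l, rfl⟩ _ ⟨w, rfl⟩ u ⟨a, ha⟩ v ⟨b, hb⟩
    have h : ∀ u a, f u = ρ a (f w) → χ l u = c l * ∑ a, θ (l (ρ a (f w))) := by
      intro u a ha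
      rw [hχ, ha]
      congr 1
      exact Fintype.sum_equiv (Equiv.mulRight a) _ _ fun b => by rw [hρ]; rfl
    rw [h u a ha, h v b hb]
  · intro ψ hψ
    have hex : ∃ l, IsConstituent ψ (χ l) := by
      by_contra! hno
      obtain ⟨d, σ, hσ, rfl⟩ := hψ
      have hd : 0 < d := by
        rw [Nat.pos_iff_ne_zero]
        rintro rfl
        obtain ⟨W, W', hW⟩ := hσ.exists_pair_ne
        refine hW (SetLike.ext fun v => ?_)
        rw [Subsingleton.elim v 0]
        exact iff_of_true W.toSubmodule.zero_mem W'.toSubmodule.zero_mem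
      -- A combination of the functions `χ l` is a multiple of the regular character.
      have h1 : ∑ l, (c l)⁻¹ * ∑ u, χ l u * star (σ.character u) = 0 := by
        refine Finset.sum_eq_zero fun l _ => ?_
        have h := hno l
        rw [IsConstituent, not_not, characterInner_eq_sum, mul_eq_zero, or_iff_right hU] at h
        rw [h, mul_zero]
      simp only [Finset.mul_sum] at h1
      rw [Finset.sum_comm, Finset.sum_eq_single 1] at h1
      · have h2 : ∀ l, (c l)⁻¹ * (χ l 1 * star (σ.character 1)) = Nat.card A * d := by
          intro l
          rw [hχ, hf1, mul_assoc, inv_mul_cancel_left₀ (hc l)]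
          simp
        rw [Finset.sum_congr rfl fun l _ => h2 l, Finset.sum_const, nsmul_eq_mul] at h1
        refine mul_ne_zero (Nat.cast_ne_zero.2 ?_) (mul_ne_zero (Nat.cast_ne_zero.2 ?_)
          (Nat.cast_ne_zero.2 hd.ne')) h1
        · exact Finset.card_ne_zero.2 Finset.univ_nonempty
        · exact Nat.card_pos.ne'
      · intro u _ hu
        have h2 : ∀ l, (c l)⁻¹ * (χ l u * star (σ.character u)) =
            star (σ.character u) * ∑ a, θ (l (ρ a (f u))) := by
          intro l
          rw [hχ, mul_comm (c l), mul_comm _ (star _), ← mul_assoc, mul_comm _ (star _),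
            mul_assoc, mul_comm _ (c l), inv_mul_cancel_left₀ (hc l)]
        rw [Finset.sum_congr rfl fun l _ => h2 l, ← Finset.mul_sum, Finset.sum_comm,
          Finset.sum_eq_zero, mul_zero]
        intro a _
        refine sum_dual_addChar_apply_eq_zero hθ fun h0 => hu (f.injective ?_)
        rw [hf1, ← hρ1 (f u), ← inv_mul_cancel a, ← hρ, h0, map_zero]
      · simp
    obtain ⟨l, hl⟩ := hex
    refine ⟨χ l, ⟨⟨l, rfl⟩, hl⟩, ?_⟩
    rintro _ ⟨⟨l', rfl⟩, hl'⟩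
    exact horth _ _ (characterInner_ne_zero_of_isConstituent (hchar _) (hchar _) hψ hl' hl)

end LinearActions

/-! ### Symmetric matrices up to unitriangular congruence -/

section Congruence

variable {ι : Type*} [LinearOrder ι] [Fintype ι] {F : Type*} [Field F]

/-- The matrix `g` is upper triangular with ones on the diagonal, with respect to the order of the
index type. -/
def IsUnitriangular (g : Matrix ι ι F) : Prop :=
  (∀ i j, j < i → g i j = 0) ∧ ∀ i, g i i = 1

theorem IsUnitriangular.mul {g h : Matrix ι ι F} (hg : IsUnitriangular g)
    (hh : IsUnitriangular h) : IsUnitriangular (g * h) := by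
  refine ⟨fun i j hij => ?_, fun i => ?_⟩
  · rw [Matrix.mul_apply]
    refine Finset.sum_eq_zero fun k _ => ?_
    rcases lt_or_ge k i with hk | hk
    · rw [hg.1 _ _ hk, zero_mul]
    · rw [hh.1 _ _ (hij.trans_le hk), mul_zero]
  · rw [Matrix.mul_apply, Finset.sum_eq_single i, hg.2, hh.2, one_mul]
    · intro k _ hk
      rcases lt_or_gt_of_ne hk with hk | hk
      · rw [hg.1 _ _ hk, zero_mul]
      · rw [hh.1 _ _ hk, mul_zero]
    · simp

/-- The matrix has at most one nonzero entry in each row. -/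
def IsPartialMatching (y : Matrix ι ι F) : Prop :=
  ∀ i j k, y i j ≠ 0 → y i k ≠ 0 → j = k

/-- Adding multiples of a row `r` to the rows above it, and likewise for columns, is a unitriangular
congruence. -/
theorem exists_unitriangular_rowOperation (y : Matrix ι ι F) (r : ι) (c : ι → F)
    (hc : ∀ a, r ≤ a → c a = 0) :
    ∃ g : Matrix ι ι F, IsUnitriangular g ∧ ∀ a b,
      (g * y * gᵀ) a b = y a b + c a * y r b + c b * y a r + c a * c b * y r r := by
  refine ⟨1 + vecMulVec c (Pi.single r 1), ⟨fun i j hij => ?_, fun i => ?_⟩, fun a b => ?_⟩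
  · rw [Matrix.add_apply, one_apply_ne hij.ne', vecMulVec_apply, zero_add]
    by_cases h : j = r
    · rw [hc i (h ▸ hij.le), zero_mul]
    · rw [Pi.single_eq_of_ne h, mul_zero]
  · rw [Matrix.add_apply, one_apply_eq, vecMulVec_apply]
    by_cases h : i = r
    · rw [hc i h.ge, zero_mul, add_zero]
    · rw [Pi.single_eq_of_ne h, mul_zero, add_zero]
  · have h1 : ∀ z : Matrix ι ι F, ∀ a b, (vecMulVec c (Pi.single r 1) * z) a b = c a * z r b := by
      intro z a b
      simp [Matrix.mul_apply, vecMulVec_apply, Pi.single_apply, ite_mul]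
    have h2 : ∀ z : Matrix ι ι F, ∀ a b,
        (z * (vecMulVec c (Pi.single r 1))ᵀ) a b = c b * z a r := by
      intro z a b
      simp [Matrix.mul_apply, vecMulVec_apply, Pi.single_apply, mul_comm]
    rw [Matrix.transpose_add, Matrix.transpose_one, Matrix.mul_add, Matrix.add_mul, Matrix.one_mul,
      Matrix.mul_one, Matrix.add_apply, Matrix.add_apply, h2, Matrix.add_apply, h1, h1]
    ring

theorem transpose_congruence {κ : Type*} [Fintype κ] {y g : Matrix κ κ F} (hy : yᵀ = y) :
    (g * y * gᵀ)ᵀ = g * y * gᵀ := by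
  rw [Matrix.transpose_mul, Matrix.transpose_mul, Matrix.transpose_transpose, hy, Matrix.mul_assoc]

/-- Symmetric elimination on the set `A` of rows that still need to be cleared; the other rows have
at most one nonzero entry each, outside the columns with index in `A`. The pivot is the
last nonzero entry of the last nonzero row with index in `A`; characteristic different from two is
needed to clear the diagonal entry of the pivot column. -/
theorem exists_congruence_of_cleared (h2 : (2 : F) ≠ 0) (A : Finset ι) (y : Matrix ι ι F)
    (hy : yᵀ = y) (hm : ∀ i, i ∉ A → ∀ j k, y i j ≠ 0 → y i k ≠ 0 → j = k)
    (h0 : ∀ i, i ∉ A → ∀ j ∈ A, y i j = 0) :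
    ∃ g : Matrix ι ι F, IsUnitriangular g ∧ IsPartialMatching (g * y * gᵀ) := by
  induction A using Finset.strongInduction generalizing y with
  | H A ih =>
  have hsymm : ∀ {z : Matrix ι ι F}, zᵀ = z → ∀ a b, z a b = z b a := fun hz a b =>
    congrFun (congrFun hz b) a
  -- A congruence that leaves fewer rows to be cleared suffices.
  have step : ∀ B ⊂ A, ∀ g : Matrix ι ι F, IsUnitriangular g →
      (∀ i, i ∉ B → ∀ j k, (g * y * gᵀ) i j ≠ 0 → (g * y * gᵀ) i k ≠ 0 → j = k) →
      (∀ i, i ∉ B → ∀ j ∈ B, (g * y * gᵀ) i j = 0) →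
      ∃ g : Matrix ι ι F, IsUnitriangular g ∧ IsPartialMatching (g * y * gᵀ) := by
    intro B hB g hg h3 h4
    obtain ⟨g', hg', hm'⟩ := ih B hB _ (transpose_congruence hy) h3 h4
    refine ⟨g' * g, hg'.mul hg, ?_⟩
    rw [Matrix.transpose_mul]
    simpa only [Matrix.mul_assoc] using hm'
  by_cases hA : ∀ i ∈ A, ∀ j, y i j = 0
  · refine ⟨1, ⟨fun i j h => one_apply_ne h.ne', fun i => one_apply_eq i⟩, fun i j k hj hk => ?_⟩
    rw [Matrix.one_mul, Matrix.transpose_one, Matrix.mul_one] at hj hk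
    by_cases hi : i ∈ A
    · exact absurd (hA i hi j) hj
    · exact hm i hi j k hj hk
  push Not at hA
  classical
  obtain ⟨s, hs⟩ : ∃ s, s ∈ A ∧ (∃ j, y s j ≠ 0) ∧ ∀ i ∈ A, s < i → ∀ j, y i j = 0 := by
    have hne : (A.filter fun i => ∃ j, y i j ≠ 0).Nonempty := by
      obtain ⟨i, hi, hj⟩ := hA
      exact ⟨i, Finset.mem_filter.2 ⟨hi, hj⟩⟩
    refine ⟨_, (Finset.mem_filter.1 (Finset.max'_mem _ hne)).1,
      (Finset.mem_filter.1 (Finset.max'_mem _ hne)).2, fun i hi hlt j => ?_⟩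
    by_contra hij
    exact absurd (Finset.le_max' _ i (Finset.mem_filter.2 ⟨hi, j, hij⟩)) hlt.not_ge
  obtain ⟨hsA, hsne, hslast⟩ := hs
  obtain ⟨r, hr, hrlast⟩ : ∃ r, y s r ≠ 0 ∧ ∀ j, r < j → y s j = 0 := by
    have hne : (Finset.univ.filter fun j => y s j ≠ 0).Nonempty := by
      obtain ⟨j, hj⟩ := hsne
      exact ⟨j, Finset.mem_filter.2 ⟨Finset.mem_univ _, hj⟩⟩
    refine ⟨_, (Finset.mem_filter.1 (Finset.max'_mem _ hne)).2, fun j hlt => ?_⟩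
    by_contra hij
    exact absurd (Finset.le_max' _ j (Finset.mem_filter.2 ⟨Finset.mem_univ _, hij⟩)) hlt.not_ge
  have hout : ∀ i ∈ A, ∀ j, j ∉ A → y i j = 0 := fun i hi j hj => by
    rw [hsymm hy, h0 j hj i hi]
  have hrA : r ∈ A := by
    by_contra h
    exact hr (hout s hsA r h)
  have hrs : r ≤ s := by
    by_contra h
    rw [hsymm hy, hslast r hrA (not_le.1 h)] at hr
    exact hr rfl
  -- The entries of row `s` to the left of the pivot are cleared with column `r`.
  obtain ⟨g, hg, hgy⟩ := exists_unitriangular_rowOperation y r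
    (fun a => if a < r then -(y s a / y s r) else 0) (fun a ha => if_neg ha.not_gt)
  have hz := transpose_congruence (g := g) hy
  set z := g * y * gᵀ with hzdef
  have hcs : (if s < r then -(y s s / y s r) else 0) = (0 : F) := if_neg hrs.not_gt
  have hzs : ∀ b, b ≠ r → z s b = 0 := by
    intro b hb
    rw [hgy, hcs]
    rcases lt_or_gt_of_ne hb with h | h
    · rw [if_pos h]
      field_simp
      ring
    · rw [if_neg h.not_gt, hrlast b h]
      ring
  have hzsr : z s r = y s r := by
    rw [hgy, hcs, if_neg (lt_irrefl r)]
    ring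
  have hcout : ∀ i, i ∉ A → (if i < r then -(y s i / y s r) else 0) = 0 := fun i hi => by
    rw [hout s hsA i hi, zero_div, neg_zero, ite_self]
  have hzout : ∀ i, i ∉ A → ∀ b, z i b = y i b := fun i hi b => by
    rw [hgy, hcout i hi, h0 i hi r hrA]
    ring
  have hzlast : ∀ i ∈ A, s < i → ∀ b, z i b = 0 := fun i hi hlt b => by
    rw [hgy, if_neg (hrs.trans_lt hlt).not_gt, hslast i hi hlt, hslast i hi hlt]
    ring
  rcases hrs.eq_or_lt with rfl | hlt
  · refine step (A.erase r) (Finset.erase_ssubset hsA) g hg (fun i hi j k hj hk => ?_)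
      (fun i hi j hj => ?_)
    · rw [← hzdef] at hj hk
      rw [Finset.mem_erase, not_and_or, not_not] at hi
      rcases hi with rfl | hi
      · by_contra hjk
        rcases eq_or_ne j i with rfl | hji
        · exact hk (hzs k (Ne.symm hjk))
        · exact hj (hzs j hji)
      · rw [hzout i hi] at hj hk
        exact hm i hi j k hj hk
    · rw [← hzdef]
      rw [Finset.mem_erase, not_and_or, not_not] at hi
      rcases hi with rfl | hi
      · exact hzs j (Finset.ne_of_mem_erase hj)
      · rw [hzout i hi, h0 i hi j (Finset.mem_of_mem_erase hj)]
  · -- The other entries of column `r` are cleared with row `s`, which vanishes off the pivot.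
    obtain ⟨c, hc⟩ : ∃ c : ι → F, ∀ a, c a =
        if a < s then (if a = r then -(z r r / (2 * y s r)) else -(z r a / y s r)) else 0 :=
      ⟨_, fun _ => rfl⟩
    obtain ⟨g', hg', hgz⟩ := exists_unitriangular_rowOperation z s c
      (fun a ha => by rw [hc, if_neg ha.not_gt])
    have hw := transpose_congruence (g := g') hz
    set w := g' * z * g'ᵀ with hwdef
    have hw' : w = (g' * g) * y * (g' * g)ᵀ := by
      rw [hwdef, hzdef, Matrix.transpose_mul]
      simp only [Matrix.mul_assoc]
    have hzss : z s s = 0 := hzs s hlt.ne'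
    have hcs' : c s = 0 := by rw [hc, if_neg (lt_irrefl s)]
    have hws : ∀ b, w s b = z s b := fun b => by
      rw [hgz, hcs', hzss]
      ring
    have hzrs : z r s = y s r := by rw [hsymm hz, hzsr]
    have hwr : ∀ b, b ≠ s → w r b = 0 := by
      intro b hb
      rw [hgz, hzss]
      rcases eq_or_ne b r with rfl | hbr
      · rw [hzsr, hzrs]
        simp only [hc, if_pos hlt, if_true]
        field_simp
        ring
      · rw [hzs b hbr, hzrs]
        rcases lt_or_gt_of_ne hb with h | h
        · simp only [hc, if_pos h, if_neg hbr]
          field_simp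
          ring
        · have : z r b = 0 := by
            rw [hsymm hz]
            by_cases hbA : b ∈ A
            · exact hzlast b hbA h r
            · rw [hzout b hbA, h0 b hbA r hrA]
          simp only [hc, if_neg h.not_gt, this]
          ring
    have hwout : ∀ i, i ∉ A → ∀ b, w i b = y i b := fun i hi b => by
      have h3 : z r i = 0 := by rw [hsymm hz, hzout i hi, h0 i hi r hrA]
      have h4 : c i = 0 := by
        have : i ≠ r := fun h => hi (h ▸ hrA)
        simp only [hc, if_neg this, h3, zero_div, neg_zero, ite_self]
      rw [hgz, h4, hzout i hi, hzout i hi, h0 i hi s hsA]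
      ring
    refine step ((A.erase r).erase s) (lt_of_le_of_lt (Finset.erase_subset _ _)
      (Finset.erase_ssubset hrA)) (g' * g) (hg'.mul hg) (fun i hi j k hj hk => ?_)
      (fun i hi j hj => ?_)
    · rw [← hw'] at hj hk
      rw [Finset.mem_erase, not_and_or, not_not, Finset.mem_erase, not_and_or, not_not] at hi
      rcases hi with rfl | rfl | hi
      · rw [hws] at hj hk
        rw [not_imp_comm.1 (hzs j) hj, not_imp_comm.1 (hzs k) hk]
      · rw [not_imp_comm.1 (hwr j) hj, not_imp_comm.1 (hwr k) hk]
      · rw [hwout i hi] at hj hk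
        exact hm i hi j k hj hk
    · rw [← hw']
      rw [Finset.mem_erase, not_and_or, not_not, Finset.mem_erase, not_and_or, not_not] at hi
      rw [Finset.mem_erase, Finset.mem_erase] at hj
      rcases hi with rfl | rfl | hi
      · rw [hws, hzs j hj.2.1]
      · rw [hwr j hj.1]
      · rw [hwout i hi, h0 i hi j hj.2.2]

/-- In characteristic different from two, every symmetric matrix is congruent, by a unitriangular
matrix, to one with at most one nonzero entry in each row. -/
theorem exists_unitriangular_congruence (h2 : (2 : F) ≠ 0) {y : Matrix ι ι F} (hy : yᵀ = y) :
    ∃ g : Matrix ι ι F, IsUnitriangular g ∧ IsPartialMatching (g * y * gᵀ) :=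
  exists_congruence_of_cleared h2 Finset.univ y hy (fun i hi => absurd (Finset.mem_univ i) hi)
    (fun i hi => absurd (Finset.mem_univ i) hi)

end Congruence

/-! ### Unitriangular matrices as a unipotent group -/

section UnitriangularGroup

variable {m : ℕ} {F : Type*} [Field F]

theorem utMat_injective : Function.Injective (utMat : UT m F → Matrix (Fin m) (Fin m) F) :=
  fun _ _ h => Subtype.ext (Units.ext h)

theorem isUnitriangular_utMat (g : UT m F) : IsUnitriangular (utMat g) :=
  ⟨fun _ _ h => utMat_lower g h, utMat_diag g⟩

theorem utMat_pow (g : UT m F) (k : ℕ) : utMat (g ^ k) = utMat g ^ k := by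
  induction k with
  | zero => rw [pow_zero, pow_zero, utMat_one]
  | succ k ih => rw [pow_succ, pow_succ, utMat_mul, ih]

/-- The element of `UT_m(F)` with a given underlying unitriangular matrix. -/
noncomputable def utOf (M : Matrix (Fin m) (Fin m) F) (hM : IsUnitriangular M) : UT m F :=
  ⟨Matrix.GeneralLinearGroup.mkOfDetNeZero M (by
    have h : M.IsUpperTriangular := fun i j hij => hM.1 i j hij
    rw [Matrix.det_of_isUpperTriangular h]
    simp [hM.2]), hM.1, hM.2⟩

@[simp]
theorem utMat_utOf (M : Matrix (Fin m) (Fin m) F) (hM : IsUnitriangular M) :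
    utMat (utOf M hM) = M := rfl

theorem utMat_sub_one_mem_ut (g : UT m F) : utMat g - 1 ∈ ut m F := by
  intro i j hij
  rcases hij.eq_or_lt with rfl | h
  · rw [Matrix.sub_apply, utMat_diag, one_apply_eq, sub_self]
  · rw [Matrix.sub_apply, utMat_lower g h, one_apply_ne h.ne', sub_self]

theorem isUnitriangular_one_add {x : Matrix (Fin m) (Fin m) F} (hx : x ∈ ut m F) :
    IsUnitriangular (1 + x) := by
  refine ⟨fun i j hij => ?_, fun i => ?_⟩
  · rw [Matrix.add_apply, hx i j hij.le, one_apply_ne hij.ne', add_zero]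
  · rw [Matrix.add_apply, hx i i le_rfl, one_apply_eq, add_zero]

theorem mul_isUnitriangular_mem_ut {x y : Matrix (Fin m) (Fin m) F} (hx : x ∈ ut m F)
    (hy : IsUnitriangular y) :
    x * y ∈ ut m F := by
  simpa [utMat_one] using ut_mul_mem (1 : UT m F) hx hy.1

theorem mul_mem_ut {x y : Matrix (Fin m) (Fin m) F} (hx : x ∈ ut m F) (hy : y ∈ ut m F) :
    x * y ∈ ut m F := by
  simpa [utMat_one] using ut_mul_mem (1 : UT m F) hx fun i j hij => hy i j hij.le

theorem pow_mem_ut {x : Matrix (Fin m) (Fin m) F} (hx : x ∈ ut m F) {k : ℕ} (hk : k ≠ 0) :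
    x ^ k ∈ ut m F := by
  obtain ⟨k, rfl⟩ := Nat.exists_eq_succ_of_ne_zero hk
  induction k with
  | zero => simpa using hx
  | succ k ih => exact pow_succ x (k + 1) ▸ mul_mem_ut (ih k.succ_ne_zero) hx

theorem pow_eq_zero_of_mem_ut {x : Matrix (Fin m) (Fin m) F} (hx : x ∈ ut m F) : x ^ m = 0 := by
  have h : x.IsUpperTriangular := fun i j hij => hx i j hij.le
  have h1 := Matrix.aeval_self_charpoly x
  rw [Matrix.charpoly_of_isUpperTriangular x h] at h1
  have h2 : ∀ i, x i i = 0 := fun i => hx i i le_rfl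
  simpa [h2] using h1

/-- In odd characteristic the group `UT_m(F)` has no element of even order. -/
theorem exists_odd_pow_eq_one [Finite F] (h2 : (2 : F) ≠ 0) (g : UT m F) :
    ∃ k, Odd k ∧ g ^ k = 1 := by
  obtain ⟨p, hp⟩ := CharP.exists F
  have hprime : p.Prime := CharP.char_is_prime F p
  have : Fact p.Prime := ⟨hprime⟩
  have hp2 : p ≠ 2 := by
    rintro rfl
    exact h2 (by exact_mod_cast CharP.cast_eq_zero F 2)
  refine ⟨p ^ m, (hprime.odd_of_ne_two hp2).pow, utMat_injective ?_⟩
  rcases Nat.eq_zero_or_pos m with rfl | hm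
  · exact Subsingleton.elim _ _
  have : Nonempty (Fin m) := ⟨⟨0, hm⟩⟩
  have h1 : (utMat g - 1) ^ p ^ m = utMat g ^ p ^ m - 1 ^ p ^ m :=
    sub_pow_char_pow_of_commute (p := p) m (Commute.one_right _)
  rw [pow_eq_zero_of_le (Nat.lt_pow_self hprime.one_lt).le
    (pow_eq_zero_of_mem_ut (utMat_sub_one_mem_ut g)), one_pow] at h1
  rw [utMat_pow, utMat_one]
  exact (sub_eq_zero.1 h1.symm)

theorem exists_pow_mul_self_eq [Finite F] (h2 : (2 : F) ≠ 0) (g : UT m F) :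
    ∃ k : ℕ, g ^ k * g ^ k = g := by
  obtain ⟨_, ⟨k, rfl⟩, hk⟩ := exists_odd_pow_eq_one h2 g
  refine ⟨k + 1, ?_⟩
  rw [← pow_add, show k + 1 + (k + 1) = (2 * k + 1) + 1 by ring, pow_succ, hk, one_mul]

theorem mem_utSuperclass_self (g : UT m F) : g ∈ utSuperclass g :=
  ⟨1, 1, by rw [utMat_one, Matrix.one_mul, Matrix.mul_one]⟩

theorem utSuperclass_eq_of_mem {g h : UT m F} (hgh : h ∈ utSuperclass g) :
    utSuperclass h = utSuperclass g := by
  obtain ⟨a, b, hab⟩ := hgh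
  ext k
  constructor
  · rintro ⟨c, d, hcd⟩
    refine ⟨c * a, b * d, ?_⟩
    rw [hcd, hab, utMat_mul, utMat_mul]
    simp only [Matrix.mul_assoc]
  · rintro ⟨c, d, hcd⟩
    refine ⟨c * a⁻¹, b⁻¹ * d, ?_⟩
    rw [hcd, hab, utMat_mul, utMat_mul]
    calc utMat c * (utMat g - 1) * utMat d
        = utMat c * (utMat a⁻¹ * utMat a) * (utMat g - 1) * (utMat b * utMat b⁻¹) * utMat d := by
          rw [utMat_inv_mul, utMat_mul_inv, Matrix.mul_one, Matrix.mul_one]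
      _ = _ := by simp only [Matrix.mul_assoc]

end UnitriangularGroup

/-! ### The anti-involution and the action on the Lie algebra -/

section SymplecticAction

variable {n : ℕ} {F : Type*} [Field F]

/-- The sign of an index of a `2n × 2n` matrix: `-1` in the first half and `1` in the second. -/
def halfSign (F : Type*) [Field F] (i : Fin (2 * n)) : F := if (i : ℕ) < n then -1 else 1

theorem halfSign_mul_self (i : Fin (2 * n)) : halfSign F i * halfSign F i = 1 := by
  rw [halfSign]
  split_ifs <;> simp

theorem halfSign_rev (i : Fin (2 * n)) : halfSign F i.rev = -halfSign F i := by
  have hi := i.2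
  simp only [halfSign, Fin.val_rev]
  split_ifs <;> first | omega | simp

theorem halfSign_ne_zero (i : Fin (2 * n)) : halfSign F i ≠ 0 := fun h => by
  have := halfSign_mul_self (F := F) i
  simp [h] at this

theorem mul_symplecticOmega_apply (x : Matrix (Fin (2 * n)) (Fin (2 * n)) F) (i j : Fin (2 * n)) :
    (x * symplecticOmega n F) i j = -halfSign F j * x i j.rev := by
  rw [Matrix.mul_apply, Finset.sum_eq_single j.rev]
  · rw [← halfSign_rev, mul_comm]
    simp [symplecticOmega, halfSign]
  · intro k _ hk
    have : j ≠ k.rev := fun h => hk (by rw [h, Fin.rev_rev])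
    simp [symplecticOmega, this]
  · simp

theorem dagger_apply (x : Matrix (Fin (2 * n)) (Fin (2 * n)) F) (i j : Fin (2 * n)) :
    dagger x i j = halfSign F i * halfSign F j * x j.rev i.rev := by
  rw [dagger, Matrix.neg_apply, mul_symplecticOmega_apply, Matrix.mul_apply,
    Finset.sum_eq_single i.rev]
  · simp only [symplecticOmega, halfSign, of_apply, transpose_apply, if_true]
    split_ifs <;> ring
  · intro k _ hk
    simp [symplecticOmega, hk]
  · simp

theorem dagger_isUnitriangular {x : Matrix (Fin (2 * n)) (Fin (2 * n)) F}
    (hx : IsUnitriangular x) : IsUnitriangular (dagger x) :=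
  ⟨dagger_lower hx.1, fun i => by rw [dagger_apply, halfSign_mul_self, hx.2, one_mul]⟩

theorem usp_apply (x : usp n F) (i j : Fin (2 * n)) :
    (x : Matrix (Fin (2 * n)) (Fin (2 * n)) F) i j =
      -(halfSign F i * halfSign F j * (x : Matrix _ _ F) j.rev i.rev) := by
  rw [← dagger_apply, x.2.2, Matrix.neg_apply, neg_neg]

/-- Multiplication by `Ω` turns `𝔲𝔰𝔭` into a space of symmetric matrices. -/
theorem transpose_mul_symplecticOmega (x : usp n F) :
    ((x : Matrix (Fin (2 * n)) (Fin (2 * n)) F) * symplecticOmega n F)ᵀ =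
      (x : Matrix _ _ F) * symplecticOmega n F := by
  ext i j
  rw [Matrix.transpose_apply, mul_symplecticOmega_apply, mul_symplecticOmega_apply, usp_apply,
    halfSign_rev, Fin.rev_rev]
  linear_combination (-halfSign F j * (x : Matrix _ _ F) i j.rev) * halfSign_mul_self (F := F) i

/-- Multiplication by `Ω` turns the action `x ↦ g x g†` into the congruence `y ↦ g y gᵗ`. -/
theorem mul_dagger_mul_symplecticOmega (g x : Matrix (Fin (2 * n)) (Fin (2 * n)) F) :
    g * x * dagger g * symplecticOmega n F = g * (x * symplecticOmega n F) * gᵀ := by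
  have h : dagger g * symplecticOmega n F = symplecticOmega n F * gᵀ := by
    rw [dagger, Matrix.neg_mul, Matrix.mul_assoc _ (symplecticOmega n F),
      symplecticOmega_mul_self, Matrix.mul_neg, Matrix.mul_one, neg_neg]
  rw [Matrix.mul_assoc, h]
  simp only [Matrix.mul_assoc]

theorem uspAction_coe (g : UT (2 * n) F) (x : usp n F) :
    (uspAction g x : Matrix (Fin (2 * n)) (Fin (2 * n)) F) =
      utMat g * (x : Matrix _ _ F) * dagger (utMat g) := rfl

variable (n F) in
/-- The action `g · x = g x g†` as a linear representation of `UT_{2n}(F)`. -/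
def uspRepresentation : Representation F (UT (2 * n) F) (usp n F) where
  toFun := uspAction
  map_one' := by
    ext x : 2
    simp [uspAction_coe, utMat_one, dagger_one]
  map_mul' g h := by
    ext x : 2
    simp [uspAction_coe, utMat_mul, dagger_mul, Matrix.mul_assoc]

theorem uspAction_mul (g h : UT (2 * n) F) (x : usp n F) :
    uspAction (g * h) x = uspAction g (uspAction h x) :=
  LinearMap.congr_fun ((uspRepresentation n F).map_mul g h) x

theorem uspAction_one (x : usp n F) : uspAction (1 : UT (2 * n) F) x = x :=
  LinearMap.congr_fun (uspRepresentation n F).map_one x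

/-- Two elements of `𝔲𝔰𝔭` in the same double coset under `UT_{2n}(F)` are in the same orbit. After
a translation `y = x b`; then `x b = b† x`, hence `x b = c† x c` where `c` is a power of `b` with
`c² = b`. -/
theorem exists_uspAction_eq [Finite F] (h2 : (2 : F) ≠ 0) {x y : usp n F} {a b : UT (2 * n) F}
    (h : (y : Matrix (Fin (2 * n)) (Fin (2 * n)) F) = utMat a * (x : Matrix _ _ F) * utMat b) :
    ∃ g, y = uspAction g x := by
  let d : UT (2 * n) F := b * utOf _ (dagger_isUnitriangular (isUnitriangular_utMat a⁻¹))
  have hz : (uspAction a⁻¹ y : Matrix (Fin (2 * n)) (Fin (2 * n)) F) =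
      (x : Matrix _ _ F) * utMat d := by
    rw [uspAction_coe, h, utMat_mul, utMat_utOf]
    calc _ = (utMat a⁻¹ * utMat a) * (x : Matrix _ _ F) * utMat b * dagger (utMat a⁻¹) := by
          simp only [Matrix.mul_assoc]
      _ = _ := by rw [utMat_inv_mul, Matrix.one_mul, Matrix.mul_assoc]
  have hcomm : (x : Matrix _ _ F) * utMat d = dagger (utMat d) * (x : Matrix _ _ F) := by
    have h1 := (uspAction a⁻¹ y).2.2
    rw [hz, dagger_mul, x.2.2, Matrix.mul_neg, neg_inj] at h1
    exact h1.symm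
  have hpow : ∀ k : ℕ, (x : Matrix _ _ F) * utMat d ^ k =
      dagger (utMat (d ^ k)) * (x : Matrix _ _ F) := by
    intro k
    induction k with
    | zero => rw [pow_zero, pow_zero, utMat_one, dagger_one, Matrix.mul_one, Matrix.one_mul]
    | succ k ih =>
      rw [pow_succ, ← Matrix.mul_assoc, ih, Matrix.mul_assoc, hcomm, ← Matrix.mul_assoc,
        ← dagger_mul, ← utMat_mul, ← pow_succ']
  obtain ⟨k, hk⟩ := exists_pow_mul_self_eq h2 d
  let c : UT (2 * n) F := utOf _ (dagger_isUnitriangular (isUnitriangular_utMat (d ^ k)))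
  have hc : uspAction a⁻¹ y = uspAction c x := by
    apply Subtype.ext
    rw [hz, uspAction_coe, utMat_utOf, dagger_dagger, ← hpow, Matrix.mul_assoc, ← utMat_pow,
      ← utMat_mul, hk]
  refine ⟨a * c, ?_⟩
  rw [uspAction_mul, ← hc, ← uspAction_mul, mul_inv_cancel, uspAction_one]

end SymplecticAction

/-! ### Springer morphisms -/

section Springer

variable {n : ℕ} {F : Type*} [Field F]

/-- A Springer morphism is multiplication of `g - 1` by a unitriangular matrix, which is a
polynomial in `g - 1` with constant term one. -/
theorem SpringerMorphism.exists_eq_mul (f : SpringerMorphism n F) (g : UT (2 * n) F) :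
    ∃ (h : UT (2 * n) F) (a : ℕ → F),
      (f.toFun g : Matrix (Fin (2 * n)) (Fin (2 * n)) F) = (utMat g - 1) * utMat h ∧
      utMat h = 1 + ∑ i ∈ Finset.Ico 2 (2 * n), a i • (utMat g - 1) ^ (i - 1) := by
  obtain ⟨a, ha⟩ := f.exists_coeff
  have hmem : ∑ i ∈ Finset.Ico 2 (2 * n), a i • (utMat g - 1) ^ (i - 1) ∈ ut (2 * n) F := by
    refine Submodule.sum_mem _ fun i hi => Submodule.smul_mem _ _
      (pow_mem_ut (utMat_sub_one_mem_ut g) ?_)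
    have := (Finset.mem_Ico.1 hi).1
    omega
  refine ⟨utOf _ (isUnitriangular_one_add hmem), a, ?_, rfl⟩
  rw [ha, utMat_utOf, Matrix.mul_add, Matrix.mul_one, Finset.mul_sum]
  congr 1
  refine Finset.sum_congr rfl fun i hi => ?_
  have := (Finset.mem_Ico.1 hi).1
  rw [Matrix.mul_smul, ← pow_succ', show i - 1 + 1 = i by omega]

theorem SpringerMorphism.map_conj (f : SpringerMorphism n F) (g v : UT (2 * n) F) :
    (f.toFun (v * g * v⁻¹) : Matrix (Fin (2 * n)) (Fin (2 * n)) F) =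
      utMat v * (f.toFun g : Matrix _ _ F) * utMat v⁻¹ := by
  obtain ⟨a, ha⟩ := f.exists_coeff
  have h1 : utMat (v * g * v⁻¹) - 1 = utMat v * (utMat g - 1) * utMat v⁻¹ := by
    rw [utMat_mul, utMat_mul, Matrix.mul_sub, Matrix.sub_mul, Matrix.mul_one, utMat_mul_inv]
  have h2 : ∀ k : ℕ, (utMat v * (utMat g - 1) * utMat v⁻¹) ^ k =
      utMat v * (utMat g - 1) ^ k * utMat v⁻¹ := by
    intro k
    induction k with
    | zero => rw [pow_zero, pow_zero, Matrix.mul_one, utMat_mul_inv]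
    | succ k ih =>
      rw [pow_succ, ih, pow_succ]
      calc _ = utMat v * (utMat g - 1) ^ k * (utMat v⁻¹ * utMat v) * (utMat g - 1) *
            utMat v⁻¹ := by simp only [Matrix.mul_assoc]
        _ = _ := by rw [utMat_inv_mul, Matrix.mul_one]; simp only [Matrix.mul_assoc]
  rw [ha, ha, h1, Matrix.mul_add, Matrix.add_mul, Finset.mul_sum, Finset.sum_mul]
  congr 1
  refine Finset.sum_congr rfl fun i _ => ?_
  rw [h2, Matrix.mul_smul, Matrix.smul_mul]

theorem SpringerMorphism.onUSp_conj (f : SpringerMorphism n F) (u v : USp n F) :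
    f.onUSp (v * u * v⁻¹) = uspAction (v : UT (2 * n) F) (f.onUSp u) := by
  apply Subtype.ext
  rw [uspAction_coe, ← show utMat (v : UT (2 * n) F)⁻¹ = dagger (utMat (v : UT (2 * n) F)) from v.2]
  exact f.map_conj u v

/-- The bijection from `USp_{2n}(F)` to `𝔲𝔰𝔭_{2n}(F)` given by a Springer morphism. -/
noncomputable def SpringerMorphism.uspEquiv (f : SpringerMorphism n F) : USp n F ≃ usp n F :=
  Equiv.ofBijective f.onUSp ⟨fun u v h => by
    refine Subtype.ext (f.bijective.1 (Subtype.ext ?_))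
    exact congrArg (fun x : usp n F => (x : Matrix (Fin (2 * n)) (Fin (2 * n)) F)) h, fun x => by
    have hx : (x : Matrix (Fin (2 * n)) (Fin (2 * n)) F) ∈
        (usp n F : Set (Matrix (Fin (2 * n)) (Fin (2 * n)) F)) := x.2
    rw [← f.image_eq] at hx
    obtain ⟨u, hu, hux⟩ := hx
    exact ⟨⟨u, hu⟩, Subtype.ext hux⟩⟩

theorem SpringerMorphism.uspEquiv_apply (f : SpringerMorphism n F) (u : USp n F) :
    f.uspEquiv u = f.onUSp u := rfl

theorem SpringerMorphism.onUSp_one (f : SpringerMorphism n F) : f.onUSp 1 = 0 := by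
  apply Subtype.ext
  obtain ⟨h, a, hh, -⟩ := f.exists_eq_mul 1
  change (f.toFun 1 : Matrix (Fin (2 * n)) (Fin (2 * n)) F) = 0
  rw [hh, utMat_one, sub_self, Matrix.zero_mul]

/-- The superclasses of the action are cut out by the superclasses of the algebra group. -/
theorem mem_actionSuperclass_iff [Finite F] (h2 : (2 : F) ≠ 0) (f : SpringerMorphism n F)
    (u v : USp n F) :
    v ∈ actionSuperclass f u ↔ (v : UT (2 * n) F) ∈ utSuperclass (u : UT (2 * n) F) := by
  obtain ⟨h, a, hu, -⟩ := f.exists_eq_mul u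
  obtain ⟨k, b, hv, -⟩ := f.exists_eq_mul v
  constructor
  · rintro ⟨g, hg⟩
    have hg' := congrArg (fun x : usp n F => (x : Matrix (Fin (2 * n)) (Fin (2 * n)) F)) hg
    change (f.toFun v : Matrix (Fin (2 * n)) (Fin (2 * n)) F) =
      utMat g * (f.toFun u : Matrix _ _ F) * dagger (utMat g) at hg'
    rw [hu, hv] at hg'
    refine ⟨g, h * utOf _ (dagger_isUnitriangular (isUnitriangular_utMat g)) * k⁻¹, ?_⟩
    calc utMat (v : UT (2 * n) F) - 1
        = (utMat (v : UT (2 * n) F) - 1) * (utMat k * utMat k⁻¹) := by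
          rw [utMat_mul_inv, Matrix.mul_one]
      _ = (utMat (v : UT (2 * n) F) - 1) * utMat k * utMat k⁻¹ := by rw [Matrix.mul_assoc]
      _ = _ := by
        rw [hg', utMat_mul, utMat_mul, utMat_utOf]
        simp only [Matrix.mul_assoc]
  · rintro ⟨c, d, hcd⟩
    refine exists_uspAction_eq h2 (a := c) (b := h⁻¹ * d * k) ?_
    change (f.toFun v : Matrix (Fin (2 * n)) (Fin (2 * n)) F) =
      utMat c * (f.toFun u : Matrix _ _ F) * utMat (h⁻¹ * d * k)
    rw [hu, hv, hcd, utMat_mul, utMat_mul]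
    calc utMat c * (utMat (u : UT (2 * n) F) - 1) * utMat d * utMat k
        = utMat c * (utMat (u : UT (2 * n) F) - 1) * (utMat h * utMat h⁻¹) * utMat d *
            utMat k := by rw [utMat_mul_inv, Matrix.mul_one]
      _ = _ := by simp only [Matrix.mul_assoc]

theorem range_actionSuperclass [Finite F] (h2 : (2 : F) ≠ 0) (f : SpringerMorphism n F) :
    Set.range (actionSuperclass f) = superclassIntersections n F := by
  have h : ∀ u, actionSuperclass f u =
      {v : USp n F | (v : UT (2 * n) F) ∈ utSuperclass (u : UT (2 * n) F)} := fun u =>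
    Set.ext fun v => mem_actionSuperclass_iff h2 f u v
  ext K
  constructor
  · rintro ⟨u, rfl⟩
    exact ⟨⟨u, (mem_actionSuperclass_iff h2 f u u).2 (mem_utSuperclass_self _)⟩, u, h u⟩
  · rintro ⟨⟨u, hu⟩, g, rfl⟩
    exact ⟨u, by rw [h, utSuperclass_eq_of_mem hu]⟩

end Springer

/-! ### The Cayley map -/

section Cayley

variable {n : ℕ} {F : Type*} [Field F]

/-- The anti-involution `†` as a map on the group `UT_{2n}(F)`. -/
noncomputable def daggerUT (g : UT (2 * n) F) : UT (2 * n) F :=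
  utOf _ (dagger_isUnitriangular (isUnitriangular_utMat g))

theorem utMat_daggerUT (g : UT (2 * n) F) : utMat (daggerUT g) = dagger (utMat g) := rfl

theorem daggerUT_mul (g h : UT (2 * n) F) : daggerUT (g * h) = daggerUT h * daggerUT g :=
  utMat_injective (by rw [utMat_mul, utMat_daggerUT, utMat_mul, dagger_mul]; rfl)

theorem daggerUT_one : daggerUT (1 : UT (2 * n) F) = 1 :=
  utMat_injective (by rw [utMat_daggerUT, utMat_one, dagger_one])

theorem daggerUT_inv (g : UT (2 * n) F) : daggerUT g⁻¹ = (daggerUT g)⁻¹ := by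
  rw [eq_inv_iff_mul_eq_one, ← daggerUT_mul, mul_inv_cancel, daggerUT_one]

theorem mem_USp_iff (g : UT (2 * n) F) : g ∈ USp n F ↔ daggerUT g = g⁻¹ := by
  change utMat g⁻¹ = dagger (utMat g) ↔ _
  rw [← utMat_daggerUT, utMat_injective.eq_iff, eq_comm]

/-- The element `(1 + g) / 2`. -/
noncomputable def cayleyDenominator (g : UT (2 * n) F) : UT (2 * n) F :=
  utOf _ (isUnitriangular_one_add (Submodule.smul_mem _ (2 : F)⁻¹ (utMat_sub_one_mem_ut g)))

theorem utMat_cayleyDenominator (g : UT (2 * n) F) :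
    utMat (cayleyDenominator g) = 1 + (2 : F)⁻¹ • (utMat g - 1) := rfl

/-- The Cayley map `g ↦ 2 (g - 1) (g + 1)⁻¹`. -/
noncomputable def cayley (g : UT (2 * n) F) : ut (2 * n) F :=
  ⟨(utMat g - 1) * utMat (cayleyDenominator g)⁻¹,
    mul_isUnitriangular_mem_ut (utMat_sub_one_mem_ut g) (isUnitriangular_utMat _)⟩

theorem cayley_coe (g : UT (2 * n) F) :
    (cayley g : Matrix (Fin (2 * n)) (Fin (2 * n)) F) =
      (utMat g - 1) * utMat (cayleyDenominator g)⁻¹ := rfl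

theorem one_sub_half_cayley (g : UT (2 * n) F) :
    1 - (2 : F)⁻¹ • (cayley g : Matrix (Fin (2 * n)) (Fin (2 * n)) F) =
      utMat (cayleyDenominator g)⁻¹ := by
  have h := utMat_mul_inv (cayleyDenominator g)
  rw [utMat_cayleyDenominator, Matrix.add_mul, Matrix.one_mul, Matrix.smul_mul] at h
  rw [cayley_coe]
  exact sub_eq_of_eq_add h.symm

theorem cayleyDenominator_injective (h2 : (2 : F) ≠ 0) :
    Function.Injective (cayleyDenominator : UT (2 * n) F → UT (2 * n) F) := by
  intro g h hgh
  have h1 := congrArg utMat hgh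
  rw [utMat_cayleyDenominator, utMat_cayleyDenominator, add_right_inj] at h1
  exact utMat_injective (sub_left_injective (smul_right_injective _ (inv_ne_zero h2) h1))

theorem cayley_bijective (h2 : (2 : F) ≠ 0) :
    Function.Bijective (cayley : UT (2 * n) F → ut (2 * n) F) := by
  constructor
  · intro g h hgh
    refine cayleyDenominator_injective h2 (inv_injective (utMat_injective ?_))
    rw [← one_sub_half_cayley, ← one_sub_half_cayley, hgh]
  · intro y
    let k : UT (2 * n) F := utOf _ (isUnitriangular_one_add
      (Submodule.smul_mem _ (-(2 : F)⁻¹) y.2))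
    let g : UT (2 * n) F := utOf _ (isUnitriangular_one_add
      (Submodule.smul_mem _ (2 : F) (utMat_sub_one_mem_ut k⁻¹)))
    have hg : utMat g - 1 = (2 : F) • (utMat k⁻¹ - 1) := add_sub_cancel_left _ _
    have hk : cayleyDenominator g = k⁻¹ := by
      apply utMat_injective
      rw [utMat_cayleyDenominator, hg, smul_smul, inv_mul_cancel₀ h2, one_smul, add_sub_cancel]
    refine ⟨g, Subtype.ext ?_⟩
    rw [cayley_coe, hk, inv_inv, hg, Matrix.smul_mul, Matrix.sub_mul, utMat_inv_mul,
      Matrix.one_mul, utMat_utOf, sub_add_cancel_left, neg_smul, neg_neg, smul_smul,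
      mul_inv_cancel₀ h2, one_smul]

/-- The Cayley map is a truncated geometric series. -/
theorem cayley_eq_sum (g : UT (2 * n) F) :
    (cayley g : Matrix (Fin (2 * n)) (Fin (2 * n)) F) =
      (utMat g - 1) + ∑ i ∈ Finset.Ico 2 (2 * n), (-(2 : F)⁻¹) ^ (i - 1) • (utMat g - 1) ^ i := by
  rcases Nat.eq_zero_or_pos n with rfl | hn
  · have : IsEmpty (Fin (2 * 0)) := Fin.isEmpty
    exact Subsingleton.elim _ _
  set x := utMat g - 1 with hx
  have h : ∀ N, 2 ≤ N → (x + ∑ i ∈ Finset.Ico 2 N, (-(2 : F)⁻¹) ^ (i - 1) • x ^ i) *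
      utMat (cayleyDenominator g) = x - (-(2 : F)⁻¹) ^ (N - 1) • x ^ N := by
    intro N hN
    rw [utMat_cayleyDenominator, ← hx]
    induction N, hN using Nat.le_induction with
    | base =>
      rw [Finset.Ico_self, Finset.sum_empty, add_zero, Matrix.mul_add, Matrix.mul_one,
        Matrix.mul_smul, pow_two, pow_one, neg_smul, sub_neg_eq_add]
    | succ N hN ih =>
      rw [Finset.sum_Ico_succ_top hN, ← add_assoc, Matrix.add_mul, ih, Matrix.mul_add,
        Matrix.mul_one, Matrix.mul_smul, Matrix.smul_mul, ← pow_succ, smul_smul,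
        show N + 1 - 1 = (N - 1) + 1 by omega, pow_succ (-(2 : F)⁻¹), mul_neg, neg_smul,
        mul_comm (2 : F)⁻¹]
      abel
  have h1 := h (2 * n) (by omega)
  rw [pow_eq_zero_of_mem_ut (utMat_sub_one_mem_ut g), smul_zero, sub_zero] at h1
  rw [cayley_coe, ← hx]
  nth_rw 1 [← h1]
  rw [Matrix.mul_assoc, utMat_mul_inv, Matrix.mul_one]

/-- The condition `y† = -y` on the Cayley transform `y` of `g` says that `(1 - y/2)† = 1 + y/2`,
where `1 - y/2` and `1 + y/2` are `k⁻¹` and `g k⁻¹` with `k = (1 + g)/2`. -/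
theorem cayley_mem_usp_iff (h2 : (2 : F) ≠ 0) (g : UT (2 * n) F) :
    (cayley g : Matrix (Fin (2 * n)) (Fin (2 * n)) F) ∈ usp n F ↔ g ∈ USp n F := by
  set k := cayleyDenominator g with hk
  have hplus : 1 + (2 : F)⁻¹ • (cayley g : Matrix (Fin (2 * n)) (Fin (2 * n)) F) =
      utMat (g * k⁻¹) := by
    have h1 : 1 + (2 : F)⁻¹ • (cayley g : Matrix (Fin (2 * n)) (Fin (2 * n)) F) =
        (cayley g : Matrix _ _ F) + utMat k⁻¹ := by
      rw [← one_sub_half_cayley]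
      have h3 : (cayley g : Matrix (Fin (2 * n)) (Fin (2 * n)) F) =
          (2 : F)⁻¹ • (cayley g : Matrix _ _ F) + (2 : F)⁻¹ • (cayley g : Matrix _ _ F) := by
        rw [← two_smul F, smul_smul, mul_inv_cancel₀ h2, one_smul]
      nth_rw 2 [h3]
      abel
    rw [h1, cayley_coe, utMat_mul, Matrix.sub_mul, Matrix.one_mul, sub_add_cancel]
  have hstep : dagger (cayley g : Matrix (Fin (2 * n)) (Fin (2 * n)) F) =
      -(cayley g : Matrix _ _ F) ↔
      daggerUT k⁻¹ = g * k⁻¹ := by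
    rw [← utMat_injective.eq_iff, utMat_daggerUT, ← hplus, ← one_sub_half_cayley, sub_eq_add_neg,
      dagger_add, dagger_one, ← neg_smul, dagger_smul, add_right_inj, neg_smul, neg_eq_iff_eq_neg,
      ← smul_neg, (smul_right_injective _ (inv_ne_zero h2)).eq_iff]
  have hk2 : daggerUT k = k * g⁻¹ ↔ daggerUT g = g⁻¹ := by
    rw [← utMat_injective.eq_iff, ← utMat_injective.eq_iff, utMat_daggerUT, utMat_daggerUT,
      utMat_mul, hk, utMat_cayleyDenominator, dagger_add, dagger_smul, sub_eq_add_neg, dagger_add,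
      Matrix.add_mul, Matrix.smul_mul, Matrix.add_mul, utMat_mul_inv, Matrix.one_mul,
      Matrix.neg_mul, Matrix.one_mul, dagger_one, ← neg_one_smul F (1 : Matrix _ _ F), dagger_smul,
      dagger_one]
    have h3 : (1 : Matrix (Fin (2 * n)) (Fin (2 * n)) F) =
        (2 : F)⁻¹ • (1 : Matrix _ _ F) + (2 : F)⁻¹ • (1 : Matrix _ _ F) := by
      rw [← two_smul F, smul_smul, mul_inv_cancel₀ h2, one_smul]
    have h4 : ∀ z : Matrix (Fin (2 * n)) (Fin (2 * n)) F,
        1 + (2 : F)⁻¹ • (z + (-1 : F) • (1 : Matrix _ _ F)) = (2 : F)⁻¹ • (z + 1) := by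
      intro z
      nth_rw 1 [h3]
      module
    have h5 : ∀ z : Matrix (Fin (2 * n)) (Fin (2 * n)) F,
        z + (2 : F)⁻¹ • (1 + -z) = (2 : F)⁻¹ • (z + 1) := by
      intro z
      have : z = (2 : F)⁻¹ • z + (2 : F)⁻¹ • z := by
        rw [← two_smul F, smul_smul, mul_inv_cancel₀ h2, one_smul]
      nth_rw 1 [this]
      module
    rw [h4, h5, (smul_right_injective _ (inv_ne_zero h2)).eq_iff, add_left_inj]
  rw [mem_USp_iff, ← hk2, ← inv_inj (a := daggerUT k), ← daggerUT_inv, _root_.mul_inv_rev, inv_inv,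
    ← hstep]
  exact ⟨fun h => h.2, fun h => ⟨(cayley g).2, h⟩⟩

theorem nonempty_springerMorphism (h2 : (2 : F) ≠ 0) : Nonempty (SpringerMorphism n F) := by
  refine ⟨⟨cayley, cayley_bijective h2, ?_, _, cayley_eq_sum⟩⟩
  ext y
  constructor
  · rintro ⟨u, hu, rfl⟩
    exact (cayley_mem_usp_iff h2 u).2 hu
  · intro hy
    obtain ⟨g, hg⟩ := (cayley_bijective h2).2 ⟨y, hy.1⟩
    have hgy : (cayley g : Matrix (Fin (2 * n)) (Fin (2 * n)) F) = y := by rw [hg]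
    exact ⟨g, (cayley_mem_usp_iff h2 g).1 (hgy ▸ hy), hgy⟩

end Cayley

/-! ### Root vectors and representatives of the orbits -/

section Roots

variable {n : ℕ} {F : Type*} [Field F]

instance PosRoot.instFinite : Finite (PosRoot n) :=
  inferInstanceAs (Finite {p : Fin (2 * n) × Fin (2 * n) // p.1 < p.2 ∧ p.2 ≤ p.1.rev})

noncomputable instance PosRoot.instFintype : Fintype (PosRoot n) := Fintype.ofFinite _

theorem PosRoot.row_lt_col (α : PosRoot n) : α.row < α.col := α.2.1

theorem PosRoot.col_le_rev_row (α : PosRoot n) : α.col ≤ α.row.rev := α.2.2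

theorem PosRoot.row_val_lt (α : PosRoot n) : (α.row : ℕ) < n := by
  have h1 := Fin.lt_def.1 α.row_lt_col
  have h2 := Fin.le_def.1 α.col_le_rev_row
  rw [Fin.val_rev] at h2
  omega

theorem PosRoot.ext {α β : PosRoot n} (h1 : α.row = β.row) (h2 : α.col = β.col) : α = β :=
  Subtype.ext (Prod.ext h1 h2)

theorem PosRoot.rootVector_apply (α : PosRoot n) (i j : Fin (2 * n)) :
    α.rootVector F i j = if i = α.row ∧ j = α.col then 1 else
      if i = α.col.rev ∧ j = α.row.rev then -(halfSign F α.row * halfSign F α.col) else 0 := by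
  have hr := α.row_val_lt
  have hlt := α.row_lt_col
  simp only [PosRoot.rootVector, halfSign, if_pos hr]
  by_cases h1 : α.col = α.row.rev
  · rw [if_pos h1]
    have h2 : α.col.rev = α.row := by rw [h1, Fin.rev_rev]
    rw [h2, ← h1, Matrix.single_apply]
    split_ifs <;> first | rfl | tauto
  · have h2 : α.row ≠ α.col.rev := fun h => h1 (by rw [h, Fin.rev_rev])
    rw [if_neg h1]
    by_cases h3 : (α.col : ℕ) < n
    · simp only [if_pos h3, Matrix.sub_apply, Matrix.single_apply, eq_comm (b := i),
        eq_comm (b := j)]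
      by_cases h4 : i = α.row ∧ j = α.col
      · have h5 : ¬(i = α.col.rev ∧ j = α.row.rev) := fun h => h2 (h4.1.symm.trans h.1)
        simp only [if_pos h4, if_neg h5, sub_zero]
      · simp only [if_neg h4]
        split_ifs <;> simp
    · simp only [if_neg h3, Matrix.add_apply, Matrix.single_apply, eq_comm (b := i),
        eq_comm (b := j)]
      by_cases h4 : i = α.row ∧ j = α.col
      · have h5 : ¬(i = α.col.rev ∧ j = α.row.rev) := fun h => h2 (h4.1.symm.trans h.1)
        simp only [if_pos h4, if_neg h5, add_zero]
      · simp only [if_neg h4]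
        split_ifs <;> simp

theorem PosRoot.rootVector_mem_usp (α : PosRoot n) : α.rootVector F ∈ usp n F := by
  have hlt := α.row_lt_col
  constructor
  · intro i j hij
    rw [PosRoot.rootVector_apply, if_neg, if_neg]
    · rintro ⟨rfl, rfl⟩
      exact absurd (Fin.rev_lt_rev.2 hlt) hij.not_gt
    · rintro ⟨rfl, rfl⟩
      exact absurd hlt hij.not_gt
  · ext i j
    rw [dagger_apply, Matrix.neg_apply, PosRoot.rootVector_apply, PosRoot.rootVector_apply]
    have e1 : (j.rev = α.row ∧ i.rev = α.col) ↔ (i = α.col.rev ∧ j = α.row.rev) := by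
      rw [Fin.rev_eq_iff, Fin.rev_eq_iff, and_comm]
    have e2 : (j.rev = α.col.rev ∧ i.rev = α.row.rev) ↔ (i = α.row ∧ j = α.col) := by
      rw [Fin.rev_inj, Fin.rev_inj, and_comm]
    simp only [e1, e2]
    have hr := halfSign_mul_self (F := F) α.row
    have hc := halfSign_mul_self (F := F) α.col
    by_cases h1 : i = α.col.rev ∧ j = α.row.rev
    · rw [if_pos h1, if_pos h1]
      by_cases h2 : i = α.row ∧ j = α.col
      · rw [if_pos h2]
        have h3 : j = i.rev := by rw [h1.1, Fin.rev_rev, h2.2]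
        rw [h3, halfSign_rev]
        linear_combination -halfSign_mul_self (F := F) i
      · rw [if_neg h2, h1.1, h1.2, halfSign_rev, halfSign_rev]
        ring
    · rw [if_neg h1, if_neg h1]
      by_cases h2 : i = α.row ∧ j = α.col
      · rw [if_pos h2, if_pos h2, h2.1, h2.2]
        linear_combination (-(halfSign F α.col * halfSign F α.col)) * hr - hc
      · rw [if_neg h2, if_neg h2, mul_zero, neg_zero]

/-- The coordinate of an element of `𝔲𝔰𝔭` at the position of a root. -/
def rootCoord (F : Type*) [Field F] (α : PosRoot n) : Module.Dual F (usp n F) where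
  toFun x := (x : Matrix (Fin (2 * n)) (Fin (2 * n)) F) α.row α.col
  map_add' _ _ := rfl
  map_smul' _ _ := rfl

theorem rootCoord_apply (α : PosRoot n) (x : usp n F) :
    rootCoord F α x = (x : Matrix (Fin (2 * n)) (Fin (2 * n)) F) α.row α.col := rfl

theorem usp_ext {x y : usp n F} (h : ∀ α, rootCoord F α x = rootCoord F α y) : x = y := by
  apply Subtype.ext
  ext i j
  rcases le_or_gt j i with hji | hij
  · rw [x.2.1 i j hji, y.2.1 i j hji]
  · rcases le_or_gt j i.rev with h1 | h1
    · exact h ⟨(i, j), hij, h1⟩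
    · rw [usp_apply x, usp_apply y]
      have h2 : (x : Matrix (Fin (2 * n)) (Fin (2 * n)) F) j.rev i.rev =
          (y : Matrix _ _ F) j.rev i.rev :=
        h ⟨(j.rev, i.rev), Fin.rev_lt_rev.2 hij, by rw [Fin.rev_rev]; exact h1.le⟩
      rw [h2]

/-- The root vector as an element of `𝔲𝔰𝔭`. -/
noncomputable def uspRootVector (F : Type*) [Field F] (α : PosRoot n) : usp n F :=
  ⟨α.rootVector F, α.rootVector_mem_usp⟩

open Classical in
theorem rootCoord_uspRootVector (α β : PosRoot n) :
    rootCoord F α (uspRootVector F β) = if α = β then 1 else 0 := by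
  change β.rootVector F α.row α.col = _
  rw [PosRoot.rootVector_apply]
  by_cases h : α = β
  · subst h
    simp
  · rw [if_neg h, if_neg fun h1 => h (PosRoot.ext h1.1 h1.2), if_neg]
    rintro ⟨h1, h2⟩
    have h3 := α.col_le_rev_row
    rw [h1, h2, Fin.rev_rev] at h3
    have h4 := le_antisymm h3 β.col_le_rev_row
    exact h (PosRoot.ext (by rw [h1, ← h4, Fin.rev_rev]) (by rw [h2, h4]))

theorem usp_eq_sum (x : usp n F) : x = ∑ α, rootCoord F α x • uspRootVector F α := by
  classical
  refine usp_ext fun β => ?_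
  rw [map_sum]
  simp [rootCoord_uspRootVector]

/-- The basic element `e_{D,φ}` as an element of `𝔲𝔰𝔭`. -/
noncomputable def uspBasicElement (D : Finset (PosRoot n)) (φ : PosRoot n → Fˣ) : usp n F :=
  ∑ α ∈ D, (φ α : F) • uspRootVector F α

theorem uspBasicElement_coe (D : Finset (PosRoot n)) (φ : PosRoot n → Fˣ) :
    (uspBasicElement D φ : Matrix (Fin (2 * n)) (Fin (2 * n)) F) = basicElement D φ := by
  rw [uspBasicElement, basicElement, Submodule.coe_sum]
  rfl

/-- The linear functional `x ↦ ∑ φ(α) x_α` attached to `(D, φ)`. -/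
noncomputable def basicFunctional (D : Finset (PosRoot n)) (φ : PosRoot n → Fˣ) :
    Module.Dual F (usp n F) :=
  ∑ α ∈ D, (φ α : F) • rootCoord F α

theorem basicFunctional_apply (D : Finset (PosRoot n)) (φ : PosRoot n → Fˣ) (x : usp n F) :
    basicFunctional D φ x = ∑ α ∈ D, (φ α : F) * rootCoord F α x := by
  simp [basicFunctional]

theorem IsPartialMatching.isBasic {y : Matrix (Fin (2 * n)) (Fin (2 * n)) F}
    (hm : IsPartialMatching y) (hy : yᵀ = y) {D : Finset (PosRoot n)}
    (hD : ∀ α ∈ D, y α.row α.col.rev ≠ 0) : IsBasic D := by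
  have hsymm : ∀ a b, y a b = y b a := fun a b => congrFun (congrFun hy b) a
  have h1 : ∀ α ∈ D, ∀ p ∈ α.entries, y p.1 p.2.rev ≠ 0 := by
    rintro α hα p (rfl | rfl)
    · exact hD α hα
    · rw [hsymm]
      simpa using hD α hα
  rintro α hα β hβ p hp q hq (h | h)
  · have h2 := h1 β hβ q hq
    rw [← h] at h2
    exact Prod.ext h (Fin.rev_injective (hm _ _ _ (h1 α hα p hp) h2))
  · have h2 := h1 β hβ q hq
    have h3 := h1 α hα p hp
    rw [hsymm] at h2 h3
    rw [← h] at h2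
    exact Prod.ext (hm _ _ _ h3 h2) h

open Classical in
/-- The values of `c` as units, where they are nonzero. -/
noncomputable def unitValues {X : Type*} (c : X → F) (a : X) : Fˣ :=
  if h : c a = 0 then 1 else Units.mk0 (c a) h

theorem unitValues_coe {X : Type*} {c : X → F} {a : X} (h : c a ≠ 0) :
    (unitValues c a : F) = c a := by
  rw [unitValues, dif_neg h, Units.val_mk0]

theorem exists_uspAction_eq_basicElement (h2 : (2 : F) ≠ 0) (x : usp n F) :
    ∃ (g : UT (2 * n) F) (D : Finset (PosRoot n)) (φ : PosRoot n → Fˣ),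
      IsBasic D ∧ uspAction g x = uspBasicElement D φ := by
  classical
  obtain ⟨g, hg, hm⟩ := exists_unitriangular_congruence h2 (transpose_mul_symplecticOmega x)
  set z := uspAction (utOf g hg) x with hz
  rw [← mul_dagger_mul_symplecticOmega] at hm
  change IsPartialMatching ((z : Matrix (Fin (2 * n)) (Fin (2 * n)) F) * symplecticOmega n F) at hm
  refine ⟨utOf g hg, Finset.univ.filter fun α => rootCoord F α z ≠ 0,
    unitValues fun α => rootCoord F α z, ?_, ?_⟩
  · refine hm.isBasic (transpose_mul_symplecticOmega z) fun α hα => ?_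
    rw [mul_symplecticOmega_apply, Fin.rev_rev]
    exact mul_ne_zero (neg_ne_zero.2 (halfSign_ne_zero _)) (Finset.mem_filter.1 hα).2
  · rw [← hz]
    nth_rw 1 [usp_eq_sum z]
    rw [uspBasicElement, Finset.sum_filter]
    refine Finset.sum_congr rfl fun α _ => ?_
    split_ifs with h
    · rw [unitValues_coe (c := fun α => rootCoord F α z) h]
    · rw [not_not.1 h, zero_smul]

/-- A linear functional on `𝔲𝔰𝔭` is given by the trace pairing with a symmetric matrix. -/
theorem exists_symmetric_trace (h2 : (2 : F) ≠ 0) (l : Module.Dual F (usp n F)) :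
    ∃ L : Matrix (Fin (2 * n)) (Fin (2 * n)) F, Lᵀ = L ∧
      ∀ x : usp n F, l x = ((x : Matrix (Fin (2 * n)) (Fin (2 * n)) F) *
        symplecticOmega n F * L).trace := by
  obtain ⟨m, hm⟩ := LinearMap.exists_extend l
  let M : Matrix (Fin (2 * n)) (Fin (2 * n)) F :=
    Matrix.of fun j i => m (-(Matrix.single i j 1 * symplecticOmega n F))
  have h : ∀ x : usp n F, l x = ((x : Matrix (Fin (2 * n)) (Fin (2 * n)) F) *
      symplecticOmega n F * M).trace := by
    intro x
    have h1 : (x : Matrix (Fin (2 * n)) (Fin (2 * n)) F) =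
        -((x : Matrix _ _ F) * symplecticOmega n F * symplecticOmega n F) := by
      rw [Matrix.mul_assoc, symplecticOmega_mul_self, Matrix.mul_neg, Matrix.mul_one, neg_neg]
    set y := (x : Matrix (Fin (2 * n)) (Fin (2 * n)) F) * symplecticOmega n F
    have h3 : l x = m (x : Matrix _ _ F) := (LinearMap.congr_fun hm x).symm
    rw [h3, h1, Matrix.matrix_eq_sum_single y, Finset.sum_mul, ← Finset.sum_neg_distrib, map_sum,
      ← Matrix.matrix_eq_sum_single y, Matrix.trace]
    refine Finset.sum_congr rfl fun i _ => ?_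
    rw [Finset.sum_mul, ← Finset.sum_neg_distrib, map_sum, Matrix.diag_apply, Matrix.mul_apply]
    refine Finset.sum_congr rfl fun j _ => ?_
    rw [show Matrix.single i j (y i j) = y i j • Matrix.single i j 1 by simp, Matrix.smul_mul,
      ← smul_neg, map_smul, smul_eq_mul]
    rfl
  refine ⟨(2 : F)⁻¹ • (M + Mᵀ), by rw [Matrix.transpose_smul, Matrix.transpose_add,
    Matrix.transpose_transpose, add_comm], fun x => ?_⟩
  have h3 : ((x : Matrix (Fin (2 * n)) (Fin (2 * n)) F) * symplecticOmega n F * Mᵀ).trace =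
      l x := by
    rw [← Matrix.trace_transpose, Matrix.transpose_mul, Matrix.transpose_transpose,
      transpose_mul_symplecticOmega, Matrix.trace_mul_comm, h]
  rw [Matrix.mul_smul, Matrix.trace_smul, Matrix.mul_add, Matrix.trace_add, h3, ← h, ← two_mul,
    smul_eq_mul, inv_mul_cancel_left₀ h2]

theorem exists_comp_uspAction_eq_basicFunctional (h2 : (2 : F) ≠ 0)
    (l : Module.Dual F (usp n F)) :
    ∃ (g : UT (2 * n) F) (D : Finset (PosRoot n)) (φ : PosRoot n → Fˣ),
      IsBasic D ∧ l ∘ₗ uspAction g = basicFunctional D φ := by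
  classical
  obtain ⟨L, hL, hl⟩ := exists_symmetric_trace h2 l
  -- Functionals transform by transposed matrices, so the order of the indices is reversed.
  obtain ⟨k, hk, hm⟩ := exists_unitriangular_congruence (ι := (Fin (2 * n))ᵒᵈ) h2 hL
  let g : Matrix (Fin (2 * n)) (Fin (2 * n)) F := fun i j => k j i
  have hg : IsUnitriangular g := ⟨fun i j hij => hk.1 j i hij, fun i => hk.2 i⟩
  let L' : Matrix (Fin (2 * n)) (Fin (2 * n)) F := gᵀ * L * g
  have hL' : L'ᵀ = L' := by
    simp only [L', Matrix.transpose_mul, Matrix.transpose_transpose, hL, Matrix.mul_assoc]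
  have hm' : IsPartialMatching L' := hm
  have hl' : ∀ x : usp n F, (l ∘ₗ uspAction (utOf g hg)) x =
      ((x : Matrix (Fin (2 * n)) (Fin (2 * n)) F) * symplecticOmega n F * L').trace := by
    intro x
    rw [LinearMap.comp_apply, hl, uspAction_coe, utMat_utOf, mul_dagger_mul_symplecticOmega,
      Matrix.mul_assoc, Matrix.mul_assoc, Matrix.trace_mul_comm]
    simp only [L', Matrix.mul_assoc]
  set l' := l ∘ₗ uspAction (utOf g hg)
  refine ⟨utOf g hg, Finset.univ.filter fun α => l' (uspRootVector F α) ≠ 0,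
    unitValues fun α => l' (uspRootVector F α), ?_, ?_⟩
  · refine hm'.isBasic hL' fun α hα h0 => (Finset.mem_filter.1 hα).2 ?_
    have h0' : L' α.col.rev α.row = 0 := by
      rw [← h0]
      exact congrFun (congrFun hL' α.row) α.col.rev
    rw [hl', Matrix.trace]
    refine Finset.sum_eq_zero fun i _ => ?_
    rw [Matrix.diag_apply, Matrix.mul_apply]
    refine Finset.sum_eq_zero fun j _ => ?_
    rw [mul_symplecticOmega_apply]
    change -halfSign F j * α.rootVector F i j.rev * L' j i = 0
    rw [PosRoot.rootVector_apply]
    split_ifs with h3 h4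
    · rw [h3.1, ← Fin.rev_rev j, h3.2, h0', mul_zero]
    · rw [h4.1, Fin.rev_injective h4.2, h0, mul_zero]
    · rw [mul_zero, zero_mul]
  · refine LinearMap.ext fun x => ?_
    rw [basicFunctional_apply, Finset.sum_filter]
    nth_rw 1 [usp_eq_sum x]
    rw [map_sum]
    refine Finset.sum_congr rfl fun α _ => ?_
    rw [map_smul, smul_eq_mul]
    split_ifs with h
    · rw [unitValues_coe (c := fun α => l' (uspRootVector F α)) h, mul_comm]
    · rw [not_not.1 h, mul_zero]

/-- The superclasses of the action are the superclasses of the pairs `(D, φ)`. -/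
theorem range_actionSuperclass_eq_andreNeto [Finite F] (h2 : (2 : F) ≠ 0)
    (f : SpringerMorphism n F) :
    Set.range (actionSuperclass f) = {K : Set (USp n F) | ∃ (D : Finset (PosRoot n))
      (φ : PosRoot n → Fˣ), IsBasic D ∧ K = andreNetoSuperclass D φ} := by
  have key : ∀ (u : USp n F) (D : Finset (PosRoot n)) (φ : PosRoot n → Fˣ) (g : UT (2 * n) F),
      uspAction g (f.onUSp u) = uspBasicElement D φ →
      actionSuperclass f u = andreNetoSuperclass D φ := by
    intro u D φ g hg
    obtain ⟨h, -, hu, -⟩ := f.exists_eq_mul u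
    have hg' := congrArg (fun x : usp n F => (x : Matrix (Fin (2 * n)) (Fin (2 * n)) F)) hg
    change utMat g * (f.toFun u : Matrix (Fin (2 * n)) (Fin (2 * n)) F) * utMat (daggerUT g) = _
      at hg'
    rw [hu, uspBasicElement_coe] at hg'
    ext v
    rw [mem_actionSuperclass_iff h2]
    constructor
    · rintro ⟨a, b, hab⟩
      refine ⟨a * g⁻¹, (h * daggerUT g)⁻¹ * b, ?_⟩
      rw [hab, ← hg']
      calc utMat a * (utMat (u : UT (2 * n) F) - 1) * utMat b
          = utMat a * (utMat g⁻¹ * utMat g) * (utMat (u : UT (2 * n) F) - 1) *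
              (utMat (h * daggerUT g) * utMat (h * daggerUT g)⁻¹) * utMat b := by
            rw [utMat_inv_mul, utMat_mul_inv, Matrix.mul_one, Matrix.mul_one]
        _ = _ := by simp only [utMat_mul, Matrix.mul_assoc]
    · rintro ⟨a, b, hab⟩
      refine ⟨a * g, h * daggerUT g * b, ?_⟩
      rw [hab, ← hg']
      simp only [utMat_mul, Matrix.mul_assoc]
  ext K
  constructor
  · rintro ⟨u, rfl⟩
    obtain ⟨g, D, φ, hD, hg⟩ := exists_uspAction_eq_basicElement h2 (f.onUSp u)
    exact ⟨D, φ, hD, key u D φ g hg⟩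
  · rintro ⟨D, φ, hD, rfl⟩
    obtain ⟨u, hu⟩ := f.uspEquiv.surjective (uspBasicElement D φ)
    exact ⟨u, key u D φ 1 (by rw [uspAction_one]; exact hu)⟩

end Roots

/-! ### Averages over independent rows -/

section Independence

/-- If `f₁` only sees the first and `f₂` only the second argument of an exchange `mix`, then they
are independent as random variables. -/
theorem sum_mul_sum_eq_of_mix {X : Type*} [Fintype X] (mix : X → X → X)
    (hmix : ∀ g g', mix (mix g g') (mix g' g) = g) (f₁ f₂ : X → ℂ)
    (h₁ : ∀ g g', f₁ (mix g g') = f₁ g) (h₂ : ∀ g g', f₂ (mix g g') = f₂ g') :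
    (∑ g, f₁ g) * ∑ g, f₂ g = Nat.card X * ∑ g, f₁ g * f₂ g := by
  let e : X × X ≃ X × X :=
    { toFun := fun p => (mix p.1 p.2, mix p.2 p.1)
      invFun := fun p => (mix p.1 p.2, mix p.2 p.1)
      left_inv := fun p => Prod.ext (hmix _ _) (hmix _ _)
      right_inv := fun p => Prod.ext (hmix _ _) (hmix _ _) }
  rw [Finset.sum_mul_sum, ← Fintype.sum_prod_type' (fun g g' => f₁ g * f₂ g')]
  calc ∑ p : X × X, f₁ p.1 * f₂ p.2 = ∑ p : X × X, f₁ p.1 * f₂ p.1 :=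
        Fintype.sum_equiv e _ _ fun p => by rw [← h₁ p.1 p.2, ← h₂ p.1 p.2]; rfl
    _ = _ := by
        rw [Fintype.sum_prod_type]
        simp only [Finset.sum_const, Finset.card_univ, nsmul_eq_mul, Finset.mul_sum,
          Nat.card_eq_fintype_card]

/-- Functions that depend on disjoint sets of rows are independent, for a set `X` of matrices that
is closed under exchanging rows. -/
theorem average_prod_eq_prod_average {ι κ : Type*} {E : Type*} {X : Type*} [Fintype X] [Nonempty X]
    (row : X → ι → E) (hrow : Function.Injective row)
    (hX : ∀ (R : Set ι) (g g' : X), ∃ k, (∀ i ∈ R, row k i = row g i) ∧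
      ∀ i, i ∉ R → row k i = row g' i)
    (D : Finset κ) (R : κ → Set ι) (hR : ∀ α ∈ D, ∀ β ∈ D, α ≠ β → Disjoint (R α) (R β))
    (f : κ → X → ℂ) (hf : ∀ α, ∀ g g', (∀ i ∈ R α, row g i = row g' i) → f α g = f α g') :
    (Nat.card X : ℂ)⁻¹ * ∑ g, ∏ α ∈ D, f α g = ∏ α ∈ D, ((Nat.card X : ℂ)⁻¹ * ∑ g, f α g) := by
  classical
  have hcard : (Nat.card X : ℂ) ≠ 0 := Nat.cast_ne_zero.2 Nat.card_pos.ne'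
  induction D using Finset.induction_on with
  | empty => simp
  | insert a D ha ih =>
    rw [Finset.prod_insert ha, ← ih fun α hα β hβ => hR α (Finset.mem_insert_of_mem hα) β
      (Finset.mem_insert_of_mem hβ)]
    choose mix hmix1 hmix2 using hX (R a)
    have h := sum_mul_sum_eq_of_mix mix (fun g g' => hrow (funext fun i => by
        by_cases hi : i ∈ R a
        · rw [hmix1 _ _ i hi, hmix1 _ _ i hi]
        · rw [hmix2 _ _ i hi, hmix2 _ _ i hi])) (f a) (fun g => ∏ α ∈ D, f α g)
      (fun g g' => hf a _ _ fun i hi => hmix1 _ _ i hi)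
      (fun g g' => Finset.prod_congr rfl fun α hα => hf α _ _ fun i hi => hmix2 _ _ i
        (Set.disjoint_left.1 (hR α (Finset.mem_insert_of_mem hα) a (Finset.mem_insert_self a D)
          (fun h => ha (h ▸ hα))) hi))
    simp only [Finset.prod_insert ha]
    rw [mul_mul_mul_comm, h]
    field_simp

theorem exists_mixed_rows {m : ℕ} {F : Type*} [Field F] (R : Set (Fin m)) (g g' : UT m F) :
    ∃ k : UT m F, (∀ i ∈ R, utMat k i = utMat g i) ∧ ∀ i, i ∉ R → utMat k i = utMat g' i := by
  classical
  refine ⟨utOf (Matrix.of fun i => if i ∈ R then utMat g i else utMat g' i) ⟨fun i j hij => ?_,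
    fun i => ?_⟩, fun i hi => if_pos hi, fun i hi => if_neg hi⟩
  · rw [Matrix.of_apply]
    split_ifs
    · exact utMat_lower g hij
    · exact utMat_lower g' hij
  · rw [Matrix.of_apply]
    split_ifs
    · exact utMat_diag g i
    · exact utMat_diag g' i

end Independence

/-! ### The subgroup `H` -/

section HalfGroup

variable {n : ℕ} {F : Type*} [Field F]

variable (n F) in
/-- The diagonal idempotent onto the first half of the coordinates. -/
def firstHalf : Matrix (Fin (2 * n)) (Fin (2 * n)) F :=
  Matrix.diagonal fun i => if (i : ℕ) < n then 1 else 0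

theorem mul_firstHalf_apply (x : Matrix (Fin (2 * n)) (Fin (2 * n)) F) (i j : Fin (2 * n)) :
    (x * firstHalf n F) i j = if (j : ℕ) < n then x i j else 0 := by
  rw [firstHalf, Matrix.mul_diagonal]
  split_ifs <;> simp

theorem mem_halfGroup_iff (h : UT (2 * n) F) :
    h ∈ halfGroup n F ↔ utMat h * firstHalf n F = firstHalf n F := by
  constructor
  · intro hh
    ext i j
    rw [mul_firstHalf_apply, firstHalf, Matrix.diagonal_apply]
    by_cases hij : i = j
    · subst hij
      rw [utMat_diag, if_pos rfl]
    · rw [if_neg hij]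
      split_ifs with hj
      · exact hh i j hij hj
      · rfl
  · intro hh i j hij hj
    have h1 := congrFun (congrFun hh i) j
    rwa [mul_firstHalf_apply, if_pos hj, firstHalf, Matrix.diagonal_apply_ne _ hij] at h1

variable (n F) in
/-- The set `halfGroup n F` as a subgroup. -/
def halfSubgroup : Subgroup (UT (2 * n) F) where
  carrier := halfGroup n F
  one_mem' := by rw [mem_halfGroup_iff, utMat_one, Matrix.one_mul]
  mul_mem' := fun {a b} ha hb => by
    rw [mem_halfGroup_iff] at ha hb ⊢
    rw [utMat_mul, Matrix.mul_assoc, hb, ha]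
  inv_mem' := fun {a} ha => by
    rw [mem_halfGroup_iff] at ha ⊢
    nth_rw 1 [← ha]
    rw [← Matrix.mul_assoc, utMat_inv_mul, Matrix.one_mul]

theorem sub_one_apply_of_halfSubgroup (h : halfSubgroup n F) {i j : Fin (2 * n)}
    (hj : (j : ℕ) < n) : (utMat (h : UT (2 * n) F) - 1) i j = 0 := by
  rw [Matrix.sub_apply]
  by_cases hij : i = j
  · rw [hij, utMat_diag, Matrix.one_apply_eq, sub_self]
  · rw [h.2 i j hij hj, Matrix.one_apply_ne hij, sub_self]

theorem dagger_firstHalf : dagger (firstHalf n F) = 1 - firstHalf n F := by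
  ext i j
  have hi := i.2
  rw [dagger_apply, Matrix.sub_apply, firstHalf, Matrix.diagonal_apply, Matrix.diagonal_apply,
    Matrix.one_apply]
  by_cases hij : i = j
  · subst hij
    rw [halfSign_mul_self, if_pos rfl, if_pos rfl, if_pos rfl, Fin.val_rev]
    split_ifs <;> first | omega | simp
  · have : j.rev ≠ i.rev := fun h => hij (Fin.rev_injective h).symm
    rw [if_neg this, if_neg hij, if_neg hij, mul_zero, sub_zero]

theorem firstHalf_mul_self : firstHalf n F * firstHalf n F = firstHalf n F := by
  rw [firstHalf, Matrix.diagonal_mul_diagonal]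
  congr 1
  ext i
  split_ifs <;> simp

theorem firstHalf_mul_mul_firstHalf (g : UT (2 * n) F) :
    firstHalf n F * utMat g * firstHalf n F = utMat g * firstHalf n F := by
  ext i j
  rw [mul_firstHalf_apply, mul_firstHalf_apply, firstHalf, Matrix.diagonal_mul]
  by_cases hj : (j : ℕ) < n
  · rw [if_pos hj, if_pos hj]
    by_cases hi : (i : ℕ) < n
    · rw [if_pos hi, one_mul]
    · rw [utMat_lower g (Fin.lt_def.2 (lt_of_lt_of_le hj (not_lt.1 hi))), mul_zero]
  · rw [if_neg hj, if_neg hj]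

/-- `UT_{2n}(F)` is the product of `H` and `USp_{2n}(F)`: the factor in `USp_{2n}(F)` is block
diagonal, with the same first block as the given matrix. -/
theorem exists_halfSubgroup_mul_USp (g : UT (2 * n) F) :
    ∃ (h : halfSubgroup n F) (v : USp n F), g = (h : UT (2 * n) F) * (v : UT (2 * n) F) := by
  set P := firstHalf n F with hP
  set Q := 1 - P with hQ
  have hPP : P * P = P := firstHalf_mul_self
  have hQP : Q * P = 0 := by rw [hQ, Matrix.sub_mul, Matrix.one_mul, hPP, sub_self]
  have hPQ : P * Q = 0 := by rw [hQ, Matrix.mul_sub, Matrix.mul_one, hPP, sub_self]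
  have hdQ : dagger Q = P := by rw [hQ, ← dagger_firstHalf, dagger_dagger]
  have hup : ∀ g : UT (2 * n) F, P * utMat g * P = utMat g * P := firstHalf_mul_mul_firstHalf
  have hup' : ∀ g : UT (2 * n) F, Q * utMat g * P = 0 := fun g => by
    rw [hQ, Matrix.sub_mul, Matrix.sub_mul, Matrix.one_mul, hup, sub_self]
  have hup'' : ∀ g : UT (2 * n) F, Q * utMat g * Q = Q * utMat g := fun g => by
    nth_rw 2 [hQ]
    rw [Matrix.mul_sub, Matrix.mul_one, hup', sub_zero]
  set g' := daggerUT g⁻¹ with hg'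
  -- The factor in `USp_{2n}(F)` has the first block of `g` and the second block of `(g†)⁻¹`.
  have hM : IsUnitriangular (utMat g * P + Q * utMat g') := by
    have hQd : ∀ i j, Q i j = if i = j then (if (i : ℕ) < n then (0 : F) else 1) else 0 := by
      intro i j
      rw [hQ, hP, Matrix.sub_apply, Matrix.one_apply, firstHalf, Matrix.diagonal_apply]
      split_ifs <;> simp
    have hQm : ∀ (x : Matrix (Fin (2 * n)) (Fin (2 * n)) F) i j,
        (Q * x) i j = if (i : ℕ) < n then 0 else x i j := by
      intro x i j
      rw [Matrix.mul_apply, Finset.sum_eq_single i]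
      · rw [hQd, if_pos rfl]
        split_ifs <;> simp
      · intro k _ hk
        rw [hQd, if_neg hk.symm, zero_mul]
      · simp
    refine ⟨fun i j hij => ?_, fun i => ?_⟩
    · rw [Matrix.add_apply, mul_firstHalf_apply, hQm, utMat_lower g hij, utMat_lower g' hij,
        ite_self, ite_self, add_zero]
    · rw [Matrix.add_apply, mul_firstHalf_apply, hQm, utMat_diag, utMat_diag]
      split_ifs <;> simp
  let v := utOf _ hM
  have hdv : utMat (daggerUT v) = utMat g⁻¹ * P + Q * utMat (daggerUT g) := by
    change dagger (utMat g * P + Q * utMat g') = _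
    rw [dagger_add, dagger_mul, dagger_mul, hdQ, dagger_firstHalf, hg', utMat_daggerUT,
      dagger_dagger, utMat_daggerUT, add_comm]
  have hg'g : utMat g' * utMat (daggerUT g) = 1 := by
    rw [← utMat_mul, hg', ← daggerUT_mul, mul_inv_cancel, daggerUT_one, utMat_one]
  have hv : v ∈ USp n F := by
    rw [mem_USp_iff, eq_inv_iff_mul_eq_one, mul_eq_one_iff_eq_inv, eq_comm, ← mul_eq_one_iff_inv_eq]
    apply utMat_injective
    rw [utMat_mul, hdv, utMat_one]
    change (utMat g * P + Q * utMat g') * _ = 1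
    have e1 : utMat g * P * (utMat g⁻¹ * P) = P := by
      rw [Matrix.mul_assoc, ← Matrix.mul_assoc P, hup, ← Matrix.mul_assoc, utMat_mul_inv,
        Matrix.one_mul]
    have e2 : utMat g * P * (Q * utMat (daggerUT g)) = 0 := by
      rw [Matrix.mul_assoc, ← Matrix.mul_assoc P, hPQ, Matrix.zero_mul, Matrix.mul_zero]
    have e3 : Q * utMat g' * (utMat g⁻¹ * P) = 0 := by
      rw [← Matrix.mul_assoc, Matrix.mul_assoc Q, ← utMat_mul, hup']
    have e4 : Q * utMat g' * (Q * utMat (daggerUT g)) = Q := by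
      rw [← Matrix.mul_assoc, hup'', Matrix.mul_assoc, hg'g, Matrix.mul_one]
    rw [Matrix.add_mul, Matrix.mul_add, Matrix.mul_add, e1, e2, e3, e4, hQ]
    abel
  refine ⟨⟨g * v⁻¹, ?_⟩, ⟨v, hv⟩, by simp⟩
  change g * v⁻¹ ∈ halfGroup n F
  rw [mem_halfGroup_iff, ← (mem_USp_iff v).1 hv, utMat_mul, hdv, Matrix.mul_add, Matrix.add_mul,
    ← Matrix.mul_assoc, utMat_mul_inv, Matrix.one_mul, ← hP, hPP, Matrix.mul_assoc, hup',
    Matrix.mul_zero, add_zero]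

end HalfGroup

/-! ### Averages over `H` of the characters attached to a root -/

section HalfAverage

variable {n : ℕ} {F : Type*} [Field F]

/-- The subspace of `𝔲𝔰𝔭` corresponding to the subgroup `U_α`. -/
def elementarySubspace (F : Type*) [Field F] (α : PosRoot n) : Submodule F (usp n F) where
  carrier := {x | ∀ k : Fin (2 * n), (k : ℕ) < n →
    (k < α.col → (x : Matrix (Fin (2 * n)) (Fin (2 * n)) F) α.row k = 0) ∧
      (x : Matrix (Fin (2 * n)) (Fin (2 * n)) F) α.col.rev k = 0}
  zero_mem' := fun _ _ => ⟨fun _ => rfl, rfl⟩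
  add_mem' := fun {x y} hx hy k hk => ⟨fun h => by
    rw [Submodule.coe_add, Matrix.add_apply, (hx k hk).1 h, (hy k hk).1 h, add_zero], by
    rw [Submodule.coe_add, Matrix.add_apply, (hx k hk).2, (hy k hk).2, add_zero]⟩
  smul_mem' := fun c x hx k hk => ⟨fun h => by
    rw [Submodule.coe_smul, Matrix.smul_apply, (hx k hk).1 h, smul_zero], by
    rw [Submodule.coe_smul, Matrix.smul_apply, (hx k hk).2, smul_zero]⟩

/-- The elements of `H` differ from the identity only in the last `n` columns, so that the quadratic
term of `h x h†` in `h - 1` vanishes. -/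
theorem rootCoord_uspAction_halfSubgroup (h : halfSubgroup n F) (x : usp n F) (α : PosRoot n) :
    rootCoord F α (uspAction (h : UT (2 * n) F) x) = rootCoord F α x +
      ∑ k, (utMat (h : UT (2 * n) F) - 1) α.row k *
        (x : Matrix (Fin (2 * n)) (Fin (2 * n)) F) k α.col +
      ∑ k, (x : Matrix (Fin (2 * n)) (Fin (2 * n)) F) α.row k *
        (halfSign F k * halfSign F α.col * (utMat (h : UT (2 * n) F) - 1) α.col.rev k.rev) := by
  set d := utMat (h : UT (2 * n) F) - 1 with hd
  have hdz : ∀ i j : Fin (2 * n), (j : ℕ) < n → d i j = 0 := fun i j =>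
    sub_one_apply_of_halfSubgroup h
  have h1 : utMat (h : UT (2 * n) F) = 1 + d := by rw [hd, add_sub_cancel]
  have h2 : d * (x : Matrix (Fin (2 * n)) (Fin (2 * n)) F) * dagger d = 0 := by
    ext i j
    rw [Matrix.mul_apply]
    refine Finset.sum_eq_zero fun l _ => ?_
    rw [dagger_apply]
    by_cases hl : (l.rev : ℕ) < n
    · rw [hdz _ _ hl, mul_zero, mul_zero]
    · rw [Matrix.mul_apply, Finset.sum_eq_zero, zero_mul]
      intro k _
      by_cases hk : (k : ℕ) < n
      · rw [hdz _ _ hk, zero_mul]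
      · rw [x.2.1 k l, mul_zero]
        rw [Fin.val_rev] at hl
        rw [Fin.le_def]
        omega
  rw [rootCoord_apply, uspAction_coe, h1, dagger_add, dagger_one, Matrix.add_mul, Matrix.mul_add,
    Matrix.mul_one, Matrix.one_mul, Matrix.add_mul, h2, add_zero, Matrix.add_apply,
    Matrix.add_apply, Matrix.mul_apply, Matrix.mul_apply, rootCoord_apply]
  simp only [dagger_apply]

theorem rootCoord_uspAction_of_mem {α : PosRoot n} {x : usp n F} (hx : x ∈ elementarySubspace F α)
    (h : halfSubgroup n F) :
    rootCoord F α (uspAction (h : UT (2 * n) F) x) = rootCoord F α x := by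
  have hdz := fun (i j : Fin (2 * n)) => sub_one_apply_of_halfSubgroup h (i := i) (j := j)
  rw [rootCoord_uspAction_halfSubgroup, Finset.sum_eq_zero, Finset.sum_eq_zero, add_zero, add_zero]
  · intro k _
    by_cases hk : (k : ℕ) < n
    · by_cases hkc : k < α.col
      · rw [(hx k hk).1 hkc, zero_mul]
      · rw [utMat_sub_one_mem_ut _ _ _ (Fin.rev_le_rev.2 (not_lt.1 hkc)), mul_zero, mul_zero]
    · rw [hdz _ k.rev (by rw [Fin.val_rev]; omega), mul_zero, mul_zero]
  · intro k _
    by_cases hk : (k : ℕ) < n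
    · rw [hdz _ _ hk, zero_mul]
    · rw [usp_apply, (hx k.rev (by rw [Fin.val_rev]; omega)).2, mul_zero, neg_zero, mul_zero]

/-- Adding a number to an entry in the last `n` columns is a permutation of `H`. -/
theorem exists_equiv_add_single (a b : Fin (2 * n)) (hab : a < b) (hb : n ≤ (b : ℕ)) (t : F) :
    ∃ e : halfSubgroup n F ≃ halfSubgroup n F, ∀ h : halfSubgroup n F,
      utMat (e h : UT (2 * n) F) = utMat (h : UT (2 * n) F) + Matrix.single a b t := by
  have hz : ∀ (i j : Fin (2 * n)) (s : F), ¬(i = a ∧ j = b) → Matrix.single a b s i j = 0 :=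
    fun i j s h => by
      rw [Matrix.single_apply, if_neg fun h' => h ⟨h'.1.symm, h'.2.symm⟩]
  have hU : ∀ (h : UT (2 * n) F) (s : F), IsUnitriangular (utMat h + Matrix.single a b s) := by
    refine fun h s => ⟨fun i j hij => ?_, fun i => ?_⟩
    · rw [Matrix.add_apply, utMat_lower h hij, hz, add_zero]
      rintro ⟨rfl, rfl⟩
      exact hab.not_gt hij
    · rw [Matrix.add_apply, utMat_diag, hz, add_zero]
      rintro ⟨rfl, rfl⟩
      exact hab.ne rfl
  have hH : ∀ (h : halfSubgroup n F) (s : F),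
      utOf _ (hU (h : UT (2 * n) F) s) ∈ halfSubgroup n F := by
    intro h s i j hij hj
    rw [utMat_utOf, Matrix.add_apply, h.2 i j hij hj, hz, add_zero]
    rintro ⟨rfl, rfl⟩
    omega
  refine ⟨⟨fun h => ⟨_, hH h t⟩, fun h => ⟨_, hH h (-t)⟩, fun h => ?_, fun h => ?_⟩, fun h => rfl⟩
  · refine Subtype.ext (utMat_injective ?_)
    rw [utMat_utOf, utMat_utOf, add_assoc, ← Matrix.single_add, add_neg_cancel, Matrix.single_zero,
      add_zero]
  · refine Subtype.ext (utMat_injective ?_)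
    rw [utMat_utOf, utMat_utOf, add_assoc, ← Matrix.single_add, neg_add_cancel, Matrix.single_zero,
      add_zero]

theorem rootCoord_uspAction_add_single {h h' : halfSubgroup n F} {a b : Fin (2 * n)} {t : F}
    (hh : utMat (h' : UT (2 * n) F) = utMat (h : UT (2 * n) F) + Matrix.single a b t)
    (x : usp n F) (α : PosRoot n) :
    rootCoord F α (uspAction (h' : UT (2 * n) F) x) =
      rootCoord F α (uspAction (h : UT (2 * n) F) x) +
      t * ((if a = α.row then (x : Matrix (Fin (2 * n)) (Fin (2 * n)) F) b α.col else 0) +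
        if a = α.col.rev then (x : Matrix (Fin (2 * n)) (Fin (2 * n)) F) α.row b.rev *
          (halfSign F b.rev * halfSign F α.col) else 0) := by
  have h1 : utMat (h' : UT (2 * n) F) - 1 =
      (utMat (h : UT (2 * n) F) - 1) + Matrix.single a b t := by
    rw [hh]
    abel
  rw [rootCoord_uspAction_halfSubgroup, rootCoord_uspAction_halfSubgroup, h1]
  have h2 : ∑ k, ((utMat (h : UT (2 * n) F) - 1) + Matrix.single a b t) α.row k *
        (x : Matrix (Fin (2 * n)) (Fin (2 * n)) F) k α.col =
      ∑ k, (utMat (h : UT (2 * n) F) - 1) α.row k *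
        (x : Matrix (Fin (2 * n)) (Fin (2 * n)) F) k α.col +
      t * (if a = α.row then (x : Matrix (Fin (2 * n)) (Fin (2 * n)) F) b α.col else 0) := by
    simp only [Matrix.add_apply, add_mul, Finset.sum_add_distrib]
    congr 1
    rw [Finset.sum_eq_single b]
    · rw [Matrix.single_apply]
      split_ifs with h3 h4 h4 <;> simp_all
    · intro k _ hk
      rw [Matrix.single_apply, if_neg fun h3 => hk h3.2.symm, zero_mul]
    · simp
  have h3 : ∑ k, (x : Matrix (Fin (2 * n)) (Fin (2 * n)) F) α.row k *
        (halfSign F k * halfSign F α.col *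
          ((utMat (h : UT (2 * n) F) - 1) + Matrix.single a b t) α.col.rev k.rev) =
      ∑ k, (x : Matrix (Fin (2 * n)) (Fin (2 * n)) F) α.row k *
        (halfSign F k * halfSign F α.col * (utMat (h : UT (2 * n) F) - 1) α.col.rev k.rev) +
      t * (if a = α.col.rev then (x : Matrix (Fin (2 * n)) (Fin (2 * n)) F) α.row b.rev *
          (halfSign F b.rev * halfSign F α.col) else 0) := by
    simp only [Matrix.add_apply, mul_add, Finset.sum_add_distrib]
    congr 1
    rw [Finset.sum_eq_single b.rev]
    · rw [Matrix.single_apply, Fin.rev_rev]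
      by_cases h4 : a = α.col.rev
      · rw [if_pos ⟨h4, rfl⟩, if_pos h4]
        ring
      · rw [if_neg fun h5 => h4 h5.1, if_neg h4, mul_zero, mul_zero, mul_zero]
    · intro k _ hk
      rw [Matrix.single_apply, if_neg fun h4 => hk (by rw [h4.2, Fin.rev_rev]), mul_zero, mul_zero]
    · simp
  rw [h2, h3]
  ring

/-- Off the subspace `𝔲_α` some entry of `h` can be varied so as to vary the coordinate of `h x h†`
at `α`. For the roots `2ε_i` the entry enters twice, whence the restriction on the
characteristic. -/
theorem exists_entry_of_notMem (h2 : (2 : F) ≠ 0) {α : PosRoot n} {x : usp n F}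
    (hx : x ∉ elementarySubspace F α) :
    ∃ a b : Fin (2 * n), a < b ∧ n ≤ (b : ℕ) ∧
      (if a = α.row then (x : Matrix (Fin (2 * n)) (Fin (2 * n)) F) b α.col else 0) +
        (if a = α.col.rev then (x : Matrix (Fin (2 * n)) (Fin (2 * n)) F) α.row b.rev *
          (halfSign F b.rev * halfSign F α.col) else 0) ≠ 0 := by
  have hsgn : ∀ i j : Fin (2 * n), halfSign F i * halfSign F j ≠ 0 := fun i j =>
    mul_ne_zero (halfSign_ne_zero i) (halfSign_ne_zero j)
  have hrow := α.row_val_lt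
  by_cases h1 : ∃ k : Fin (2 * n), (k : ℕ) < n ∧ k < α.col ∧
      (x : Matrix (Fin (2 * n)) (Fin (2 * n)) F) α.row k ≠ 0
  · obtain ⟨k, hk, hkc, hxk⟩ := h1
    refine ⟨α.col.rev, k.rev, Fin.rev_lt_rev.2 hkc, by rw [Fin.val_rev]; omega, ?_⟩
    rw [if_pos rfl, Fin.rev_rev]
    by_cases h3 : α.col.rev = α.row
    · rw [if_pos h3, usp_apply x k.rev, Fin.rev_rev, h3, halfSign_rev]
      have : -(-halfSign F k * halfSign F α.col *
            (x : Matrix (Fin (2 * n)) (Fin (2 * n)) F) α.row k) +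
          (x : Matrix (Fin (2 * n)) (Fin (2 * n)) F) α.row k *
            (halfSign F k * halfSign F α.col) =
          2 * ((x : Matrix (Fin (2 * n)) (Fin (2 * n)) F) α.row k *
            (halfSign F k * halfSign F α.col)) := by ring
      rw [this]
      exact mul_ne_zero h2 (mul_ne_zero hxk (hsgn _ _))
    · rw [if_neg h3, zero_add]
      exact mul_ne_zero hxk (hsgn _ _)
  · push Not at h1
    obtain ⟨k, hk, hxk⟩ : ∃ k : Fin (2 * n), (k : ℕ) < n ∧
        (x : Matrix (Fin (2 * n)) (Fin (2 * n)) F) α.col.rev k ≠ 0 := by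
      by_contra! h3
      exact hx fun k hk => ⟨fun hkc => h1 k hk hkc, h3 k hk⟩
    have hck : α.col.rev < k := by
      by_contra h3
      exact hxk (x.2.1 _ _ (not_lt.1 h3))
    have hne : α.row ≠ α.col.rev := by
      intro h3
      rw [← h3] at hxk
      refine hxk (h1 k hk ?_)
      rw [Fin.lt_def] at hck ⊢
      rw [Fin.val_rev] at hck
      omega
    refine ⟨α.row, k.rev, ?_, by rw [Fin.val_rev]; omega, ?_⟩
    · rw [Fin.lt_def, Fin.val_rev]
      omega
    · rw [if_pos rfl, if_neg hne, add_zero, usp_apply, Fin.rev_rev]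
      exact neg_ne_zero.2 (mul_ne_zero (hsgn _ _) hxk)

open Classical in
/-- The average over `H` of the character attached to `α` is that character on `𝔲_α`, extended by
zero. -/
theorem sum_halfSubgroup_addChar [Finite F] [Fintype (halfSubgroup n F)] (h2 : (2 : F) ≠ 0)
    {ψ : AddChar F ℂ} (hψ : ψ ≠ 1) (α : PosRoot n) (r : Fˣ) (x : usp n F) :
    (Nat.card (halfSubgroup n F) : ℂ)⁻¹ *
        ∑ h : halfSubgroup n F, ψ (r * rootCoord F α (uspAction (h : UT (2 * n) F) x)) =
      if x ∈ elementarySubspace F α then ψ (r * rootCoord F α x) else 0 := by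
  split_ifs with hx
  · rw [Finset.sum_congr rfl fun h _ => by rw [rootCoord_uspAction_of_mem hx h], Finset.sum_const,
      Finset.card_univ, nsmul_eq_mul, ← Nat.card_eq_fintype_card, inv_mul_cancel_left₀]
    exact Nat.cast_ne_zero.2 Nat.card_pos.ne'
  · obtain ⟨a, b, hab, hb, hc⟩ := exists_entry_of_notMem h2 hx
    set c := (if a = α.row then (x : Matrix (Fin (2 * n)) (Fin (2 * n)) F) b α.col else 0) +
        (if a = α.col.rev then (x : Matrix (Fin (2 * n)) (Fin (2 * n)) F) α.row b.rev *
          (halfSign F b.rev * halfSign F α.col) else 0)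
    obtain ⟨s, hs⟩ := AddChar.ne_one_iff.1 hψ
    obtain ⟨e, he⟩ := exists_equiv_add_single a b hab hb ((r : F)⁻¹ * s * c⁻¹)
    have h3 : ∀ h, ψ (r * rootCoord F α (uspAction (e h : UT (2 * n) F) x)) =
        ψ s * ψ (r * rootCoord F α (uspAction (h : UT (2 * n) F) x)) := by
      intro h
      rw [rootCoord_uspAction_add_single (he h), ← AddChar.map_add_eq_mul]
      congr 1
      change (r : F) * (_ + (r : F)⁻¹ * s * c⁻¹ * c) = _
      have := r.ne_zero
      field_simp
      ring
    have h4 := Equiv.sum_comp e fun h : halfSubgroup n F =>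
      ψ (r * rootCoord F α (uspAction (h : UT (2 * n) F) x))
    rw [Finset.sum_congr rfl fun h _ => h3 h, ← Finset.mul_sum] at h4
    rw [mul_eq_zero]
    right
    by_contra h5
    exact hs (mul_right_cancel₀ h5 (h4.trans (one_mul _).symm))

end HalfAverage

/-! ### The subgroups `U_α` -/

section ElementarySubgroup

variable {n : ℕ} {F : Type*} [Field F]

theorem mem_elementarySubgroup_iff (α : PosRoot n) (v : USp n F) :
    v ∈ elementarySubgroup F α ↔ ∀ k : Fin (2 * n), (k : ℕ) < n →
      (k < α.col → (utMat (v : UT (2 * n) F) - 1) α.row k = 0) ∧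
        (utMat (v : UT (2 * n) F) - 1) α.col.rev k = 0 := by
  have h1 : ∀ (i : Fin (2 * n)) (c : ℕ), (v : UT (2 * n) F) ∈ utRowSubgroup i c ↔
      ∀ k : Fin (2 * n), (k : ℕ) < c → (utMat (v : UT (2 * n) F) - 1) i k = 0 := by
    intro i c
    constructor
    · intro h k hk
      rcases lt_or_ge i k with hik | hik
      · rw [Matrix.sub_apply, h k hik hk, Matrix.one_apply_ne hik.ne, sub_self]
      · exact utMat_sub_one_mem_ut _ _ _ hik
    · intro h k hik hk
      have := h k hk
      rwa [Matrix.sub_apply, Matrix.one_apply_ne hik.ne, sub_zero] at this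
  rw [elementarySubgroup, Subgroup.mem_subgroupOf]
  split_ifs with hc
  · rw [h1]
    constructor
    · refine fun h k hk => ⟨fun hkc => h k hkc, utMat_sub_one_mem_ut _ _ _ ?_⟩
      rw [Fin.le_def, Fin.val_rev]
      omega
    · exact fun h k hk => (h k (hk.trans hc)).1 hk
  · rw [Subgroup.mem_inf, h1, h1]
    constructor
    · exact fun h k hk => ⟨fun _ => h.1 k hk, h.2 k hk⟩
    · refine fun h => ⟨fun k hk => (h k hk).1 ?_, fun k hk => (h k hk).2⟩
      rw [Fin.lt_def]
      omega

/-- The column of `α` vanishes in the second half of the rows, for the elements of `U_α`: this is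
the condition on the row `α.col.rev` of the inverse. -/
theorem elementarySubgroup_col_eq_zero {α : PosRoot n} {v : USp n F}
    (hv : v ∈ elementarySubgroup F α) {l : Fin (2 * n)} (hl : n ≤ (l : ℕ)) :
    (utMat (v : UT (2 * n) F) - 1) l α.col = 0 := by
  have h1 := (mem_elementarySubgroup_iff α _).1 ((elementarySubgroup F α).inv_mem hv) l.rev
    (by rw [Fin.val_rev]; omega)
  have h3 : utMat (v : UT (2 * n) F) = dagger (utMat ((v⁻¹ : USp n F) : UT (2 * n) F)) := by
    have h4 : utMat ((v⁻¹ : USp n F) : UT (2 * n) F)⁻¹ =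
      dagger (utMat ((v⁻¹ : USp n F) : UT (2 * n) F)) := (v⁻¹).2
    rw [← h4, Subgroup.coe_inv, inv_inv]
  have h5 : utMat (v : UT (2 * n) F) - 1 =
      dagger (utMat ((v⁻¹ : USp n F) : UT (2 * n) F) - 1) := by
    rw [h3, sub_eq_add_neg, sub_eq_add_neg, dagger_add, ← neg_one_smul F (1 : Matrix _ _ F),
      dagger_smul, dagger_one]
  rw [h5, dagger_apply, h1.2, mul_zero]

theorem elementarySubgroup_row_mul_eq_zero {α : PosRoot n} {v : USp n F}
    (hv : v ∈ elementarySubgroup F α) {z : Matrix (Fin (2 * n)) (Fin (2 * n)) F}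
    (hz : z ∈ ut (2 * n) F) (hz' : ∀ l : Fin (2 * n), n ≤ (l : ℕ) → z l α.col = 0) :
    ((utMat (v : UT (2 * n) F) - 1) * z) α.row α.col = 0 := by
  rw [Matrix.mul_apply]
  refine Finset.sum_eq_zero fun k _ => ?_
  rcases lt_or_ge (k : ℕ) n with hk | hk
  · rcases lt_or_ge k α.col with hkc | hkc
    · rw [((mem_elementarySubgroup_iff α v).1 hv k hk).1 hkc, zero_mul]
    · rw [hz _ _ hkc, mul_zero]
  · rw [hz' k hk, mul_zero]

/-- The position of `α` is an additive coordinate on `U_α`. -/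
theorem elementarySubgroup_apply_mul {α : PosRoot n} {u v : USp n F}
    (hu : u ∈ elementarySubgroup F α) (hv : v ∈ elementarySubgroup F α) :
    utMat ((u * v : USp n F) : UT (2 * n) F) α.row α.col =
      utMat (u : UT (2 * n) F) α.row α.col + utMat (v : UT (2 * n) F) α.row α.col := by
  have h1 : utMat ((u * v : USp n F) : UT (2 * n) F) =
      utMat (u : UT (2 * n) F) + utMat (v : UT (2 * n) F) - 1 +
        (utMat (u : UT (2 * n) F) - 1) * (utMat (v : UT (2 * n) F) - 1) := by
    rw [Subgroup.coe_mul, utMat_mul]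
    noncomm_ring
  rw [h1, Matrix.add_apply, elementarySubgroup_row_mul_eq_zero hu (utMat_sub_one_mem_ut _)
    fun l hl => elementarySubgroup_col_eq_zero hv hl, Matrix.sub_apply, Matrix.add_apply,
    Matrix.one_apply_ne α.row_lt_col.ne, add_zero, sub_zero]

theorem row_mul_eq_zero {x y : Matrix (Fin (2 * n)) (Fin (2 * n)) F} (hy : ∀ i j, j < i → y i j = 0)
    {i k : Fin (2 * n)} (h : ∀ l ≤ k, x i l = 0) : (x * y) i k = 0 := by
  rw [Matrix.mul_apply]
  refine Finset.sum_eq_zero fun l _ => ?_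
  rcases le_or_gt l k with hl | hl
  · rw [h l hl, zero_mul]
  · rw [hy _ _ hl, mul_zero]

theorem onUSp_mem_elementarySubspace_iff (f : SpringerMorphism n F) (α : PosRoot n) (v : USp n F) :
    f.onUSp v ∈ elementarySubspace F α ↔ v ∈ elementarySubgroup F α := by
  obtain ⟨h, -, hf, -⟩ := f.exists_eq_mul v
  have hf' : utMat (v : UT (2 * n) F) - 1 =
      (f.toFun v : Matrix (Fin (2 * n)) (Fin (2 * n)) F) * utMat h⁻¹ := by
    rw [hf, Matrix.mul_assoc, utMat_mul_inv, Matrix.mul_one]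
  rw [mem_elementarySubgroup_iff]
  constructor
  · intro hx k hk
    rw [hf']
    exact ⟨fun hkc => row_mul_eq_zero (fun i j => utMat_lower h⁻¹) fun l hl =>
      (hx l (lt_of_le_of_lt hl hk)).1 (lt_of_le_of_lt hl hkc), row_mul_eq_zero
      (fun i j => utMat_lower h⁻¹) fun l hl => (hx l (lt_of_le_of_lt hl hk)).2⟩
  · intro hx k hk
    change (k < α.col → (f.toFun v : Matrix (Fin (2 * n)) (Fin (2 * n)) F) α.row k = 0) ∧
      (f.toFun v : Matrix (Fin (2 * n)) (Fin (2 * n)) F) α.col.rev k = 0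
    rw [hf]
    exact ⟨fun hkc => row_mul_eq_zero (fun i j => utMat_lower h) fun l hl =>
      (hx l (lt_of_le_of_lt hl hk)).1 (lt_of_le_of_lt hl hkc), row_mul_eq_zero
      (fun i j => utMat_lower h) fun l hl => (hx l (lt_of_le_of_lt hl hk)).2⟩

/-- The higher terms of a Springer morphism do not contribute to the coordinate at `α` on `U_α`. -/
theorem rootCoord_onUSp (f : SpringerMorphism n F) {α : PosRoot n} {v : USp n F}
    (hv : v ∈ elementarySubgroup F α) :
    rootCoord F α (f.onUSp v) = utMat (v : UT (2 * n) F) α.row α.col := by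
  obtain ⟨h, a, hf, hh⟩ := f.exists_eq_mul v
  change (f.toFun v : Matrix (Fin (2 * n)) (Fin (2 * n)) F) α.row α.col = _
  rw [hf, hh, Matrix.mul_add, Matrix.mul_one, Matrix.add_apply, Matrix.sub_apply,
    Matrix.one_apply_ne α.row_lt_col.ne, sub_zero, Finset.mul_sum, Matrix.sum_apply,
    Finset.sum_eq_zero, add_zero]
  intro i hi
  have hi2 := (Finset.mem_Ico.1 hi).1
  rw [Matrix.mul_smul, Matrix.smul_apply, elementarySubgroup_row_mul_eq_zero hv, smul_zero]
  · exact pow_mem_ut (utMat_sub_one_mem_ut _) (by omega)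
  · intro l hl
    rw [show i - 1 = (i - 2) + 1 by omega, pow_succ, Matrix.mul_apply]
    refine Finset.sum_eq_zero fun k _ => ?_
    rcases lt_or_ge k l with hk | hk
    · have h1 : ((utMat (v : UT (2 * n) F) - 1) ^ (i - 2)) l k = 0 := by
        rcases Nat.eq_zero_or_pos (i - 2) with h0 | h0
        · rw [h0, pow_zero, Matrix.one_apply_ne hk.ne']
        · exact pow_mem_ut (utMat_sub_one_mem_ut _) h0.ne' _ _ hk.le
      rw [h1, zero_mul]
    · rw [elementarySubgroup_col_eq_zero hv (hl.trans hk), mul_zero]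

end ElementarySubgroup

/-! ### The elementary characters -/

section ElementaryCharacters

variable {n : ℕ} {F : Type*} [Field F]

theorem isComplexCharacter_elementaryCharacter [Finite F] (ψ : AddChar F ℂ) (α : PosRoot n)
    (r : Fˣ) : IsComplexCharacter (elementaryCharacter ψ α r) :=
  isComplexCharacter_inducedFunction (elementarySubgroup F α)
    { toFun := fun u => ψ (r * utMat ((u : USp n F) : UT (2 * n) F) α.row α.col)
      map_one' := by
        rw [OneMemClass.coe_one, OneMemClass.coe_one, utMat_one,
          Matrix.one_apply_ne α.row_lt_col.ne, mul_zero, AddChar.map_zero_eq_one]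
      map_mul' := fun u v => by
        rw [Subgroup.coe_mul, elementarySubgroup_apply_mul u.2 v.2, mul_add,
          AddChar.map_add_eq_mul] }

/-- The average over `UT_{2n}(F) = H · USp_{2n}(F)` of a left `H`-invariant function is its average
over `USp_{2n}(F)`. -/
theorem average_eq_average_USp [Finite F] [Fintype (UT (2 * n) F)] [Fintype (USp n F)]
    (Ψ : UT (2 * n) F → ℂ)
    (hΨ : ∀ (h : halfSubgroup n F) (g : UT (2 * n) F), Ψ ((h : UT (2 * n) F) * g) = Ψ g) :
    (Nat.card (UT (2 * n) F) : ℂ)⁻¹ * ∑ g, Ψ g =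
      (Nat.card (USp n F) : ℂ)⁻¹ * ∑ v : USp n F, Ψ (v : UT (2 * n) F) := by
  have h1 : ∀ g : UT (2 * n) F, ∑ v : USp n F, Ψ (g * (v : UT (2 * n) F)) =
      ∑ v : USp n F, Ψ (v : UT (2 * n) F) := by
    intro g
    obtain ⟨h, w, rfl⟩ := exists_halfSubgroup_mul_USp g
    simp only [mul_assoc, hΨ]
    exact Equiv.sum_comp (Equiv.mulLeft w) fun v : USp n F => Ψ (v : UT (2 * n) F)
  have h2 : ∑ g, ∑ v : USp n F, Ψ (g * (v : UT (2 * n) F)) = Nat.card (USp n F) * ∑ g, Ψ g := by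
    have h : ∀ v : USp n F, ∑ g, Ψ (g * (v : UT (2 * n) F)) = ∑ g, Ψ g := fun v =>
      Equiv.sum_comp (Equiv.mulRight (v : UT (2 * n) F)) Ψ
    rw [Finset.sum_comm, Finset.sum_congr rfl fun v _ => h v, Finset.sum_const, nsmul_eq_mul,
      Finset.card_univ, Nat.card_eq_fintype_card]
  rw [Finset.sum_congr rfl fun g _ => h1 g, Finset.sum_const, nsmul_eq_mul, Finset.card_univ,
    ← Nat.card_eq_fintype_card] at h2
  have hG : (Nat.card (UT (2 * n) F) : ℂ) ≠ 0 := Nat.cast_ne_zero.2 Nat.card_pos.ne'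
  have hU : (Nat.card (USp n F) : ℂ) ≠ 0 := Nat.cast_ne_zero.2 Nat.card_pos.ne'
  rw [inv_mul_eq_iff_eq_mul₀ hG, mul_left_comm, eq_inv_mul_iff_mul_eq₀ hU, ← h2]

/-- The elementary character is a multiple of the average of a linear character of `𝔲𝔰𝔭` over the
whole action of `UT_{2n}(F)`. -/
theorem elementaryCharacter_eq_average [Finite F] [Fintype (UT (2 * n) F)] (h2 : (2 : F) ≠ 0)
    (f : SpringerMorphism n F) {ψ : AddChar F ℂ} (hψ : ψ ≠ 1) (α : PosRoot n) (r : Fˣ)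
    (u : USp n F) :
    elementaryCharacter ψ α r u =
      (Nat.card (USp n F) : ℂ) / Nat.card (elementarySubgroup F α) *
        ((Nat.card (UT (2 * n) F) : ℂ)⁻¹ *
          ∑ g : UT (2 * n) F, ψ (r * rootCoord F α (uspAction g (f.onUSp u)))) := by
  classical
  have := Fintype.ofFinite (USp n F)
  have := Fintype.ofFinite (halfSubgroup n F)
  have hU : (Nat.card (USp n F) : ℂ) ≠ 0 := Nat.cast_ne_zero.2 Nat.card_pos.ne'
  have hH : (Nat.card (halfSubgroup n F) : ℂ) ≠ 0 := Nat.cast_ne_zero.2 Nat.card_pos.ne'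
  set Φ : UT (2 * n) F → ℂ := fun g => ψ (r * rootCoord F α (uspAction g (f.onUSp u))) with hΦ
  let Ψ : UT (2 * n) F → ℂ := fun g =>
    (Nat.card (halfSubgroup n F) : ℂ)⁻¹ * ∑ h : halfSubgroup n F, Φ ((h : UT (2 * n) F) * g)
  have hΨ : ∀ (h : halfSubgroup n F) (g : UT (2 * n) F), Ψ ((h : UT (2 * n) F) * g) = Ψ g := by
    intro h g
    simp only [Ψ, ← mul_assoc]
    congr 1
    exact Equiv.sum_comp (Equiv.mulRight h) fun k : halfSubgroup n F => Φ ((k : UT (2 * n) F) * g)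
  have hsum : ∑ g, Ψ g = ∑ g, Φ g := by
    have h1 : ∀ h : halfSubgroup n F, ∑ g, Φ ((h : UT (2 * n) F) * g) = ∑ g, Φ g := fun h =>
      Equiv.sum_comp (Equiv.mulLeft (h : UT (2 * n) F)) Φ
    simp only [Ψ]
    rw [← Finset.mul_sum, Finset.sum_comm, Finset.sum_congr rfl fun h _ => h1 h,
      Finset.sum_const, nsmul_eq_mul, Finset.card_univ, ← Nat.card_eq_fintype_card,
      inv_mul_cancel_left₀ hH]
  have hterm : ∀ v : USp n F, (if h : v * u * v⁻¹ ∈ elementarySubgroup F α then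
      (fun w : elementarySubgroup F α =>
        ψ (r * utMat ((w : USp n F) : UT (2 * n) F) α.row α.col)) ⟨v * u * v⁻¹, h⟩ else 0) =
      Ψ (v : UT (2 * n) F) := by
    intro v
    have h1 := sum_halfSubgroup_addChar h2 hψ α r (f.onUSp (v * u * v⁻¹))
    simp only [f.onUSp_conj, ← uspAction_mul] at h1
    simp only [Ψ, hΦ]
    rw [h1]
    by_cases h : v * u * v⁻¹ ∈ elementarySubgroup F α
    · rw [dif_pos h, if_pos, ← rootCoord_onUSp f h, f.onUSp_conj]
      rw [← f.onUSp_conj]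
      exact (onUSp_mem_elementarySubspace_iff f α _).2 h
    · rw [dif_neg h, if_neg]
      rw [← f.onUSp_conj]
      exact fun h' => h ((onUSp_mem_elementarySubspace_iff f α _).1 h')
  rw [← hsum, average_eq_average_USp Ψ hΨ, elementaryCharacter, inducedFunction,
    finsum_eq_sum_of_fintype, div_eq_inv_mul, mul_assoc, mul_inv_cancel_left₀ hU]
  congr 1
  exact Finset.sum_congr rfl fun v _ => hterm v

theorem rootCoord_uspAction_congr {α : PosRoot n} {g g' : UT (2 * n) F}
    (h : ∀ i ∈ ({α.row, α.col.rev} : Set (Fin (2 * n))), utMat g i = utMat g' i) (x : usp n F) :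
    rootCoord F α (uspAction g x) = rootCoord F α (uspAction g' x) := by
  rw [rootCoord_apply, rootCoord_apply, uspAction_coe, uspAction_coe]
  simp only [Matrix.mul_apply, dagger_apply, h _ (Set.mem_insert _ _),
    h _ (Set.mem_insert_of_mem _ rfl)]

/-- The roots of a basic set involve disjoint sets of rows. -/
theorem IsBasic.disjoint_rows {D : Finset (PosRoot n)} (hD : IsBasic D) {α β : PosRoot n}
    (hα : α ∈ D) (hβ : β ∈ D) (hne : α ≠ β) :
    Disjoint ({α.row, α.col.rev} : Set (Fin (2 * n))) {β.row, β.col.rev} := by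
  rw [Set.disjoint_left]
  intro i hi hi'
  have h1 : ∀ γ : PosRoot n, i ∈ ({γ.row, γ.col.rev} : Set (Fin (2 * n))) →
      ∃ p ∈ γ.entries, p.1 = i := by
    rintro γ (h | h)
    · exact ⟨_, Or.inl rfl, h.symm⟩
    · exact ⟨_, Or.inr rfl, h.symm⟩
  obtain ⟨p, hp, hpi⟩ := h1 α hi
  obtain ⟨q, hq, hqi⟩ := h1 β hi'
  have hpq := hD α hα β hβ p hp q hq (Or.inl (hpi.trans hqi.symm))
  subst hpq
  -- A position and its mirror image determine the same root.
  have h2 : ∀ γ : PosRoot n, p ∈ γ.entries → p.2 ≤ p.1.rev → p = (γ.row, γ.col) := by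
    rintro γ (h | h) hle
    · exact h
    · rw [h] at hle ⊢
      rw [Fin.rev_rev] at hle
      have h3 : γ.row.rev = γ.col := le_antisymm hle γ.col_le_rev_row
      rw [h3, ← h3, Fin.rev_rev]
  have h3 : ∀ γ : PosRoot n, p ∈ γ.entries → ¬ p.2 ≤ p.1.rev → p = (γ.col.rev, γ.row.rev) := by
    rintro γ (h | h) hle
    · rw [h] at hle
      exact absurd γ.col_le_rev_row hle
    · exact h
  apply hne
  by_cases hle : p.2 ≤ p.1.rev
  · have h4 := (h2 α hp hle).symm.trans (h2 β hq hle)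
    exact PosRoot.ext (Prod.ext_iff.1 h4).1 (Prod.ext_iff.1 h4).2
  · have h4 := (h3 α hp hle).symm.trans (h3 β hq hle)
    exact PosRoot.ext (Fin.rev_injective (Prod.ext_iff.1 h4).2)
      (Fin.rev_injective (Prod.ext_iff.1 h4).1)

theorem addChar_basicFunctional (ψ : AddChar F ℂ) (D : Finset (PosRoot n)) (φ : PosRoot n → Fˣ)
    (x : usp n F) : ψ (basicFunctional D φ x) = ∏ α ∈ D, ψ (φ α * rootCoord F α x) := by
  classical
  rw [basicFunctional_apply]
  induction D using Finset.induction_on with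
  | empty => simp
  | insert a D ha ih => rw [Finset.sum_insert ha, Finset.prod_insert ha, AddChar.map_add_eq_mul, ih]

theorem andreNetoSupercharacter_eq_average [Finite F] [Fintype (UT (2 * n) F)] (h2 : (2 : F) ≠ 0)
    (f : SpringerMorphism n F) {ψ : AddChar F ℂ} (hψ : ψ ≠ 1) {D : Finset (PosRoot n)}
    (hD : IsBasic D) (φ : PosRoot n → Fˣ) (u : USp n F) :
    andreNetoSupercharacter ψ D φ u =
      (∏ α ∈ D, (Nat.card (USp n F) : ℂ) / Nat.card (elementarySubgroup F α)) *
        ((Nat.card (UT (2 * n) F) : ℂ)⁻¹ *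
          ∑ g : UT (2 * n) F, ψ (basicFunctional D φ (uspAction g (f.onUSp u)))) := by
  rw [andreNetoSupercharacter, Finset.prod_congr rfl fun α _ =>
    elementaryCharacter_eq_average h2 f hψ α (φ α) u, Finset.prod_mul_distrib]
  congr 1
  simp only [addChar_basicFunctional]
  exact (average_prod_eq_prod_average (utMat : UT (2 * n) F → _) utMat_injective exists_mixed_rows D
    (fun α => {α.row, α.col.rev}) (fun α hα β hβ hne => hD.disjoint_rows hα hβ hne) _
    fun α g g' h => by rw [rootCoord_uspAction_congr h]).symm

end ElementaryCharacters

/-! ### The size of the orbits under `H` -/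

section HalfOrbits

variable {n : ℕ} {F : Type*} [Field F]

theorem halfSubgroup_mixed_rows (R : Set (Fin (2 * n))) (g g' : halfSubgroup n F) :
    ∃ k : halfSubgroup n F,
      (∀ i ∈ R, utMat (k : UT (2 * n) F) i = utMat (g : UT (2 * n) F) i) ∧
      ∀ i, i ∉ R → utMat (k : UT (2 * n) F) i = utMat (g' : UT (2 * n) F) i := by
  obtain ⟨k, h1, h2⟩ := exists_mixed_rows R (g : UT (2 * n) F) g'
  refine ⟨⟨k, fun i j hij hj => ?_⟩, h1, h2⟩
  by_cases hi : i ∈ R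
  · rw [h1 i hi]
    exact g.2 i j hij hj
  · rw [h2 i hi]
    exact g'.2 i j hij hj

open Classical in
theorem average_halfSubgroup_basicFunctional [Finite F] [Fintype (halfSubgroup n F)]
    (h2 : (2 : F) ≠ 0) {ψ : AddChar F ℂ} (hψ : ψ ≠ 1) {D : Finset (PosRoot n)} (hD : IsBasic D)
    (φ : PosRoot n → Fˣ) (x : usp n F) :
    (Nat.card (halfSubgroup n F) : ℂ)⁻¹ *
        ∑ h : halfSubgroup n F, ψ (basicFunctional D φ (uspAction (h : UT (2 * n) F) x)) =
      if ∀ α ∈ D, x ∈ elementarySubspace F α then ψ (basicFunctional D φ x) else 0 := by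
  simp only [addChar_basicFunctional]
  rw [average_prod_eq_prod_average (fun h : halfSubgroup n F => utMat (h : UT (2 * n) F))
    (fun h h' hh => Subtype.ext (utMat_injective hh)) halfSubgroup_mixed_rows D
    (fun α => {α.row, α.col.rev}) (fun α hα β hβ hne => hD.disjoint_rows hα hβ hne)
    (fun α (h : halfSubgroup n F) => ψ (φ α * rootCoord F α (uspAction (h : UT (2 * n) F) x)))
    fun α g g' h => by rw [rootCoord_uspAction_congr h], Finset.prod_congr rfl fun α _ =>
    sum_halfSubgroup_addChar h2 hψ α (φ α) x]
  split_ifs with h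
  · exact Finset.prod_congr rfl fun α hα => if_pos (h α hα)
  · push Not at h
    obtain ⟨α, hα, hx⟩ := h
    exact Finset.prod_eq_zero hα (if_neg hx)

variable (n F) in
/-- The dual action of the subgroup `H`. -/
abbrev halfDualAction : MulAction (halfSubgroup n F) (Module.Dual F (usp n F)) :=
  representationAction ((uspRepresentation n F).dual.comp (halfSubgroup n F).subtype)

variable (n F) in
/-- The dual action of `UT_{2n}(F)`. -/
abbrev dualAction : MulAction (UT (2 * n) F) (Module.Dual F (usp n F)) :=
  representationAction (uspRepresentation n F).dual

theorem halfDualOrbit_eq (l : Module.Dual F (usp n F)) :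
    halfDualOrbit l = @MulAction.orbit _ _ (halfDualAction n F).toSMul l := by
  ext μ
  constructor
  · rintro ⟨h, hh, rfl⟩
    exact ⟨⟨h, hh⟩, rfl⟩
  · rintro ⟨h, rfl⟩
    exact ⟨h, h.2, rfl⟩

theorem dualOrbit_eq (l : Module.Dual F (usp n F)) :
    dualOrbit l = @MulAction.orbit _ _ (dualAction n F).toSMul l := by
  ext μ
  constructor
  · rintro ⟨h, rfl⟩
    exact ⟨h, rfl⟩
  · rintro ⟨h, rfl⟩
    exact ⟨h, rfl⟩

theorem finite_dual [Finite F] : Finite (Module.Dual F (usp n F)) := Module.finite_of_finite F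

/-- The average over `H` of the character of `l` is a normalized sum of characters over the orbit
`H · l`; pairing it with the character of `l` computes the size of the orbit. -/
theorem ncard_halfDualOrbit_mul_card [Finite F] (h2 : (2 : F) ≠ 0) {ψ : AddChar F ℂ} (hψ : ψ ≠ 1)
    {D : Finset (PosRoot n)} (hD : IsBasic D) (φ : PosRoot n → Fˣ) :
    ((halfDualOrbit (basicFunctional D φ)).ncard : ℂ) *
      Nat.card {x : usp n F // ∀ α ∈ D, x ∈ elementarySubspace F α} = Nat.card (usp n F) := by
  classical
  have := Fintype.ofFinite (halfSubgroup n F)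
  have := Fintype.ofFinite (usp n F)
  have := finite_dual (n := n) (F := F)
  set l := basicFunctional D φ with hl
  set O := halfDualOrbit l with hO
  have hlO : l ∈ O := by
    rw [hO, halfDualOrbit_eq]
    exact @MulAction.mem_orbit_self (halfSubgroup n F) _ _ (halfDualAction n F) l
  have hOne : (O.ncard : ℂ) ≠ 0 := by
    rw [Nat.cast_ne_zero, ← Nat.pos_iff_ne_zero, Set.ncard_pos]
    exact ⟨l, hlO⟩
  have hH : (Nat.card (halfSubgroup n F) : ℂ) ≠ 0 := Nat.cast_ne_zero.2 Nat.card_pos.ne'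
  have h1 : ∀ x : usp n F, (O.ncard : ℂ) *
      (if ∀ α ∈ D, x ∈ elementarySubspace F α then ψ (l x) else 0) = ∑ᶠ μ ∈ O, ψ (μ x) := by
    intro x
    have h3 := @sum_smul_eq_orbit_sum (halfSubgroup n F) _ _ _ _ (halfDualAction n F) l
      (fun μ => ψ (μ x))
    rw [← halfDualOrbit_eq, ← hO] at h3
    rw [← average_halfSubgroup_basicFunctional h2 hψ hD φ x, ← hl]
    have h4 : ∑ h : halfSubgroup n F, ψ (l (uspAction (h : UT (2 * n) F) x)) =
        Nat.card (halfSubgroup n F) / (O.ncard : ℂ) * ∑ᶠ μ ∈ O, ψ (μ x) := by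
      rw [← h3]
      refine Fintype.sum_equiv (Equiv.inv _) _ _ fun h => ?_
      change ψ (l (uspAction (h : UT (2 * n) F) x)) =
        ψ (l (uspAction ((((h⁻¹ : halfSubgroup n F) : UT (2 * n) F))⁻¹) x))
      rw [Subgroup.coe_inv, inv_inv]
    rw [h4]
    field_simp
  -- Only the term of `l` in the sum over the orbit is not orthogonal to the character of `l`.
  have h5 : ∑ x : usp n F, ψ (-(l x)) * ((O.ncard : ℂ) *
      (if ∀ α ∈ D, x ∈ elementarySubspace F α then ψ (l x) else 0)) = Nat.card (usp n F) := by
    simp only [h1]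
    have hfin : O.Finite := Set.toFinite O
    simp only [finsum_mem_eq_finite_toFinset_sum _ hfin, Finset.mul_sum]
    rw [Finset.sum_comm, Finset.sum_eq_single l]
    · simp [← AddChar.map_add_eq_mul]
    · intro μ _ hμ
      rw [← sum_addChar_apply_dual_eq_zero hψ (sub_ne_zero.2 hμ)]
      refine Finset.sum_congr rfl fun x _ => ?_
      rw [← AddChar.map_add_eq_mul, LinearMap.sub_apply, neg_add_eq_sub]
    · exact fun h => absurd (hfin.mem_toFinset.2 hlO) h
  rw [← h5, Nat.card_eq_fintype_card, Fintype.card_subtype, Finset.card_filter, Nat.cast_sum,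
    Finset.mul_sum]
  refine Finset.sum_congr rfl fun x _ => ?_
  split_ifs
  · rw [mul_left_comm, ← AddChar.map_add_eq_mul, neg_add_cancel, AddChar.map_zero_eq_one,
      Nat.cast_one]
  · simp

/-- The root coordinates are independent. -/
theorem card_usp_eq_card_mul_pow [Finite F] (S : Finset (PosRoot n)) :
    Nat.card (usp n F) =
      Nat.card {x : usp n F // ∀ β ∈ S, rootCoord F β x = 0} * Nat.card F ^ S.card := by
  classical
  let T : usp n F →ₗ[F] (S → F) := LinearMap.pi fun β => rootCoord F (β : PosRoot n)
  have hT : Function.Surjective T := by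
    intro c
    refine ⟨∑ β : S, c β • uspRootVector F (β : PosRoot n), funext fun γ => ?_⟩
    change rootCoord F (γ : PosRoot n) _ = c γ
    rw [map_sum, Finset.sum_eq_single γ]
    · simp [rootCoord_uspRootVector]
    · intro β _ hβ
      have : (γ : PosRoot n) ≠ β := fun h => hβ (Subtype.ext h.symm)
      simp [rootCoord_uspRootVector, this]
    · simp
  have h1 : Nat.card {x : usp n F // ∀ β ∈ S, rootCoord F β x = 0} =
      Nat.card (LinearMap.ker T) := by
    refine Nat.card_congr (Equiv.subtypeEquivRight fun x => ?_)
    rw [LinearMap.mem_ker]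
    constructor
    · exact fun h => funext fun β => h β β.2
    · exact fun h β hβ => congrFun h ⟨β, hβ⟩
  have h3 := LinearMap.finrank_range_add_finrank_ker T
  rw [LinearMap.range_eq_top.2 hT, finrank_top, Module.finrank_fintype_fun_eq_card,
    Fintype.card_coe] at h3
  rw [h1, Module.natCard_eq_pow_finrank (K := F) (V := usp n F),
    Module.natCard_eq_pow_finrank (K := F) (V := LinearMap.ker T), ← h3, ← pow_add, add_comm]

open Classical in
/-- The roots whose coordinates have to vanish on the elements of `𝔲_α`. -/
noncomputable def elementaryRoots (α : PosRoot n) : Finset (PosRoot n) :=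
  Finset.univ.filter fun β => (β.col : ℕ) < n ∧
    ((β.row = α.row ∧ β.col < α.col) ∨ β.row = α.col.rev)

theorem mem_elementarySubspace_iff (α : PosRoot n) (x : usp n F) :
    x ∈ elementarySubspace F α ↔ ∀ β ∈ elementaryRoots α, rootCoord F β x = 0 := by
  constructor
  · intro hx β hβ
    obtain ⟨-, hβ, ⟨h1, h2⟩ | h1⟩ := Finset.mem_filter.1 hβ
    · rw [rootCoord_apply, h1]
      exact (hx _ hβ).1 h2
    · rw [rootCoord_apply, h1]
      exact (hx _ hβ).2
  · intro hx k hk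
    have key : ∀ i : Fin (2 * n), i < k → ((i = α.row ∧ k < α.col) ∨ i = α.col.rev) →
        (x : Matrix (Fin (2 * n)) (Fin (2 * n)) F) i k = 0 := by
      intro i hik h
      have h1 : k ≤ i.rev := by
        rw [Fin.lt_def] at hik
        rw [Fin.le_def, Fin.val_rev]
        omega
      exact hx ⟨(i, k), hik, h1⟩ (Finset.mem_filter.2 ⟨Finset.mem_univ _, hk, h⟩)
    constructor
    · intro hkc
      rcases lt_or_ge α.row k with h | h
      · exact key _ h (Or.inl ⟨rfl, hkc⟩)
      · exact x.2.1 _ _ h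
    · rcases lt_or_ge α.col.rev k with h | h
      · exact key _ h (Or.inr rfl)
      · exact x.2.1 _ _ h

theorem card_USp_div_card_elementarySubgroup [Finite F] (f : SpringerMorphism n F) (α : PosRoot n) :
    (Nat.card (USp n F) : ℂ) / Nat.card (elementarySubgroup F α) =
      Nat.card F ^ (elementaryRoots α).card := by
  have h1 : Nat.card (elementarySubgroup F α) =
      Nat.card {x : usp n F // ∀ β ∈ elementaryRoots α, rootCoord F β x = 0} := by
    refine Nat.card_congr (f.uspEquiv.subtypeEquiv fun v => ?_)
    rw [← mem_elementarySubspace_iff, f.uspEquiv_apply, onUSp_mem_elementarySubspace_iff]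
  have h2 := card_usp_eq_card_mul_pow (F := F) (elementaryRoots α)
  rw [← h1] at h2
  rw [Nat.card_congr f.uspEquiv, h2, Nat.cast_mul, Nat.cast_pow, mul_div_cancel_left₀]
  exact Nat.cast_ne_zero.2 Nat.card_pos.ne'

/-- The size of the `H`-orbit of a basic functional is the degree of the supercharacter of `(D, φ)`:
the indices of the `U_α` are the powers of `|F|` counting the vanishing coordinates of `𝔲_α`, and
these sets of coordinates are disjoint. -/
theorem ncard_halfDualOrbit_basicFunctional [Finite F] (h2 : (2 : F) ≠ 0)
    (f : SpringerMorphism n F) {ψ : AddChar F ℂ} (hψ : ψ ≠ 1)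
    {D : Finset (PosRoot n)} (hD : IsBasic D) (φ : PosRoot n → Fˣ) :
    ((halfDualOrbit (basicFunctional D φ)).ncard : ℂ) =
      ∏ α ∈ D, (Nat.card (USp n F) : ℂ) / Nat.card (elementarySubgroup F α) := by
  classical
  have hdisj : Set.PairwiseDisjoint (D : Set (PosRoot n)) elementaryRoots := by
    intro α hα β hβ hne
    rw [Function.onFun, Finset.disjoint_left]
    intro γ hγ hγ'
    have h1 : ∀ α : PosRoot n, γ ∈ elementaryRoots α →
        γ.row ∈ ({α.row, α.col.rev} : Set (Fin (2 * n))) := by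
      intro α h
      obtain ⟨-, -, h | h⟩ := Finset.mem_filter.1 h
      · exact Or.inl h.1
      · exact Or.inr h
    exact Set.disjoint_left.1 (hD.disjoint_rows hα hβ hne) (h1 α hγ) (h1 β hγ')
  have h3 := ncard_halfDualOrbit_mul_card h2 hψ hD φ
  have h4 := card_usp_eq_card_mul_pow (F := F) (D.biUnion elementaryRoots)
  have h5 : Nat.card {x : usp n F // ∀ β ∈ D.biUnion elementaryRoots, rootCoord F β x = 0} =
      Nat.card {x : usp n F // ∀ α ∈ D, x ∈ elementarySubspace F α} := by
    refine Nat.card_congr (Equiv.subtypeEquivRight fun x => ?_)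
    simp only [mem_elementarySubspace_iff, Finset.mem_biUnion]
    exact ⟨fun h α hα β hβ => h β ⟨α, hα, hβ⟩, fun h β ⟨α, hα, hβ⟩ => h α hα β hβ⟩
  have : Nonempty {x : usp n F // ∀ α ∈ D, x ∈ elementarySubspace F α} :=
    ⟨⟨0, fun α _ => Submodule.zero_mem _⟩⟩
  rw [h4, h5, Nat.cast_mul, mul_comm, Finset.card_biUnion hdisj] at h3
  rw [mul_left_cancel₀ (Nat.cast_ne_zero.2 Nat.card_pos.ne') h3, Finset.prod_congr rfl fun α _ =>
    card_USp_div_card_elementarySubgroup f α, Finset.prod_pow_eq_pow_sum, Nat.cast_pow]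

end HalfOrbits

/-! ### Comparison of the two theories -/

section Comparison

variable {n : ℕ} {F : Type*} [Field F]

theorem actionSupercharacter_eq_average [Finite F] [Fintype (UT (2 * n) F)]
    (f : SpringerMorphism n F) (θ : AddChar F ℂ) (l : Module.Dual F (usp n F)) (u : USp n F) :
    actionSupercharacter f θ l u = ((halfDualOrbit l).ncard : ℂ) *
      ((Nat.card (UT (2 * n) F) : ℂ)⁻¹ *
        ∑ g : UT (2 * n) F, θ (l (uspAction g (f.onUSp u)))) := by
  have := finite_dual (n := n) (F := F)
  have h3 := @sum_smul_eq_orbit_sum (UT (2 * n) F) _ _ _ _ (dualAction n F) l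
    (fun μ => θ (μ (f.onUSp u)))
  rw [← dualOrbit_eq] at h3
  have h4 : ∑ g : UT (2 * n) F, θ (l (uspAction g (f.onUSp u))) =
      Nat.card (UT (2 * n) F) / ((dualOrbit l).ncard : ℂ) *
        ∑ᶠ μ ∈ dualOrbit l, θ (μ (f.onUSp u)) := by
    rw [← h3]
    refine Fintype.sum_equiv (Equiv.inv _) _ _ fun g => ?_
    change θ (l (uspAction g _)) = θ (l (uspAction (g⁻¹)⁻¹ _))
    rw [inv_inv]
  have hG : (Nat.card (UT (2 * n) F) : ℂ) ≠ 0 := Nat.cast_ne_zero.2 Nat.card_pos.ne'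
  rw [h4, actionSupercharacter, div_mul_eq_mul_div, mul_div_assoc, div_mul_eq_mul_div,
    mul_div_assoc, inv_mul_cancel_left₀ hG]

theorem actionSupercharacter_basicFunctional [Finite F] (h2 : (2 : F) ≠ 0)
    (f : SpringerMorphism n F) {ψ : AddChar F ℂ} (hψ : ψ ≠ 1) {D : Finset (PosRoot n)}
    (hD : IsBasic D) (φ : PosRoot n → Fˣ) :
    actionSupercharacter f ψ (basicFunctional D φ) = andreNetoSupercharacter ψ D φ := by
  have := Fintype.ofFinite (UT (2 * n) F)
  ext u
  rw [andreNetoSupercharacter_eq_average h2 f hψ hD, actionSupercharacter_eq_average,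
    ncard_halfDualOrbit_basicFunctional h2 f hψ hD]

/-- Conjugation by `UT_{2n}(F)` preserves `H`, the kernel of the restriction to the first block. -/
theorem conj_mem_halfGroup {h : UT (2 * n) F} (hh : h ∈ halfGroup n F) (g : UT (2 * n) F) :
    g * h * g⁻¹ ∈ halfGroup n F := by
  rw [mem_halfGroup_iff] at hh ⊢
  rw [utMat_mul, utMat_mul, Matrix.mul_assoc, ← firstHalf_mul_mul_firstHalf, ← Matrix.mul_assoc,
    ← Matrix.mul_assoc, Matrix.mul_assoc _ (utMat h), hh, Matrix.mul_assoc, Matrix.mul_assoc,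
    ← Matrix.mul_assoc (firstHalf n F), firstHalf_mul_mul_firstHalf, ← Matrix.mul_assoc,
    utMat_mul_inv, Matrix.one_mul]

theorem comp_uspAction_injective (g : UT (2 * n) F) :
    Function.Injective fun l : Module.Dual F (usp n F) => l ∘ₗ uspAction g := by
  intro l l' h
  refine LinearMap.ext fun x => ?_
  have := LinearMap.congr_fun h (uspAction g⁻¹ x)
  simpa [← uspAction_mul, uspAction_one] using this

theorem ncard_halfDualOrbit_comp (l : Module.Dual F (usp n F)) (g : UT (2 * n) F) :
    (halfDualOrbit (l ∘ₗ uspAction g)).ncard = (halfDualOrbit l).ncard := by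
  rw [← Set.ncard_image_of_injective (halfDualOrbit l) (comp_uspAction_injective g)]
  congr 1
  have key : ∀ h : UT (2 * n) F, uspDualAction h (l ∘ₗ uspAction g) =
      uspDualAction (g * h * g⁻¹) l ∘ₗ uspAction g := by
    intro h
    refine LinearMap.ext fun x => ?_
    change l (uspAction g (uspAction h⁻¹ x)) = l (uspAction (g * h * g⁻¹)⁻¹ (uspAction g x))
    rw [← uspAction_mul, ← uspAction_mul]
    congr 3
    group
  ext μ
  constructor
  · rintro ⟨h, hh, rfl⟩
    exact ⟨_, ⟨_, conj_mem_halfGroup hh g, rfl⟩, (key h).symm⟩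
  · rintro ⟨_, ⟨h, hh, rfl⟩, rfl⟩
    refine ⟨g⁻¹ * h * g, ?_, ?_⟩
    · simpa using conj_mem_halfGroup hh g⁻¹
    · rw [key]
      congr 2
      group

theorem actionSupercharacter_comp [Finite F] (f : SpringerMorphism n F) (θ : AddChar F ℂ)
    (l : Module.Dual F (usp n F)) (g : UT (2 * n) F) :
    actionSupercharacter f θ (l ∘ₗ uspAction g) = actionSupercharacter f θ l := by
  have := Fintype.ofFinite (UT (2 * n) F)
  ext u
  rw [actionSupercharacter_eq_average, actionSupercharacter_eq_average, ncard_halfDualOrbit_comp]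
  congr 2
  exact Fintype.sum_equiv (Equiv.mulLeft g) _ _ fun a => by
    rw [Equiv.coe_mulLeft, uspAction_mul, LinearMap.comp_apply]

theorem exists_actionSupercharacter_eq [Finite F] (h2 : (2 : F) ≠ 0) (f : SpringerMorphism n F)
    {θ : AddChar F ℂ} (hθ : θ ≠ 1) (l : Module.Dual F (usp n F)) :
    ∃ (D : Finset (PosRoot n)) (φ : PosRoot n → Fˣ), IsBasic D ∧
      actionSupercharacter f θ l = andreNetoSupercharacter θ D φ := by
  obtain ⟨g, D, φ, hD, hl⟩ := exists_comp_uspAction_eq_basicFunctional h2 l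
  exact ⟨D, φ, hD, by
    rw [← actionSupercharacter_comp f θ l g, hl, actionSupercharacter_basicFunctional h2 f hθ hD]⟩

theorem isComplexCharacter_andreNetoSupercharacter [Finite F] (ψ : AddChar F ℂ)
    (D : Finset (PosRoot n)) (φ : PosRoot n → Fˣ) :
    IsComplexCharacter (andreNetoSupercharacter ψ D φ) := by
  convert isComplexCharacter_prod D (fun α => elementaryCharacter ψ α (φ α))
    fun α _ => isComplexCharacter_elementaryCharacter ψ α (φ α) using 1
  ext u
  rw [andreNetoSupercharacter, Finset.prod_apply]

/-- Any two nontrivial additive characters of a finite field differ by a dilation. -/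
theorem exists_unit_addChar_eq [Finite F] {θ ψ : AddChar F ℂ} (hθ : θ ≠ 1) (hψ : ψ ≠ 1) :
    ∃ c : Fˣ, ∀ t, ψ t = θ (c * t) := by
  have := Fintype.ofFinite F
  have hinj : Function.Injective θ.mulShift :=
    AddChar.to_mulShift_inj_of_isPrimitive (AddChar.IsPrimitive.of_ne_one hθ)
  obtain ⟨c, hc⟩ := ((Fintype.bijective_iff_injective_and_card _).2
    ⟨hinj, AddChar.card_eq.symm⟩).2 ψ
  have hc0 : c ≠ 0 := by
    rintro rfl
    exact hψ (by rw [← hc, AddChar.mulShift_zero])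
  exact ⟨Units.mk0 c hc0, fun t => by rw [← hc, AddChar.mulShift_apply, Units.val_mk0]⟩

theorem andreNetoSupercharacter_of_addChar_eq {θ ψ : AddChar F ℂ} {c : Fˣ}
    (hc : ∀ t, ψ t = θ (c * t)) (D : Finset (PosRoot n)) (φ : PosRoot n → Fˣ) :
    andreNetoSupercharacter ψ D φ = andreNetoSupercharacter θ D fun α => c * φ α := by
  ext u
  simp only [andreNetoSupercharacter, elementaryCharacter, hc, Units.val_mul, mul_assoc]

theorem actionTheory_eq_andreNetoTheory [Finite F] (h2 : (2 : F) ≠ 0) (f : SpringerMorphism n F)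
    {θ ψ : AddChar F ℂ} (hθ : θ ≠ 1) (hψ : ψ ≠ 1) :
    actionTheory f θ = andreNetoTheory n ψ := by
  refine Prod.ext (range_actionSuperclass_eq_andreNeto h2 f) (Set.ext fun χ => ?_)
  obtain ⟨c, hc⟩ := exists_unit_addChar_eq hψ hθ
  obtain ⟨d, hd⟩ := exists_unit_addChar_eq hθ hψ
  constructor
  · rintro ⟨l, rfl⟩
    obtain ⟨D, φ, hD, h⟩ := exists_actionSupercharacter_eq h2 f hθ l
    exact ⟨D, _, hD, h.trans (andreNetoSupercharacter_of_addChar_eq hc D φ)⟩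
  · rintro ⟨D, φ, hD, rfl⟩
    exact ⟨basicFunctional D fun α => d * φ α, by
      rw [actionSupercharacter_basicFunctional h2 f hθ hD,
        andreNetoSupercharacter_of_addChar_eq hd]⟩

theorem isSupercharacterTheory_actionTheory [Finite F] (h2 : (2 : F) ≠ 0)
    (f : SpringerMorphism n F) {θ : AddChar F ℂ} (hθ : θ ≠ 1) :
    IsSupercharacterTheory (actionTheory f θ) := by
  have := Fintype.ofFinite (UT (2 * n) F)
  have := finite_dual (n := n) (F := F)
  refine isSupercharacterTheory_of_orbits (uspRepresentation n F) f.uspEquiv f.onUSp_one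
    (fun u v => ⟨u, f.onUSp_conj v u⟩) hθ (actionSupercharacter f θ)
    (fun l => ((halfDualOrbit l).ncard : ℂ) * (Nat.card (UT (2 * n) F) : ℂ)⁻¹) (fun l => ?_)
    (fun l u => ?_) (fun l a => actionSupercharacter_comp f θ l a) (fun l => ?_)
  · refine mul_ne_zero ?_ (inv_ne_zero (Nat.cast_ne_zero.2 Nat.card_pos.ne'))
    rw [Nat.cast_ne_zero, ← Nat.pos_iff_ne_zero, Set.ncard_pos, halfDualOrbit_eq]
    exact ⟨l, @MulAction.mem_orbit_self (halfSubgroup n F) _ _ (halfDualAction n F) l⟩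
  · rw [actionSupercharacter_eq_average, finsum_eq_sum_of_fintype, mul_assoc]
    rfl
  · obtain ⟨D, φ, -, h⟩ := exists_actionSupercharacter_eq h2 f hθ l
    rw [h]
    exact isComplexCharacter_andreNetoSupercharacter θ D φ

end Comparison

theorem mainTheorem7 (n : ℕ) (F : Type*) [Field F] [Finite F] (hF : ringChar F ≠ 2) :
    Nonempty (SpringerMorphism n F) ∧
    ∀ (f : SpringerMorphism n F) (θ ψ : AddChar F ℂ), θ ≠ 1 → ψ ≠ 1 →
      IsSupercharacterTheory (actionTheory f θ) ∧
      IsSupercharacterTheory (andreNetoTheory n ψ) ∧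
      actionTheory f θ = andreNetoTheory n ψ ∧
      (actionTheory f θ).1 = superclassIntersections n F ∧
      (andreNetoTheory n ψ).1 = superclassIntersections n F := by
  have h2 : (2 : F) ≠ 0 := Ring.two_ne_zero hF
  refine ⟨nonempty_springerMorphism h2, fun f θ ψ hθ hψ => ?_⟩
  have h := actionTheory_eq_andreNetoTheory h2 f hθ hψ
  have hS := isSupercharacterTheory_actionTheory h2 f hθ
  have hK : (actionTheory f θ).1 = superclassIntersections n F := range_actionSuperclass h2 f
  exact ⟨hS, h ▸ hS, h, hK, h ▸ hK⟩
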